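/- Let $d\ge 1$ and $0<\lambda<\Lambda$, and write $z=(t,x,v)\in\mathbb R\times\mathbb R^d\times\mathbb R^d$, $\mathcal T=\partial_t+v\cdot\nabla_x$. Let $\mathcal U\subset\mathbb R^{1+2d}$ be open and consider on $\mathcal U$ the equation $$\partial_t f+v\cdot\nabla_x f=\nabla_v\cdot(A\nabla_v f)+B\cdot\nabla_v f+S ,\qquad (*)$$ where $A$ is a measurable field of real symmetric $d\times d$ matrices with eigenvalues in $[\lambda,\Lambda]$, $B$ is a measurable vector field with $|B|\le\Lambda$, and $S\in L^\infty(\mathcal U)$ is real-valued. A function $f:\mathcal U\to\mathbb R$ is a weak sub-solution of $(*)$ on $\mathcal U$ if $f\in L^2(\mathcal U)$, $\nabla_v f\in L^2(\mathcal U)$ (in the sense of distributions), $\operatorname{ess\,sup}_t\int_{\{(x,v):(t,x,v)\in\mathcal U\}}f(t,x,v)^2\,dx\,dv<\infty$, and for all $\beta\in C^2(\mathbb R;\mathbb R)$ with $\beta'\ge 0$ and $\beta''\ge 0$ both bounded and all non-negative $\varphi\in C_c^\infty(\mathcal U)$, $$-\int_{\mathcal U}\beta(f)\,\mathcal T\varphi\,dz\le-\int_{\mathcal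 U}A\nabla_v\beta(f)\cdot\nabla_v\varphi\,dz+\int_{\mathcal U}\big[B\cdot\nabla_v\beta(f)+S\beta'(f)\big]\varphi\,dz .$$ (If $\mathcal U=(a,b)\times\Omega_x\times\Omega_v$, the first three conditions say $f\in L^\infty((a,b);L^2(\Omega_x\times\Omega_v))\cap L^2((a,b)\times\Omega_x;H^1(\Omega_v))$.) For $z_0=(t_0,x_0,v_0)$ and $r>0$ let $$Q_r(z_0)=\{(t,x,v):\ -r^2<t-t_0\le 0,\ |x-x_0-(t-t_0)v_0|<r^3,\ |v-v_0|<r\}.$$ **Proposition.** For every $\zeta_0>0$ there is a constant $C>0$ depending only on $d,\lambda,\Lambda,\zeta_0$ such that, for all $\mathcal U,A,B,S$ as above, every weak sub-solution $f$ of $(*)$ on $\mathcal U$ that is non-negative almost everywhere, all $z_0$ and $0<r<R\le 1$ with $Q_R(z_0)\subset\mathcal U$, and every $\zeta\in[\zeta_0,\infty)$, $$\|f\|_{L^\infty(Q_r(z_0))}\le C\left(\frac{1+|v_0|}{r^2(R-r)^3}\right)^{\frac{1+4d}{\zeta}}\Big[\|f\|_{L^\zeta(Q_R(z_0))}+\|S\|_{L^\infty(Q_R(z_0))}\Big],$$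 where $\|f\|_{L^\zeta(Q)}=\left(\int_Q|f|^\zeta\,dz\right)^{1/\zeta}\in[0,\infty]$. -/

import Mathlib

open MeasureTheory Set
open scoped ENNReal NNReal ContDiff

noncomputable section

namespace KineticFP

/-- Position or velocity space `ℝ^d` with its Euclidean norm. -/
abbrev Sp (d : ℕ) : Type := EuclideanSpace ℝ (Fin d)

/-- Phase space-time `ℝ^{1+2d}`, with points `z = (t, x, v)` and Lebesgue measure `volume`. -/
abbrev Ph (d : ℕ) : Type := ℝ × Sp d × Sp d

variable {d : ℕ}

/-- The kinetic cylinder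
`Q_r(z₀) = {-r² < t - t₀ ≤ 0, |x - x₀ - (t - t₀) v₀| < r³, |v - v₀| < r}`. -/
def cylinder (z₀ : Ph d) (r : ℝ) : Set (Ph d) :=
  {z | -r ^ 2 < z.1 - z₀.1 ∧ z.1 - z₀.1 ≤ 0 ∧
    ‖z.2.1 - z₀.2.1 - (z.1 - z₀.1) • z₀.2.2‖ < r ^ 3 ∧ ‖z.2.2 - z₀.2.2‖ < r}

/-- The free transport operator `𝒯 φ = ∂_t φ + v · ∇_x φ`, for differentiable `φ`: the derivative
of `φ` at `z = (t, x, v)` in the direction `(1, v, 0)`. -/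
def transport (φ : Ph d → ℝ) (z : Ph d) : ℝ := fderiv ℝ φ z (1, z.2.2, 0)

/-- The classical velocity gradient `∇_v φ`. -/
def gradV (φ : Ph d → ℝ) (z : Ph d) : Sp d := gradient (fun w => φ (z.1, z.2.1, w)) z.2.2

/-- Test functions `φ ∈ C_c^∞(U)`. -/
def IsTestFun (U : Set (Ph d)) (φ : Ph d → ℝ) : Prop :=
  ContDiff ℝ ∞ φ ∧ HasCompactSupport φ ∧ tsupport φ ⊆ U

/-- `G` is the velocity gradient `∇_v f` of `f` in the sense of distributions in `U`
(both being locally integrable on `U`). -/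
def IsWeakGradV (U : Set (Ph d)) (f : Ph d → ℝ) (G : Ph d → Sp d) : Prop :=
  LocallyIntegrableOn f U ∧ LocallyIntegrableOn G U ∧
    ∀ φ : Ph d → ℝ, IsTestFun U φ →
      ∫ z in U, f z • gradV φ z = -∫ z in U, φ z • G z

/-- The hypotheses on the coefficients on `U`: `A` is a measurable field of real symmetric matrices
with eigenvalues in `[lam, Lam]`, `B` is a measurable vector field with `|B| ≤ Lam`, and `S` is a
real scalar field in `L^∞(U)`. -/
structure IsAdmissible (lam Lam : ℝ) (U : Set (Ph d))
    (A : Ph d → Matrix (Fin d) (Fin d) ℝ) (B : Ph d → Sp d) (S : Ph d → ℝ) : Prop where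
  aemeasurable_A : ∀ i j, AEMeasurable (fun z => A z i j) (volume.restrict U)
  symm_A : ∀ᵐ z ∂volume.restrict U, (A z).IsSymm
  eigenvalues_A : ∀ᵐ z ∂volume.restrict U, ∀ μ : ℝ,
    Module.End.HasEigenvalue (Matrix.toLin' (A z)) μ → μ ∈ Icc lam Lam
  aemeasurable_B : AEMeasurable B (volume.restrict U)
  bound_B : ∀ᵐ z ∂volume.restrict U, ‖B z‖ ≤ Lam
  memLp_S : MemLp S ∞ (volume.restrict U)

/-- `f ∈ L^∞_t L²_{x,v} ∩ L²_{t,x} H¹_v` on `U`. For `U = (a,b) × Ω_x × Ω_v` this is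
`L^∞((a,b); L²(Ω_x × Ω_v)) ∩ L²((a,b) × Ω_x; H¹(Ω_v))`; for a general open set the `L²` norm in
`(x, v)` is taken on the slice of `U` at time `t`. -/
structure InEnergySpace (U : Set (Ph d)) (f : Ph d → ℝ) : Prop where
  memLp : MemLp f 2 (volume.restrict U)
  slices : ∃ M : ℝ≥0, ∀ᵐ t : ℝ,
    eLpNorm (fun p : Sp d × Sp d => f (t, p)) 2 (volume.restrict {p | (t, p) ∈ U}) ≤ M
  grad : ∃ G : Ph d → Sp d, IsWeakGradV U f G ∧ MemLp G 2 (volume.restrict U)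

/-- Weak sub-solutions on `U` of
`∂_t f + v · ∇_x f = ∇_v · (A ∇_v f) + B · ∇_v f + S`: `f` lies in the energy space and, for
every `β ∈ C²` with `β', β'' ≥ 0` bounded and every non-negative `φ ∈ C_c^∞(U)`,
`-∫ β(f) 𝒯φ ≤ -∫ A ∇_v β(f) · ∇_v φ + ∫ (B · ∇_v β(f) + S β'(f)) φ`.
Here `H` is the distributional gradient `∇_v β(f)` (unique up to null sets). -/
structure IsWeakSubSolution (U : Set (Ph d)) (A : Ph d → Matrix (Fin d) (Fin d) ℝ)
    (B : Ph d → Sp d) (S : Ph d → ℝ) (f : Ph d → ℝ) : Prop where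
  inEnergySpace : InEnergySpace U f
  renormalized : ∀ β : ℝ → ℝ, ContDiff ℝ 2 β →
    (∀ s, 0 ≤ deriv β s) → (∀ s, 0 ≤ deriv (deriv β) s) →
    (∃ K : ℝ, ∀ s, deriv β s ≤ K ∧ deriv (deriv β) s ≤ K) →
    ∃ H : Ph d → Sp d, IsWeakGradV U (fun z => β (f z)) H ∧
      ∀ φ : Ph d → ℝ, IsTestFun U φ → (∀ z, 0 ≤ φ z) →
        -∫ z in U, β (f z) * transport φ z ≤
          -(∫ z in U, inner ℝ (Matrix.toEuclideanLin (A z) (H z)) (gradV φ z)) +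
            ∫ z in U, (inner ℝ (B z) (H z) + S z * deriv β (f z)) * φ z

end KineticFP

end

/-!
# Local boundedness of sub-solutions of kinetic Fokker-Planck equations

The proof is a De Giorgi iteration for the hypoelliptic operator `𝒯 - ∇_v · (A ∇_v)`. The free
transport `𝒯` and `∇_v` are left-invariant for the group of Galilean translations
(`KineticFP.gal`) and homogeneous for the kinetic dilations, so all estimates are made on the box
`(-1, 0) × B_1 × B_1` and transferred to cylinders by `KineticFP.zoom`.

A smooth convex truncation `g = β(f)` of a weak sub-solution is again a sub-solution
(`KineticFP.IsWeakSubSolution.hasTruncations`). It satisfies the Caccioppoli inequality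
(`KineticFP.EnergySub.exists_caccioppoli`), which bounds `∇_v g` in `L²`, but there is no bound on
derivatives in the other directions, and the Sobolev inequality in `v` alone gives no gain of
integrability in `t` and `x`. The gain is obtained by duality. For a test function `ψ`, consider the
curves of `KineticFP.pathPt`, whose velocity is `τ m₁ + τ² m₂` at time `τ³`. The two parameters
`m₁, m₂` suffice to reach every position and velocity at a given time, and averaging `ψ` over the
curves that start at `z` produces `φ ≥ 0` and `Φ` with `-𝒯 φ = ψ + ∇_v · Φ`
(`KineticFP.transport_pathAvg_add`). Moreover `∇_v φ` is an average of the same kind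
(`KineticFP.dV_pathAvg_dualWeight`), and all such averages are bounded in `L²` by
`τ₀ ‖ψ‖₂ + τ₀^(-N) ‖ψ‖₁` for every `τ₀ ∈ (0, 1]` (`KineticFP.exists_eLpNorm_pathAvg_le`): short
curves contribute little, and for long ones the average has a bounded density. Testing the
inequality for `g` with `φ`, and the weak gradient of `g` with `Φ`, bounds `∫ g ψ`
(`KineticFP.EnergySub.exists_duality`). For `ψ = g` the term `‖g‖₁` is quadratic in the norm of the
lower truncation `(f - k)₊`, by Chebyshev's inequality (`KineticFP.EnergySub.exists_gain`). The
iteration over levels and radii then gives `f ≤ K` on the half box as soon as `K` dominates a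
multiple of `‖f‖₂` and the source (`KineticFP.HasTruncations.exists_ae_le`).

To pass from `L²` to `L^p` with `p = min ζ₀ 1`, the mean square is interpolated between `L^∞` and
`L^p` on concentric cylinders, and the `L^∞` norm is absorbed by iteration over the radii
(`KineticFP.exists_ae_le_of_hasLocalBound`). Hölder's inequality on cylinders of radius `δ = R - r`
then replaces `L^p` by `L^ζ`, at the price of the power `δ^(-(4d+2)/ζ)` that corresponds to the
volume `δ^(4d+2)`, so the constant is uniform in `ζ ≥ ζ₀`. Such cylinders with end point in the
cylinder of radius `r` lie in the one of radius `R` (`KineticFP.cylinder_subset_cylinder`), and a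
bound near every point is a bound almost everywhere
(`KineticFP.ae_cylinder_of_forall_openCylinder`).
-/

open Filter Topology

noncomputable section

namespace KineticFP

variable {d : ℕ}

/-! ### Smooth averages -/

section KernelIntegral

variable {F : Type*} [NormedAddCommGroup F] [NormedSpace ℝ F] {k : Ph d → ℝ} {K : Ph d → Ph d → F}

/-- The weight `k` and the kernel `K` have a product `k(p) K(p, z)` with compact support in `p`,
locally uniformly in `z`. -/
def LocCompactKernel (k : Ph d → ℝ) (K : Ph d → Ph d → F) : Prop :=
  ∀ R : ℝ, ∃ C : Set (Ph d), IsCompact C ∧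
    ∀ z ∈ Metric.ball (0 : Ph d) R, ∀ p ∉ C, k p • K p z = 0

theorem contDiff_fderiv_kernel (hK : ContDiff ℝ ∞ (Function.uncurry K)) :
    ContDiff ℝ ∞ (Function.uncurry fun p z => fderiv ℝ (K p) z) := by
  apply ContDiff.fderiv (f := fun q : Ph d × Ph d => K q.1) (n := ∞) (m := ∞)
  · exact hK.comp ((contDiff_fst.comp contDiff_fst).prodMk contDiff_snd)
  · exact contDiff_snd
  · exact le_rfl

theorem LocCompactKernel.fderiv (hs : LocCompactKernel k K) :
    LocCompactKernel k fun p z => fderiv ℝ (K p) z := by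
  intro R
  obtain ⟨C, hC, hz⟩ := hs R
  refine ⟨C, hC, fun z hzb p hp => ?_⟩
  by_cases hkp : k p = 0
  · simp [hkp]
  have : K p =ᶠ[𝓝 z] fun _ => 0 := by
    filter_upwards [Metric.isOpen_ball.mem_nhds hzb] with y hy
    exact (smul_eq_zero.1 (hz y hy p hp)).resolve_left hkp
  simp [this.fderiv_eq]

theorem LocCompactKernel.integrable (hs : LocCompactKernel k K) (hk : LocallyIntegrable k)
    (hK : Continuous (Function.uncurry K)) (z : Ph d) : Integrable fun p => k p • K p z := by
  obtain ⟨C, hC, hzero⟩ := hs (‖z‖ + 1)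
  have hc : Continuous fun p => K p z := hK.comp (continuous_id.prodMk continuous_const)
  have h1 : IntegrableOn (fun p => k p • K p z) C :=
    (hk.integrableOn_isCompact hC).smul_continuousOn hc.continuousOn hC
  refine (integrableOn_iff_integrable_of_support_subset ?_).1 h1
  intro p hp
  by_contra hpC
  exact hp (hzero z (by simp) p hpC)

/-- Differentiation of `z ↦ ∫ k(p) K(p, z) dp` under the integral sign. -/
theorem hasFDerivAt_integral_smul_kernel (hk : LocallyIntegrable k)
    (hK : ContDiff ℝ ∞ (Function.uncurry K)) (hs : LocCompactKernel k K) (z₀ : Ph d) :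
    HasFDerivAt (fun z => ∫ p, k p • K p z) (∫ p, k p • fderiv ℝ (K p) z₀) z₀ := by
  obtain ⟨C, hC, hz⟩ := hs.fderiv (‖z₀‖ + 1)
  have hball : Metric.ball z₀ 1 ⊆ Metric.ball (0 : Ph d) (‖z₀‖ + 1) := by
    intro z hz
    rw [mem_ball_zero_iff]
    rw [mem_ball_iff_norm] at hz
    have := norm_add_le (z - z₀) z₀
    rw [sub_add_cancel] at this
    linarith
  have hfd : Continuous fun q : Ph d × Ph d => fderiv ℝ (K q.1) q.2 :=
    (contDiff_fderiv_kernel hK).continuous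
  have hKp : ∀ p, ContDiff ℝ ∞ (K p) := fun p => hK.comp (contDiff_const.prodMk contDiff_id)
  obtain ⟨B, hB⟩ := ((hC.prod (isCompact_closedBall z₀ 1)).image hfd).isBounded.exists_norm_le
  have hBb : ∀ p ∈ C, ∀ z ∈ Metric.ball z₀ 1, ‖fderiv ℝ (K p) z‖ ≤ B := fun p hp z hz =>
    hB _ ⟨(p, z), ⟨hp, Metric.ball_subset_closedBall hz⟩, rfl⟩
  have hmeas : ∀ z, Continuous fun p => K p z := fun z =>
    hK.continuous.comp (continuous_id.prodMk continuous_const)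
  have hmeas' : ∀ z, Continuous fun p => fderiv ℝ (K p) z := fun z =>
    hfd.comp (continuous_id.prodMk continuous_const)
  refine hasFDerivAt_integral_of_dominated_of_fderiv_le (F := fun z p => k p • K p z)
    (F' := fun z p => k p • fderiv ℝ (K p) z) (bound := C.indicator fun p => ‖k p‖ * B)
    (s := Metric.ball z₀ 1)
    (Metric.ball_mem_nhds _ one_pos) ?_ ?_ ?_ ?_ ?_ ?_
  · exact Filter.Eventually.of_forall fun z =>
      hk.aestronglyMeasurable.smul (hmeas z).aestronglyMeasurable
  · exact hs.integrable hk hK.continuous z₀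
  · exact hk.aestronglyMeasurable.smul (hmeas' z₀).aestronglyMeasurable
  · refine Filter.Eventually.of_forall fun p z hzb => ?_
    by_cases hp : p ∈ C
    · rw [indicator_of_mem hp, norm_smul]
      exact mul_le_mul_of_nonneg_left (hBb p hp z hzb) (norm_nonneg _)
    · rw [indicator_of_notMem hp]
      change ‖k p • fderiv ℝ (K p) z‖ ≤ 0
      rw [hz z (hball hzb) p hp]
      simp
  · rw [integrable_indicator_iff hC.measurableSet]
    exact (hk.integrableOn_isCompact hC).norm.mul_const B
  · refine Filter.Eventually.of_forall fun p z _ => ?_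
    exact (((hKp p).differentiable (by simp)) z).hasFDerivAt.const_smul (k p)

end KernelIntegral

theorem contDiff_nat_integral_smul_kernel (n : ℕ) : ∀ {F : Type} [NormedAddCommGroup F]
    [NormedSpace ℝ F] {k : Ph d → ℝ} {K : Ph d → Ph d → F} (_ : LocallyIntegrable k)
    (_ : ContDiff ℝ ∞ (Function.uncurry K)) (_ : LocCompactKernel k K),
    ContDiff ℝ n (fun z => ∫ p, k p • K p z) := by
  induction n with
  | zero =>
    intro F _ _ k K hk hK hs
    rw [show ((0 : ℕ) : WithTop ℕ∞) = 0 from rfl, contDiff_zero]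
    exact continuous_iff_continuousAt.2 fun z =>
      (hasFDerivAt_integral_smul_kernel hk hK hs z).continuousAt
  | succ n ih =>
    intro F _ _ k K hk hK hs
    have hd := hasFDerivAt_integral_smul_kernel hk hK hs
    rw [show ((n + 1 : ℕ) : WithTop ℕ∞) = (n : WithTop ℕ∞) + 1 by push_cast; rfl,
      contDiff_succ_iff_fderiv]
    refine ⟨fun z => (hd z).differentiableAt, by simp, ?_⟩
    have : fderiv ℝ (fun z => ∫ p, k p • K p z) = fun z => ∫ p, k p • fderiv ℝ (K p) z := by
      ext1 z
      exact (hd z).fderiv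
    rw [this]
    exact ih hk (contDiff_fderiv_kernel hK) hs.fderiv

theorem contDiff_integral_mul_kernel {k : Ph d → ℝ} {K : Ph d → Ph d → ℝ}
    (hk : LocallyIntegrable k) (hK : ContDiff ℝ ∞ (Function.uncurry K))
    (hs : LocCompactKernel k K) : ContDiff ℝ ∞ (fun z => ∫ p, k p * K p z) :=
  contDiff_infty.2 fun n => contDiff_nat_integral_smul_kernel n hk hK hs

theorem fderiv_integral_mul_kernel {k : Ph d → ℝ} {K : Ph d → Ph d → ℝ}
    (hk : LocallyIntegrable k) (hK : ContDiff ℝ ∞ (Function.uncurry K))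
    (hs : LocCompactKernel k K) (z e : Ph d) :
    fderiv ℝ (fun z => ∫ p, k p * K p z) z e = ∫ p, k p * fderiv ℝ (K p) z e := by
  have h2 := (hasFDerivAt_integral_smul_kernel hk hK hs z).fderiv
  simp only [smul_eq_mul] at h2
  rw [h2, ContinuousLinearMap.integral_apply
    (hs.fderiv.integrable hk (contDiff_fderiv_kernel hK).continuous z)]
  simp

/-! ### The Galilean group -/

/-- The group law `w ∘ z` of Galilean translations, which makes the free transport operator and the
velocity gradient left-invariant. -/
def gal (w z : Ph d) : Ph d := (w.1 + z.1, w.2.1 + z.2.1 + z.1 • w.2.2, w.2.2 + z.2.2)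

/-- The inverse for the group law `gal`. -/
def galInv (z : Ph d) : Ph d := (-z.1, -z.2.1 + z.1 • z.2.2, -z.2.2)

theorem gal_galInv_cancel (w z : Ph d) : gal (gal w z) (galInv z) = w := by
  simp only [gal, galInv]
  ext1
  · simp
  ext1
  · simp only [smul_add, neg_smul]
    abel
  · simp

theorem gal_galInv_cancel' (w z : Ph d) : gal (gal w (galInv z)) z = w := by
  simp only [gal, galInv]
  ext1
  · simp
  ext1
  · simp only [smul_add, neg_smul, smul_neg]
    abel
  · simp

theorem gal_zero_left (z : Ph d) : gal 0 z = z := by simp [gal]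

theorem contDiff_gal : ContDiff ℝ ∞ (Function.uncurry (gal (d := d))) := by
  unfold gal Function.uncurry
  fun_prop

theorem contDiff_galInv : ContDiff ℝ ∞ (galInv (d := d)) := by
  unfold galInv
  fun_prop

theorem continuous_gal : Continuous (Function.uncurry (gal (d := d))) := contDiff_gal.continuous

theorem continuous_gal_left (w : Ph d) : Continuous (gal w) :=
  continuous_gal.comp (continuous_const.prodMk continuous_id)

theorem continuous_gal_right (z : Ph d) : Continuous fun w => gal w z :=
  continuous_gal.comp (continuous_id.prodMk continuous_const)

/-- A translation combined with a shear of the positions preserves Lebesgue measure. -/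
theorem measurePreserving_shear (a : ℝ) (b : Sp d) {g : ℝ → Sp d → Sp d}
    (hg : Continuous (Function.uncurry g)) :
    MeasurePreserving (fun z : Ph d => ((a + z.1, g z.1 z.2.2 + z.2.1, b + z.2.2) : Ph d)) := by
  have h1 : ∀ t : ℝ, MeasurePreserving
      (fun y : Sp d × Sp d => ((g t y.2 + y.1, b + y.2) : Sp d × Sp d)) := by
    intro t
    have h2 : MeasurePreserving
        (fun y : Sp d × Sp d => ((b + y.1, g t y.1 + y.2) : Sp d × Sp d)) := by
      refine (measurePreserving_add_left volume b).skew_product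
        (g := fun (v x : Sp d) => g t v + x) ?_ ?_
      · have : Continuous fun y : Sp d × Sp d => g t y.1 + y.2 :=
          (hg.comp (continuous_const.prodMk continuous_fst)).add continuous_snd
        exact this.measurable
      · exact Filter.Eventually.of_forall fun v => (measurePreserving_add_left volume (g t v)).map_eq
    exact ((Measure.measurePreserving_swap (μ := (volume : Measure (Sp d)))
      (ν := (volume : Measure (Sp d)))).comp h2).comp Measure.measurePreserving_swap
  refine (measurePreserving_add_left volume a).skew_product
    (g := fun (t : ℝ) (y : Sp d × Sp d) => ((g t y.2 + y.1, b + y.2) : Sp d × Sp d)) ?_ ?_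
  · have : Continuous fun z : ℝ × (Sp d × Sp d) =>
        ((g z.1 z.2.2 + z.2.1, b + z.2.2) : Sp d × Sp d) := by
      refine Continuous.prodMk ?_ (by fun_prop)
      exact (hg.comp (continuous_fst.prodMk (continuous_snd.comp continuous_snd))).add (by fun_prop)
    exact this.measurable
  · exact Filter.Eventually.of_forall fun t => (h1 t).map_eq

theorem measurePreserving_gal_left (w : Ph d) : MeasurePreserving (gal w) := by
  convert measurePreserving_shear w.1 w.2.2 (g := fun t _ => w.2.1 + t • w.2.2)
    (by unfold Function.uncurry; fun_prop) using 2 with z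
  simp only [gal]
  congr 2
  abel

theorem measurePreserving_gal_right (z : Ph d) : MeasurePreserving fun w => gal w z := by
  convert measurePreserving_shear z.1 z.2.2 (g := fun _ v => z.2.1 + z.1 • v)
    (by unfold Function.uncurry; fun_prop) using 2 with w
  simp only [gal]
  ext1
  · simp [add_comm]
  ext1
  · simp only
    abel
  · simp [add_comm]

/-- Right translation as a measurable equivalence. -/
def galRightEquiv (z : Ph d) : Ph d ≃ᵐ Ph d where
  toFun w := gal w z
  invFun w := gal w (galInv z)
  left_inv w := gal_galInv_cancel w z
  right_inv w := gal_galInv_cancel' w z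
  measurable_toFun := (continuous_gal_right z).measurable
  measurable_invFun := (continuous_gal_right _).measurable

/-! ### The transport operator and velocity derivatives -/

/-- The direction of the `i`-th velocity variable. -/
def eV (i : Fin d) : Ph d := (0, 0, EuclideanSpace.single i 1)

/-- The derivative in the `i`-th velocity variable. -/
def dV (i : Fin d) (φ : Ph d → ℝ) (z : Ph d) : ℝ := fderiv ℝ φ z (eV i)

theorem gradV_apply {φ : Ph d → ℝ} {z : Ph d} (hφ : DifferentiableAt ℝ φ z) (i : Fin d) :
    gradV φ z i = dV i φ z := by
  have h1 : HasFDerivAt (fun w : Sp d => ((z.1, z.2.1, w) : Ph d))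
      ((0 : Sp d →L[ℝ] ℝ).prod ((0 : Sp d →L[ℝ] Sp d).prod (ContinuousLinearMap.id ℝ (Sp d))))
      z.2.2 :=
    (hasFDerivAt_const _ _).prodMk ((hasFDerivAt_const _ _).prodMk (hasFDerivAt_id _))
  have h2 := HasFDerivAt.comp (g := φ) z.2.2 (hφ.hasFDerivAt) h1
  have h3 : inner ℝ (gradV φ z) (EuclideanSpace.single i (1 : ℝ)) = dV i φ z := by
    unfold gradV gradient
    rw [InnerProductSpace.toDual_symm_apply]
    have : fderiv ℝ (fun w => φ (z.1, z.2.1, w)) z.2.2 = _ := h2.fderiv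
    rw [this]
    simp [dV, eV]
  rw [← h3, EuclideanSpace.inner_single_right]
  simp

instance isAddHaarMeasure_volume_Sp_prod :
    (volume : Measure (Sp d × Sp d)).IsAddHaarMeasure :=
  Measure.prod.instIsAddHaarMeasure volume volume

instance isAddHaarMeasure_volume_Ph : (volume : Measure (Ph d)).IsAddHaarMeasure :=
  Measure.prod.instIsAddHaarMeasure (volume : Measure ℝ) (volume : Measure (Sp d × Sp d))

theorem transport_mul {a b : Ph d → ℝ} {z : Ph d} (ha : DifferentiableAt ℝ a z)
    (hb : DifferentiableAt ℝ b z) :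
    transport (fun z => a z * b z) z = a z * transport b z + b z * transport a z := by
  unfold transport
  rw [fderiv_fun_mul ha hb]
  simp

theorem dV_mul (i : Fin d) {a b : Ph d → ℝ} {z : Ph d} (ha : DifferentiableAt ℝ a z)
    (hb : DifferentiableAt ℝ b z) :
    dV i (fun z => a z * b z) z = a z * dV i b z + b z * dV i a z := by
  unfold dV
  rw [fderiv_fun_mul ha hb]
  simp

theorem contDiff_dV (i : Fin d) {φ : Ph d → ℝ} (hφ : ContDiff ℝ ∞ φ) : ContDiff ℝ ∞ (dV i φ) :=
  (hφ.fderiv_right (m := ∞) le_rfl).clm_apply contDiff_const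

theorem contDiff_transport {φ : Ph d → ℝ} (hφ : ContDiff ℝ ∞ φ) : ContDiff ℝ ∞ (transport φ) :=
  (hφ.fderiv_right (m := ∞) le_rfl).clm_apply (by fun_prop)

theorem fderiv_apply_eq_zero_of_notMem_tsupport {φ : Ph d → ℝ} {z : Ph d} (hz : z ∉ tsupport φ)
    (e : Ph d) : fderiv ℝ φ z e = 0 := by
  have : fderiv ℝ φ z = 0 :=
    image_eq_zero_of_notMem_tsupport fun h => hz (tsupport_fderiv_subset ℝ h)
  simp [this]

theorem dV_eq_zero (i : Fin d) {φ : Ph d → ℝ} {z : Ph d} (hz : z ∉ tsupport φ) : dV i φ z = 0 :=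
  fderiv_apply_eq_zero_of_notMem_tsupport hz _

theorem transport_eq_zero {φ : Ph d → ℝ} {z : Ph d} (hz : z ∉ tsupport φ) : transport φ z = 0 :=
  fderiv_apply_eq_zero_of_notMem_tsupport hz _

theorem hasCompactSupport_dV (i : Fin d) {φ : Ph d → ℝ} (hφ : HasCompactSupport φ) :
    HasCompactSupport (dV i φ) :=
  HasCompactSupport.intro hφ fun _ hz => dV_eq_zero i hz

theorem hasCompactSupport_transport {φ : Ph d → ℝ} (hφ : HasCompactSupport φ) :
    HasCompactSupport (transport φ) :=
  HasCompactSupport.intro hφ fun _ hz => transport_eq_zero hz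

theorem integral_dV_eq_zero (i : Fin d) {φ : Ph d → ℝ} (hφ : ContDiff ℝ ∞ φ)
    (hc : HasCompactSupport φ) : ∫ z, dV i φ z = 0 := by
  have h := integral_mul_fderiv_eq_neg_fderiv_mul_of_integrable (μ := (volume : Measure (Ph d)))
    (f := fun _ => (1 : ℝ)) (g := φ) (v := eV i) (by simp)
    (by
      simp only [one_mul]
      exact (contDiff_dV i hφ).continuous.integrable_of_hasCompactSupport
        (hasCompactSupport_dV i hc))
    (by simpa using hφ.continuous.integrable_of_hasCompactSupport hc)
    (fun x _ => by fun_prop) (fun x _ => hφ.differentiable (by simp) x)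
  simpa [dV] using h

/-- The shear `(t, x, v) ↦ (t, x + t v, v)` straightens the transport operator to `∂_t`. -/
theorem integral_transport_eq_zero {φ : Ph d → ℝ} (hφ : ContDiff ℝ ∞ φ)
    (hc : HasCompactSupport φ) : ∫ z, transport φ z = 0 := by
  set s : Ph d → Ph d := fun z => (z.1, z.2.1 + z.1 • z.2.2, z.2.2) with hs
  have hsmooth : ContDiff ℝ ∞ s := by
    rw [hs]
    fun_prop
  let e : Ph d ≃ₜ Ph d :=
    { toFun := s
      invFun := fun z => (z.1, z.2.1 - z.1 • z.2.2, z.2.2)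
      left_inv := fun z => by simp [hs]
      right_inv := fun z => by simp [hs]
      continuous_toFun := hsmooth.continuous
      continuous_invFun := by fun_prop }
  have hmp : MeasurePreserving s := by
    have := measurePreserving_shear (d := d) 0 0 (g := fun t v => t • v)
      (by unfold Function.uncurry; fun_prop)
    convert this using 2 with z
    simp [hs, add_comm]
  have hcomp : ContDiff ℝ ∞ (fun z => φ (s z)) := hφ.comp hsmooth
  have hcc : HasCompactSupport (fun z => φ (s z)) := hc.comp_homeomorph e
  have hder : ∀ z, fderiv ℝ (fun z => φ (s z)) z (1, 0, 0) = transport φ (s z) := by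
    intro z
    have h1 : HasDerivAt (fun r : ℝ => s (z + r • ((1, 0, 0) : Ph d))) (1, z.2.2, 0) 0 := by
      have h2 : HasDerivAt (fun r : ℝ => z.2.1 + (z.1 + r) • z.2.2) z.2.2 0 := by
        have := (((hasDerivAt_id (0 : ℝ)).const_add z.1).smul_const z.2.2).const_add z.2.1
        simpa using this
      have h3 : HasDerivAt (fun r : ℝ => z.1 + r) 1 0 := (hasDerivAt_id (0 : ℝ)).const_add z.1
      have := h3.prodMk (h2.prodMk (hasDerivAt_const (0 : ℝ) z.2.2))
      simpa [hs] using this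
    rw [← ((hcomp.differentiable (by simp)) z).lineDeriv_eq_fderiv]
    unfold lineDeriv transport
    have hd : HasFDerivAt φ (fderiv ℝ φ (s z)) (s (z + (0 : ℝ) • ((1, 0, 0) : Ph d))) := by
      simpa using (hφ.differentiable (by simp) (s z)).hasFDerivAt
    exact (hd.comp_hasDerivAt (0 : ℝ) h1).deriv
  have h := integral_mul_fderiv_eq_neg_fderiv_mul_of_integrable (μ := (volume : Measure (Ph d)))
    (f := fun _ => (1 : ℝ)) (g := fun z => φ (s z)) (v := (1, 0, 0)) (by simp)
    (by
      simp only [one_mul]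
      refine Continuous.integrable_of_hasCompactSupport ?_ ?_
      · exact ((hcomp.fderiv_right (m := ∞) le_rfl).clm_apply contDiff_const).continuous
      · exact HasCompactSupport.intro hcc fun z hz => fderiv_apply_eq_zero_of_notMem_tsupport hz _)
    (by simpa using hcomp.continuous.integrable_of_hasCompactSupport hcc)
    (fun x _ => by fun_prop) (fun x _ => hcomp.differentiable (by simp) x)
  rw [← hmp.integral_comp e.measurableEmbedding (transport φ)]
  simp only [hder] at h
  simpa using h

/-! ### Mollification by Galilean translations -/

/-- Mollification along the Galilean group,
`z ↦ ∫ u(w) ρ(w ∘ z⁻¹) dw = ∫ ρ(w) u(w ∘ z) dw`; since it averages left translates, it commutes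
with the transport operator and with velocity derivatives. -/
def moll (η : ContDiffBump (0 : Ph d)) (u : Ph d → ℝ) (z : Ph d) : ℝ :=
  ∫ w, u w * η.normed volume (gal w (galInv z))

/-- The mollification kernel as a function of the integration variable. -/
def mollKer (η : ContDiffBump (0 : Ph d)) (z w : Ph d) : ℝ := η.normed volume (gal w (galInv z))

theorem contDiff_mollKer_uncurry (η : ContDiffBump (0 : Ph d)) :
    ContDiff ℝ ∞ (Function.uncurry fun w z => mollKer η z w) := by
  unfold mollKer Function.uncurry
  exact η.contDiff_normed.comp
    (contDiff_gal.comp (contDiff_fst.prodMk (contDiff_galInv.comp contDiff_snd)))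

theorem mollKer_nonneg (η : ContDiffBump (0 : Ph d)) (z w : Ph d) : 0 ≤ mollKer η z w :=
  η.nonneg_normed _

theorem mollKer_ne_zero {η : ContDiffBump (0 : Ph d)} {z w : Ph d} (h : mollKer η z w ≠ 0) :
    w ∈ (fun y => gal y z) '' Metric.closedBall 0 η.rOut := by
  refine ⟨gal w (galInv z), ?_, gal_galInv_cancel' w z⟩
  have : gal w (galInv z) ∈ Function.support (η.normed volume) := h
  rw [η.support_normed_eq] at this
  exact Metric.ball_subset_closedBall this

theorem locCompactKernel_mollKer (η : ContDiffBump (0 : Ph d)) (u : Ph d → ℝ) :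
    LocCompactKernel u fun w z => mollKer η z w := by
  intro R
  refine ⟨Function.uncurry gal '' (Metric.closedBall 0 η.rOut ×ˢ Metric.closedBall 0 R),
    ((isCompact_closedBall _ _).prod (isCompact_closedBall _ _)).image continuous_gal,
    fun z hz w hw => ?_⟩
  by_contra h
  obtain ⟨y, hy, rfl⟩ := mollKer_ne_zero (smul_ne_zero_iff.1 h).2
  exact hw ⟨(y, z), ⟨hy, Metric.ball_subset_closedBall hz⟩, rfl⟩

theorem contDiff_moll (η : ContDiffBump (0 : Ph d)) {u : Ph d → ℝ} (hu : LocallyIntegrable u) :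
    ContDiff ℝ ∞ (moll η u) :=
  contDiff_integral_mul_kernel hu (contDiff_mollKer_uncurry η) (locCompactKernel_mollKer η u)

theorem contDiff_mollKer (η : ContDiffBump (0 : Ph d)) (z : Ph d) : ContDiff ℝ ∞ (mollKer η z) :=
  (contDiff_mollKer_uncurry η).comp (contDiff_id.prodMk contDiff_const)

theorem isTestFun_mollKer {η : ContDiffBump (0 : Ph d)} {V : Set (Ph d)} {z : Ph d}
    (hz : ∀ w ∈ Metric.closedBall (0 : Ph d) η.rOut, gal w z ∈ V) :
    IsTestFun V (mollKer η z) := by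
  have hcpt : IsCompact ((fun y => gal y z) '' Metric.closedBall 0 η.rOut) :=
    (isCompact_closedBall _ _).image (continuous_gal_right z)
  have hsub : tsupport (mollKer η z) ⊆ (fun y => gal y z) '' Metric.closedBall 0 η.rOut :=
    closure_minimal (fun w hw => mollKer_ne_zero hw) hcpt.isClosed
  refine ⟨contDiff_mollKer η z, ?_, hsub.trans ?_⟩
  · exact HasCompactSupport.of_support_subset_isCompact hcpt fun w hw => mollKer_ne_zero hw
  · rintro _ ⟨w, hw, rfl⟩
    exact hz w hw

theorem fderiv_eq_neg_of_line {f h : Ph d → ℝ} {z p e e' : Ph d} (hf : DifferentiableAt ℝ f z)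
    (hh : DifferentiableAt ℝ h p) (heq : ∀ s : ℝ, f (z + s • e) = h (p + s • (-e'))) :
    fderiv ℝ f z e = -fderiv ℝ h p e' := by
  rw [← map_neg, ← hf.lineDeriv_eq_fderiv, ← hh.lineDeriv_eq_fderiv]
  unfold lineDeriv
  simp only [heq]

/-- The kernel depends on `z` and `w` only through `w ∘ z⁻¹`, so by left-invariance its derivative
in `z` is minus its derivative in `w`. -/
theorem dV_mollKer (η : ContDiffBump (0 : Ph d)) (i : Fin d) (z w : Ph d) :
    dV i (fun z => mollKer η z w) z = -dV i (mollKer η z) w := by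
  refine fderiv_eq_neg_of_line ?_ ((contDiff_mollKer η z).differentiable (by simp) w) ?_
  · exact ((contDiff_mollKer_uncurry η).comp
      (contDiff_const.prodMk contDiff_id)).differentiable (by simp) z
  · intro s
    unfold mollKer
    congr 1
    simp only [gal, galInv, eV]
    ext1
    · simp
    ext1
    · simp only [Prod.fst_add, Prod.snd_add, Prod.smul_fst, Prod.smul_snd, Prod.fst_neg,
        Prod.snd_neg, smul_zero, add_zero, neg_zero, smul_add, neg_smul, smul_neg]
      abel
    · simp only [Prod.snd_add, Prod.smul_snd, Prod.snd_neg, smul_neg]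
      abel

theorem transport_mollKer (η : ContDiffBump (0 : Ph d)) (z w : Ph d) :
    transport (fun z => mollKer η z w) z = -transport (mollKer η z) w := by
  refine fderiv_eq_neg_of_line ?_ ((contDiff_mollKer η z).differentiable (by simp) w) ?_
  · exact ((contDiff_mollKer_uncurry η).comp
      (contDiff_const.prodMk contDiff_id)).differentiable (by simp) z
  · intro s
    unfold mollKer
    congr 1
    simp only [gal, galInv]
    ext1
    · simp only [Prod.fst_add, Prod.smul_fst, Prod.fst_neg, smul_neg, smul_eq_mul, mul_one]
      ring
    ext1
    · simp only [Prod.fst_add, Prod.snd_add, Prod.smul_fst, Prod.smul_snd, Prod.fst_neg,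
        Prod.snd_neg, smul_zero, add_zero, neg_zero, neg_smul, smul_neg, smul_eq_mul,
        mul_one, add_smul, neg_add]
      abel
    · simp

theorem dV_moll (η : ContDiffBump (0 : Ph d)) {u : Ph d → ℝ} (hu : LocallyIntegrable u)
    (i : Fin d) (z : Ph d) : dV i (moll η u) z = -∫ w, u w * dV i (mollKer η z) w := by
  have := fderiv_integral_mul_kernel hu (contDiff_mollKer_uncurry η)
    (locCompactKernel_mollKer η u) z (eV i)
  rw [← integral_neg]
  refine this.trans (integral_congr_ae (Eventually.of_forall fun w => ?_))
  have h2 := dV_mollKer η i z w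
  unfold dV at h2 ⊢
  simp only [h2, mul_neg]

theorem transport_moll (η : ContDiffBump (0 : Ph d)) {u : Ph d → ℝ} (hu : LocallyIntegrable u)
    (z : Ph d) : transport (moll η u) z = -∫ w, u w * transport (mollKer η z) w := by
  have := fderiv_integral_mul_kernel hu (contDiff_mollKer_uncurry η)
    (locCompactKernel_mollKer η u) z (1, z.2.2, 0)
  rw [← integral_neg]
  refine this.trans (integral_congr_ae (Eventually.of_forall fun w => ?_))
  have h2 := transport_mollKer η z w
  unfold transport at h2 ⊢
  simp only [h2, mul_neg]

/-! ### Convergence of mollifications -/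

theorem moll_eq (η : ContDiffBump (0 : Ph d)) (u : Ph d → ℝ) (z : Ph d) :
    moll η u z = ∫ w, η.normed volume w * u (gal w z) := by
  unfold moll
  have := (measurePreserving_gal_right z).integral_comp (galRightEquiv z).measurableEmbedding
    (fun w => u w * η.normed volume (gal w (galInv z)))
  rw [← this]
  simp only [gal_galInv_cancel, mul_comm]

theorem eLpNorm_two_sq {α : Type*} [MeasurableSpace α] (μ : Measure α) (u : α → ℝ) :
    eLpNorm u 2 μ ^ 2 = ∫⁻ z, ‖u z‖ₑ ^ 2 ∂μ := by
  have := eLpNorm_nnreal_pow_eq_lintegral (μ := μ) (f := u) (p := 2) (by norm_num)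
  simpa using this

theorem lintegral_sq_le {α : Type*} [MeasurableSpace α] (μ : Measure α) {h : α → ℝ≥0∞}
    (hh : AEMeasurable h μ) : (∫⁻ z, h z ∂μ) ^ 2 ≤ μ univ * ∫⁻ z, h z ^ 2 ∂μ := by
  have h1 := ENNReal.lintegral_mul_le_Lp_mul_Lq μ Real.HolderConjugate.two_two hh
    (aemeasurable_const (b := (1 : ℝ≥0∞)))
  simp only [Pi.mul_apply, mul_one, ENNReal.one_rpow, lintegral_const, one_mul] at h1
  calc (∫⁻ z, h z ∂μ) ^ 2
      ≤ ((∫⁻ z, h z ^ (2 : ℝ) ∂μ) ^ (1 / 2 : ℝ) * μ univ ^ (1 / 2 : ℝ)) ^ 2 := by gcongr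
    _ = μ univ * ∫⁻ z, h z ^ 2 ∂μ := by
        rw [mul_pow, ← ENNReal.rpow_natCast, ← ENNReal.rpow_mul, ← ENNReal.rpow_natCast,
          ← ENNReal.rpow_mul]
        norm_num [mul_comm]

theorem lintegral_mul_sq_le {α : Type*} [MeasurableSpace α] (μ : Measure α) {a h : α → ℝ≥0∞}
    (ha : AEMeasurable a μ) (hh : AEMeasurable h μ) :
    (∫⁻ z, a z * h z ∂μ) ^ 2 ≤ (∫⁻ z, a z ∂μ) * ∫⁻ z, a z * h z ^ 2 ∂μ := by
  have h0 : AEMeasurable h (μ.withDensity a) := hh.mono_ac (withDensity_absolutelyContinuous _ _)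
  have h1 := lintegral_sq_le (μ.withDensity a) h0
  rw [lintegral_withDensity_eq_lintegral_mul₀ ha hh,
    lintegral_withDensity_eq_lintegral_mul₀ ha (hh.pow_const 2),
    withDensity_apply _ MeasurableSet.univ, Measure.restrict_univ] at h1
  exact h1

theorem measurePreserving_gal_prod :
    MeasurePreserving (fun q : Ph d × Ph d => (q.1, gal q.1 q.2)) :=
  (MeasurePreserving.id volume).skew_product (g := gal) continuous_gal.measurable
    (Eventually.of_forall fun w => (measurePreserving_gal_left w).map_eq)

theorem aestronglyMeasurable_gal_prod {u : Ph d → ℝ} (hu : AEStronglyMeasurable u) :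
    AEStronglyMeasurable (fun q : Ph d × Ph d => u (gal q.1 q.2)) := by
  have h1 : AEStronglyMeasurable (fun q : Ph d × Ph d => u q.2) := hu.comp_snd
  exact h1.comp_measurePreserving measurePreserving_gal_prod

theorem lintegral_normed (η : ContDiffBump (0 : Ph d)) :
    ∫⁻ w, ENNReal.ofReal (η.normed volume w) = 1 := by
  rw [← ofReal_integral_eq_lintegral_ofReal η.integrable_normed
    (Eventually.of_forall fun w => η.nonneg_normed w), η.integral_normed, ENNReal.ofReal_one]

/-- Jensen's inequality for averages against a bump function, integrated over `z`. -/
theorem lintegral_sq_average_le (η : ContDiffBump (0 : Ph d)) {h : Ph d → Ph d → ℝ}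
    (hh : AEStronglyMeasurable (Function.uncurry h)) :
    ∫⁻ z, ‖∫ w, η.normed volume w * h w z‖ₑ ^ 2 ≤
      ∫⁻ w, ENNReal.ofReal (η.normed volume w) * ∫⁻ z, ‖h w z‖ₑ ^ 2 := by
  have hη : Measurable fun w : Ph d => ENNReal.ofReal (η.normed volume w) :=
    (η.contDiff_normed (n := 0)).continuous.measurable.ennreal_ofReal
  have hm : AEMeasurable (Function.uncurry fun (z w : Ph d) =>
      ENNReal.ofReal (η.normed volume w) * ‖h w z‖ₑ ^ 2) (volume.prod volume) := by
    have := hh.prod_swap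
    exact (hη.comp measurable_snd).aemeasurable.mul (this.enorm.pow_const 2)
  have hsec : ∀ᵐ z : Ph d, AEStronglyMeasurable fun w => h w z := hh.prod_swap.prodMk_left
  calc ∫⁻ z, ‖∫ w, η.normed volume w * h w z‖ₑ ^ 2
      ≤ ∫⁻ z, ∫⁻ w, ENNReal.ofReal (η.normed volume w) * ‖h w z‖ₑ ^ 2 := by
        refine lintegral_mono_ae ?_
        filter_upwards [hsec] with z hz
        calc ‖∫ w, η.normed volume w * h w z‖ₑ ^ 2
            ≤ (∫⁻ w, ENNReal.ofReal (η.normed volume w) * ‖h w z‖ₑ) ^ 2 := by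
              gcongr
              refine (enorm_integral_le_lintegral_enorm _).trans (le_of_eq ?_)
              refine lintegral_congr fun w => ?_
              rw [enorm_mul, Real.enorm_of_nonneg (η.nonneg_normed w)]
          _ ≤ _ := by
              refine (lintegral_mul_sq_le volume hη.aemeasurable hz.enorm).trans (le_of_eq ?_)
              rw [lintegral_normed, one_mul]
    _ = ∫⁻ w, ∫⁻ z, ENNReal.ofReal (η.normed volume w) * ‖h w z‖ₑ ^ 2 :=
        lintegral_lintegral_swap hm
    _ = _ := by
        refine lintegral_congr fun w => ?_
        rw [lintegral_const_mul' _ _ ENNReal.ofReal_ne_top]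

theorem locallyIntegrable_of_memLp {u : Ph d → ℝ} (hu : MemLp u 2) : LocallyIntegrable u :=
  hu.locallyIntegrable (by norm_num)

theorem eLpNorm_moll_le (η : ContDiffBump (0 : Ph d)) {u : Ph d → ℝ} (hu : MemLp u 2) :
    eLpNorm (moll η u) 2 ≤ eLpNorm u 2 := by
  have h1 := lintegral_sq_average_le η (h := fun w z => u (gal w z))
    (aestronglyMeasurable_gal_prod hu.1)
  simp only [← moll_eq] at h1
  have h2 : ∀ w : Ph d, ∫⁻ z, ‖u (gal w z)‖ₑ ^ 2 = eLpNorm u 2 ^ 2 := by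
    intro w
    rw [← eLpNorm_two_sq, ← eLpNorm_comp_measurePreserving hu.1 (measurePreserving_gal_left w)]
    rfl
  simp only [h2] at h1
  rw [lintegral_mul_const' _ _ (by simpa using hu.2.ne), lintegral_normed, one_mul,
    ← eLpNorm_two_sq] at h1
  exact (ENNReal.pow_le_pow_left_iff two_ne_zero).1 h1

theorem eLpNorm_one_moll_le (η : ContDiffBump (0 : Ph d)) {u : Ph d → ℝ}
    (hu : AEStronglyMeasurable u) : eLpNorm (moll η u) 1 ≤ eLpNorm u 1 := by
  simp only [eLpNorm_one_eq_lintegral_enorm]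
  have hη : Measurable fun w : Ph d => ENNReal.ofReal (η.normed volume w) :=
    (η.contDiff_normed (n := 0)).continuous.measurable.ennreal_ofReal
  have hm : AEMeasurable (Function.uncurry fun (z w : Ph d) =>
      ENNReal.ofReal (η.normed volume w) * ‖u (gal w z)‖ₑ) (volume.prod volume) :=
    (hη.comp measurable_snd).aemeasurable.mul (aestronglyMeasurable_gal_prod hu).prod_swap.enorm
  calc ∫⁻ z, ‖moll η u z‖ₑ ≤ ∫⁻ z, ∫⁻ w, ENNReal.ofReal (η.normed volume w) * ‖u (gal w z)‖ₑ := by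
        refine lintegral_mono fun z => ?_
        rw [moll_eq]
        refine (enorm_integral_le_lintegral_enorm _).trans (le_of_eq (lintegral_congr fun w => ?_))
        rw [enorm_mul, Real.enorm_of_nonneg (η.nonneg_normed w)]
    _ = ∫⁻ w, ∫⁻ z, ENNReal.ofReal (η.normed volume w) * ‖u (gal w z)‖ₑ :=
        lintegral_lintegral_swap hm
    _ = ∫⁻ w, ENNReal.ofReal (η.normed volume w) * ∫⁻ z, ‖u z‖ₑ := by
        refine lintegral_congr fun w => ?_
        rw [lintegral_const_mul' _ _ ENNReal.ofReal_ne_top]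
        congr 1
        have := eLpNorm_comp_measurePreserving (p := 1) hu (measurePreserving_gal_left w)
        rw [eLpNorm_one_eq_lintegral_enorm, eLpNorm_one_eq_lintegral_enorm] at this
        exact this
    _ = ∫⁻ z, ‖u z‖ₑ := by rw [lintegral_mul_const _ hη, lintegral_normed, one_mul]

theorem memLp_moll (η : ContDiffBump (0 : Ph d)) {u : Ph d → ℝ} (hu : MemLp u 2) :
    MemLp (moll η u) 2 :=
  ⟨(contDiff_moll η (locallyIntegrable_of_memLp hu)).continuous.aestronglyMeasurable,
    (eLpNorm_moll_le η hu).trans_lt hu.2⟩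

/-- Galilean translations are continuous in `L²`. -/
theorem tendsto_eLpNorm_comp_gal {u : Ph d → ℝ} (hu : MemLp u 2) :
    Tendsto (fun w : Ph d => eLpNorm (fun z => u (gal w z) - u z) 2) (𝓝 0) (𝓝 0) := by
  let c : C(Ph d, C(Ph d, Ph d)) := ContinuousMap.curry ⟨Function.uncurry gal, continuous_gal⟩
  have hc : ∀ w, MeasurePreserving (c w) := fun w => measurePreserving_gal_left w
  have h := Filter.Tendsto.compMeasurePreservingLp (l := 𝓝 (0 : Ph d))
    (f := fun _ => hu.toLp u) (f₀ := hu.toLp u) (g := c) (g₀ := c 0) tendsto_const_nhds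
    c.continuous.continuousAt hc (hc 0) (by norm_num)
  rw [Lp.tendsto_Lp_iff_tendsto_eLpNorm'] at h
  refine h.congr fun w => eLpNorm_congr_ae ?_
  have hu1 := hu.coeFn_toLp
  have h0 := Lp.coeFn_compMeasurePreserving (hu.toLp u) (hc 0)
  have hw := Lp.coeFn_compMeasurePreserving (hu.toLp u) (hc w)
  have hu2 : ∀ w, (hu.toLp u : Ph d → ℝ) ∘ c w =ᵐ[volume] u ∘ c w := fun w =>
    (hc w).quasiMeasurePreserving.ae_eq_comp hu1
  filter_upwards [h0, hw, hu2 0, hu2 w] with z h1 h2 h3 h4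
  rw [Pi.sub_apply, h1, h2, h3, h4]
  change u (gal w z) - u (gal 0 z) = _
  rw [gal_zero_left]

/-- A sequence of bump functions shrinking to the origin. -/
def bumpSeq (n : ℕ) : ContDiffBump (0 : Ph d) where
  rIn := 1 / (2 * (n + 1))
  rOut := 1 / (n + 1)
  rIn_pos := by positivity
  rIn_lt_rOut := by
    apply one_div_lt_one_div_of_lt <;> linarith [(Nat.cast_nonneg n : (0 : ℝ) ≤ n)]

theorem tendsto_bumpSeq_rOut : Tendsto (fun n => (bumpSeq (d := d) n).rOut) atTop (𝓝 0) :=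
  tendsto_one_div_add_atTop_nhds_zero_nat

theorem tendsto_moll {u : Ph d → ℝ} (hu : MemLp u 2) :
    Tendsto (fun n => eLpNorm (fun z => moll (bumpSeq n) u z - u z) 2) atTop (𝓝 0) := by
  rw [ENNReal.tendsto_nhds_zero]
  intro ε hε
  have h1 := (ENNReal.tendsto_nhds_zero.1 (tendsto_eLpNorm_comp_gal hu)) ε hε
  obtain ⟨δ, hδ, hb⟩ := Metric.eventually_nhds_iff_ball.1 h1
  filter_upwards [(tendsto_bumpSeq_rOut (d := d)).eventually (gt_mem_nhds hδ)] with n hn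
  set η := bumpSeq (d := d) n
  rw [← ENNReal.pow_le_pow_left_iff two_ne_zero, eLpNorm_two_sq]
  have hint : ∀ᵐ z : Ph d, moll η u z - u z =
      ∫ w, η.normed volume w * (u (gal w z) - u z) := by
    refine Eventually.of_forall fun z => ?_
    have h2 : Integrable fun w => η.normed volume w * u (gal w z) := by
      have h3 := (locCompactKernel_mollKer η u).integrable (locallyIntegrable_of_memLp hu)
        (contDiff_mollKer_uncurry η).continuous z
      have h4 := (measurePreserving_gal_right z).integrable_comp_of_integrable h3
      refine h4.congr (Eventually.of_forall fun w => ?_)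
      simp only [Function.comp_apply, mollKer, gal_galInv_cancel, smul_eq_mul, mul_comm]
    simp only [mul_sub]
    rw [integral_sub h2 (η.integrable_normed.mul_const _), integral_mul_const, η.integral_normed,
      one_mul, moll_eq]
  rw [lintegral_congr_ae (hint.mono fun z hz => by rw [hz])]
  have hm : AEStronglyMeasurable (Function.uncurry fun w z : Ph d => u (gal w z) - u z) :=
    (aestronglyMeasurable_gal_prod hu.1).sub hu.1.comp_snd
  refine (lintegral_sq_average_le η hm).trans ?_
  calc ∫⁻ w, ENNReal.ofReal (η.normed volume w) * ∫⁻ z, ‖u (gal w z) - u z‖ₑ ^ 2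
      ≤ ∫⁻ w, ENNReal.ofReal (η.normed volume w) * ε ^ 2 := by
        refine lintegral_mono fun w => ?_
        by_cases hw : η.normed volume w = 0
        · simp [hw]
        have hw' : w ∈ Function.support (η.normed volume) := hw
        rw [η.support_normed_eq] at hw'
        have h5 := hb w (Metric.ball_subset_ball hn.le hw')
        simp only
        rw [← eLpNorm_two_sq]
        gcongr
    _ ≤ ε ^ 2 := by
        rw [lintegral_mul_const'' _
          (η.contDiff_normed (n := 0)).continuous.measurable.ennreal_ofReal.aemeasurable,
          lintegral_normed, one_mul]

/-! ### Convergence in the mean -/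

/-- Convergence in `L²` of a sequence of square-integrable functions. -/
structure L2Tendsto (a : ℕ → Ph d → ℝ) (b : Ph d → ℝ) : Prop where
  memLp : ∀ n, MemLp (a n) 2
  memLp_lim : MemLp b 2
  tendsto : Tendsto (fun n => eLpNorm (fun z => a n z - b z) 2) atTop (𝓝 0)

theorem L2Tendsto.moll {u : Ph d → ℝ} (hu : MemLp u 2) :
    L2Tendsto (fun n => moll (bumpSeq n) u) u :=
  ⟨fun _ => memLp_moll _ hu, hu, tendsto_moll hu⟩

theorem L2Tendsto.of_norm_sub_le {a a' : ℕ → Ph d → ℝ} {b b' : Ph d → ℝ} (h : L2Tendsto a b)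
    (ha' : ∀ n, MemLp (a' n) 2) (hb' : MemLp b' 2) (C : ℝ)
    (hle : ∀ n z, ‖a' n z - b' z‖ ≤ C * ‖a n z - b z‖) : L2Tendsto a' b' := by
  refine ⟨ha', hb', ?_⟩
  have h1 : Tendsto (fun n => ENNReal.ofReal C * eLpNorm (fun z => a n z - b z) 2) atTop (𝓝 0) := by
    have := ENNReal.Tendsto.const_mul (a := ENNReal.ofReal C) h.tendsto
      (Or.inr ENNReal.ofReal_ne_top)
    simpa using this
  refine tendsto_of_tendsto_of_tendsto_of_le_of_le tendsto_const_nhds h1 (fun _ => zero_le)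
    fun n => ?_
  exact eLpNorm_le_mul_eLpNorm_of_ae_le_mul (Eventually.of_forall fun z => hle n z) 2

theorem memLp_bdd_mul {m u : Ph d → ℝ} (hm : Continuous m) {C : ℝ} (hC : ∀ z, |m z| ≤ C)
    (hu : MemLp u 2) : MemLp (fun z => m z * u z) 2 := by
  refine hu.of_le_mul (c := C) (hm.aestronglyMeasurable.mul hu.1) (Eventually.of_forall fun z => ?_)
  rw [norm_mul]
  exact mul_le_mul_of_nonneg_right (hC z) (norm_nonneg _)

theorem L2Tendsto.bdd_mul {a : ℕ → Ph d → ℝ} {b m : Ph d → ℝ} (h : L2Tendsto a b)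
    (hm : Continuous m) {C : ℝ} (hC : ∀ z, |m z| ≤ C) :
    L2Tendsto (fun n z => m z * a n z) (fun z => m z * b z) := by
  refine h.of_norm_sub_le (fun n => memLp_bdd_mul hm hC (h.memLp n))
    (memLp_bdd_mul hm hC h.memLp_lim) C fun n z => ?_
  rw [← mul_sub, norm_mul]
  exact mul_le_mul_of_nonneg_right (hC z) (norm_nonneg _)

theorem L2Tendsto.integral_mul {a a' : ℕ → Ph d → ℝ} {b b' : Ph d → ℝ} (h : L2Tendsto a b)
    (h' : L2Tendsto a' b') :
    Tendsto (fun n => ∫ z, a n z * a' n z) atTop (𝓝 (∫ z, b z * b' z)) := by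
  have h1 : Tendsto (fun n => (h.memLp n).toLp) atTop (𝓝 h.memLp_lim.toLp) :=
    (Lp.tendsto_Lp_iff_tendsto_eLpNorm'' _ h.memLp _ h.memLp_lim).2 h.tendsto
  have h2 : Tendsto (fun n => (h'.memLp n).toLp) atTop (𝓝 h'.memLp_lim.toLp) :=
    (Lp.tendsto_Lp_iff_tendsto_eLpNorm'' _ h'.memLp _ h'.memLp_lim).2 h'.tendsto
  have key : ∀ {u v : Ph d → ℝ} (hu : MemLp u 2) (hv : MemLp v 2),
      inner ℝ (hu.toLp u) (hv.toLp v) = ∫ z, u z * v z := by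
    intro u v hu hv
    rw [L2.inner_def]
    refine integral_congr_ae ?_
    filter_upwards [hu.coeFn_toLp, hv.coeFn_toLp] with z h1 h2
    rw [h1, h2]
    simp [mul_comm]
  have h3 := h1.inner (𝕜 := ℝ) h2
  simp only [key] at h3
  exact h3

/-! ### Weak derivatives and weak sub-solutions in coordinates -/

/-- `H i` is the weak derivative of `g` in the `i`-th velocity variable on `V`. -/
def WeakDV (V : Set (Ph d)) (g : Ph d → ℝ) (H : Fin d → Ph d → ℝ) : Prop :=
  ∀ φ, IsTestFun V φ → ∀ i, ∫ z, g z * dV i φ z = -∫ z, φ z * H i z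

/-- The inequality `𝒯 g ≤ div_v P + q` on `V`, in the sense of distributions, for square-integrable
functions on the whole space, where `H` is the velocity gradient of `g` on `V`. -/
structure WeakSub (V : Set (Ph d)) (g : Ph d → ℝ) (H P : Fin d → Ph d → ℝ) (q : Ph d → ℝ) :
    Prop where
  memLp_g : MemLp g 2
  memLp_H : ∀ i, MemLp (H i) 2
  memLp_P : ∀ i, MemLp (P i) 2
  memLp_q : MemLp q 2
  weakDV : WeakDV V g H
  ineq : ∀ φ, IsTestFun V φ → (∀ z, 0 ≤ φ z) →
    -∫ z, g z * transport φ z ≤ -∑ i, (∫ z, P i z * dV i φ z) + ∫ z, q z * φ z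

theorem IsTestFun.mul_left {V : Set (Ph d)} {φ a : Ph d → ℝ} (hφ : IsTestFun V φ)
    (ha : ContDiff ℝ ∞ a) : IsTestFun V fun z => φ z * a z := by
  have hsub : tsupport (fun z => φ z * a z) ⊆ tsupport φ :=
    closure_mono fun z hz => left_ne_zero_of_mul hz
  exact ⟨hφ.1.mul ha, hφ.2.1.mul_right, hsub.trans hφ.2.2⟩

theorem eventually_gal_mem {V K : Set (Ph d)} (hV : IsOpen V) (hK : IsCompact K) (hKV : K ⊆ V) :
    ∀ᶠ n in atTop, ∀ z ∈ K, ∀ w ∈ Metric.closedBall (0 : Ph d) (bumpSeq (d := d) n).rOut,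
      gal w z ∈ V := by
  obtain ⟨u, v, hu, -, h0u, hKv, huv⟩ := generalized_tube_lemma (isCompact_singleton (x := 0)) hK
    (n := Function.uncurry gal ⁻¹' V) (hV.preimage continuous_gal) (by
      rintro ⟨w, z⟩ ⟨hw, hz⟩
      rw [mem_singleton_iff] at hw
      simp only at hw hz
      simp only [mem_preimage, Function.uncurry_apply_pair]
      rw [hw, gal_zero_left]
      exact hKV hz)
  obtain ⟨δ, hδ, hb⟩ := Metric.isOpen_iff.1 hu 0 (h0u rfl)
  filter_upwards [(tendsto_bumpSeq_rOut (d := d)).eventually (gt_mem_nhds hδ)] with n hn z hz w hw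
  exact @huv (w, z) ⟨hb (Metric.closedBall_subset_ball hn hw), hKv hz⟩

theorem WeakDV.dV_moll {V : Set (Ph d)} {g : Ph d → ℝ} {H : Fin d → Ph d → ℝ}
    (hw : WeakDV V g H) (hg : LocallyIntegrable g) {η : ContDiffBump (0 : Ph d)} {z : Ph d}
    (hz : ∀ w ∈ Metric.closedBall (0 : Ph d) η.rOut, gal w z ∈ V) (i : Fin d) :
    dV i (moll η g) z = moll η (H i) z := by
  rw [KineticFP.dV_moll η hg, hw _ (isTestFun_mollKer hz), neg_neg]
  simp only [moll, mollKer, mul_comm]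

/-- Tested with the mollification kernel, the distributional inequality becomes a pointwise one for
the mollified functions. -/
theorem WeakSub.transport_moll_le {V : Set (Ph d)} {g q : Ph d → ℝ} {H P : Fin d → Ph d → ℝ}
    (hs : WeakSub V g H P q) {η : ContDiffBump (0 : Ph d)} {z : Ph d}
    (hz : ∀ w ∈ Metric.closedBall (0 : Ph d) η.rOut, gal w z ∈ V) :
    transport (moll η g) z ≤ ∑ i, dV i (moll η (P i)) z + moll η q z := by
  rw [transport_moll η (locallyIntegrable_of_memLp hs.memLp_g)]
  refine (hs.ineq _ (isTestFun_mollKer hz) (mollKer_nonneg η z)).trans (le_of_eq ?_)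
  simp only [KineticFP.dV_moll η (locallyIntegrable_of_memLp (hs.memLp_P _)),
    Finset.sum_neg_distrib]
  rfl

theorem HasCompactSupport.exists_abs_le {m : Ph d → ℝ} (hm : Continuous m)
    (hc : HasCompactSupport m) : ∃ C, ∀ z, |m z| ≤ C := by
  obtain ⟨C, hC⟩ := hm.bounded_above_of_compact_support hc
  exact ⟨C, hC⟩

/-- The energy inequality. Testing with `ψ g` is justified by mollifying along the Galilean group:
the mollified function satisfies the inequality pointwise, and is smooth. -/
theorem WeakSub.energy {V : Set (Ph d)} {g q : Ph d → ℝ} {H P : Fin d → Ph d → ℝ}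
    (hs : WeakSub V g H P q) (hV : IsOpen V) (hg : ∀ z, 0 ≤ g z) {ψ : Ph d → ℝ}
    (hψ : IsTestFun V ψ) (hψ0 : ∀ z, 0 ≤ ψ z) :
    ∑ i, ∫ z, (ψ z * H i z) * P i z ≤ (∫ z, (transport ψ z * g z) * g z) / 2
      - ∑ i, (∫ z, (dV i ψ z * g z) * P i z) + ∫ z, (ψ z * g z) * q z := by
  obtain ⟨Cψ, hCψ⟩ := HasCompactSupport.exists_abs_le hψ.1.continuous hψ.2.1
  obtain ⟨CT, hCT⟩ := HasCompactSupport.exists_abs_le (contDiff_transport hψ.1).continuous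
    (hasCompactSupport_transport hψ.2.1)
  have hdV := fun i => HasCompactSupport.exists_abs_le (contDiff_dV i hψ.1).continuous
    (hasCompactSupport_dV i hψ.2.1)
  have hgM := L2Tendsto.moll hs.memLp_g
  have t1 : Tendsto (fun n => ∑ i, ∫ z, (ψ z * moll (bumpSeq n) (H i) z) * moll (bumpSeq n) (P i) z)
      atTop (𝓝 (∑ i, ∫ z, (ψ z * H i z) * P i z)) :=
    tendsto_finsetSum _ fun i _ => ((L2Tendsto.moll (hs.memLp_H i)).bdd_mul hψ.1.continuous
      hCψ).integral_mul (L2Tendsto.moll (hs.memLp_P i))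
  have t2 := (hgM.bdd_mul (contDiff_transport hψ.1).continuous hCT).integral_mul hgM
  have t3 : Tendsto (fun n => ∑ i, ∫ z, (dV i ψ z * moll (bumpSeq n) g z) * moll (bumpSeq n) (P i) z)
      atTop (𝓝 (∑ i, ∫ z, (dV i ψ z * g z) * P i z)) := by
    refine tendsto_finsetSum _ fun i _ => ?_
    obtain ⟨C, hC⟩ := hdV i
    exact (hgM.bdd_mul (contDiff_dV i hψ.1).continuous hC).integral_mul
      (L2Tendsto.moll (hs.memLp_P i))
  have t4 := (hgM.bdd_mul hψ.1.continuous hCψ).integral_mul (L2Tendsto.moll hs.memLp_q)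
  refine le_of_tendsto_of_tendsto t1 (((t2.div_const 2).sub t3).add t4) ?_
  filter_upwards [eventually_gal_mem hV hψ.2.1 hψ.2.2] with n hn
  set η := bumpSeq (d := d) n
  set G := moll η g with hG
  set MP := fun i => moll η (P i) with hMP
  set Mq := moll η q with hMq
  have hGs : ContDiff ℝ ∞ G := contDiff_moll η (locallyIntegrable_of_memLp hs.memLp_g)
  have hPs : ∀ i, ContDiff ℝ ∞ (MP i) := fun i =>
    contDiff_moll η (locallyIntegrable_of_memLp (hs.memLp_P i))
  have hqs : ContDiff ℝ ∞ Mq := contDiff_moll η (locallyIntegrable_of_memLp hs.memLp_q)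
  have hHs : ∀ i, ContDiff ℝ ∞ (moll η (H i)) := fun i =>
    contDiff_moll η (locallyIntegrable_of_memLp (hs.memLp_H i))
  have hG0 : ∀ z, 0 ≤ G z := fun z => integral_nonneg fun w =>
    mul_nonneg (hg w) (mollKer_nonneg η z w)
  have hint : ∀ {F : Ph d → ℝ}, Continuous F → (∀ z ∉ tsupport ψ, F z = 0) → Integrable F :=
    fun hF h0 => hF.integrable_of_hasCompactSupport (HasCompactSupport.intro hψ.2.1 h0)
  have hψz : ∀ z ∉ tsupport ψ, ψ z = 0 := fun z hz => image_eq_zero_of_notMem_tsupport hz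
  have dψ := hψ.1.differentiable (by simp)
  have dG := hGs.differentiable (by simp)
  have dP := fun i => (hPs i).differentiable (by simp)
  have cψ := hψ.1.continuous
  have cG := hGs.continuous
  have cP := fun i => (hPs i).continuous
  have cTψ := (contDiff_transport hψ.1).continuous
  have cVψ := fun i => (contDiff_dV i hψ.1).continuous
  have i1 : ∀ i, Integrable fun z => (ψ z * moll η (H i) z) * MP i z := fun i =>
    hint ((cψ.mul (hHs i).continuous).mul (cP i)) fun z hz => by simp [hψz z hz]
  have i2 : Integrable fun z => (transport ψ z * G z) * G z :=
    hint ((cTψ.mul cG).mul cG) fun z hz => by simp [transport_eq_zero hz]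
  have i3 : ∀ i, Integrable fun z => (dV i ψ z * G z) * MP i z := fun i =>
    hint (((cVψ i).mul cG).mul (cP i)) fun z hz => by simp [dV_eq_zero i hz]
  have i4 : Integrable fun z => (ψ z * G z) * Mq z :=
    hint ((cψ.mul cG).mul hqs.continuous) fun z hz => by simp [hψz z hz]
  -- the pointwise inequality multiplied by `ψ G` is written below with total derivatives, whose
  -- integrals vanish
  have hz1 : ∫ z, transport (fun z => ψ z * (G z * G z)) z = 0 :=
    integral_transport_eq_zero (hψ.1.mul (hGs.mul hGs)) hψ.2.1.mul_right
  have hz2 : ∀ i, ∫ z, dV i (fun z => ψ z * (G z * MP i z)) z = 0 := fun i =>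
    integral_dV_eq_zero i (hψ.1.mul (hGs.mul (hPs i))) hψ.2.1.mul_right
  have j1 : Integrable (transport (fun z => ψ z * (G z * G z))) :=
    (contDiff_transport (hψ.1.mul (hGs.mul hGs))).continuous.integrable_of_hasCompactSupport
      (hasCompactSupport_transport hψ.2.1.mul_right)
  have j2 : ∀ i, Integrable (dV i (fun z => ψ z * (G z * MP i z))) := fun i =>
    (contDiff_dV i (hψ.1.mul (hGs.mul (hPs i)))).continuous.integrable_of_hasCompactSupport
      (hasCompactSupport_dV i hψ.2.1.mul_right)
  have hpt : ∀ z, transport (fun z => ψ z * (G z * G z)) z / 2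
      - ∑ i, dV i (fun z => ψ z * (G z * MP i z)) z ≤
      ((transport ψ z * G z) * G z / 2 - ∑ i, (dV i ψ z * G z) * MP i z + (ψ z * G z) * Mq z)
        - ∑ i, (ψ z * moll η (H i) z) * MP i z := by
    intro z
    by_cases hzψ : z ∈ tsupport ψ
    · have h1 := hs.transport_moll_le (hn z hzψ)
      have h2 := fun i => hs.weakDV.dV_moll (locallyIntegrable_of_memLp hs.memLp_g) (hn z hzψ) i
      rw [transport_mul (b := fun z => G z * G z) (dψ z) ((dG z).mul (dG z)),
        transport_mul (dG z) (dG z)]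
      have h3 : ∀ i, dV i (fun z => ψ z * (G z * MP i z)) z =
          ψ z * G z * dV i (MP i) z + (ψ z * moll η (H i) z) * MP i z
            + (dV i ψ z * G z) * MP i z := by
        intro i
        rw [dV_mul i (b := fun z => G z * MP i z) (dψ z) ((dG z).mul (dP i z)), dV_mul i (dG z) (dP i z), h2 i]
        ring
      simp only [h3, Finset.sum_add_distrib, ← Finset.mul_sum]
      have h4 := mul_le_mul_of_nonneg_left h1 (mul_nonneg (hψ0 z) (hG0 z))
      rw [mul_add] at h4
      linarith
    · have hz' : ∀ {a : Ph d → ℝ}, z ∉ tsupport fun z => ψ z * a z := fun {a} h =>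
        hzψ (tsupport_mul_subset_left h)
      simp [transport_eq_zero hz', dV_eq_zero _ hz', transport_eq_zero hzψ, dV_eq_zero _ hzψ,
        hψz z hzψ]
  have s1 : Integrable fun z => ∑ i, (ψ z * moll η (H i) z) * MP i z :=
    integrable_finsetSum _ fun i _ => i1 i
  have s3 : Integrable fun z => ∑ i, (dV i ψ z * G z) * MP i z :=
    integrable_finsetSum _ fun i _ => i3 i
  have s23 : Integrable fun z => (transport ψ z * G z) * G z / 2
      - ∑ i, (dV i ψ z * G z) * MP i z := (i2.div_const 2).sub s3
  have s234 : Integrable fun z => (transport ψ z * G z) * G z / 2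
      - ∑ i, (dV i ψ z * G z) * MP i z + (ψ z * G z) * Mq z := s23.add i4
  have sj : Integrable fun z => ∑ i, dV i (fun z => ψ z * (G z * MP i z)) z :=
    integrable_finsetSum _ fun i _ => j2 i
  have hI := integral_mono ((j1.div_const 2).sub sj) (s234.sub s1) hpt
  simp only [Pi.sub_apply] at hI
  rw [integral_sub (j1.div_const 2) sj, integral_div, hz1, integral_finsetSum _ fun i _ => j2 i,
    Finset.sum_eq_zero fun i _ => hz2 i, integral_sub s234 s1, integral_finsetSum _ fun i _ => i1 i,
    integral_add s23 i4, integral_sub (i2.div_const 2) s3, integral_div,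
    integral_finsetSum _ fun i _ => i3 i] at hI
  linarith

/-- The chain rule for weak velocity derivatives. It holds for the mollified functions, and as `β`
and `β'` are Lipschitz continuous, every term converges in `L²`. -/
theorem WeakDV.comp {V : Set (Ph d)} (hV : IsOpen V) {f : Ph d → ℝ} {G : Fin d → Ph d → ℝ}
    (hw : WeakDV V f G) (hf : MemLp f 2) (hG : ∀ i, MemLp (G i) 2) {β : ℝ → ℝ}
    (hβ : ContDiff ℝ ∞ β) (hβ0 : β 0 = 0) {C : ℝ} (hC1 : ∀ s, |deriv β s| ≤ C)
    (hC2 : ∀ s, |deriv (deriv β) s| ≤ C) :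
    WeakDV V (fun z => β (f z)) (fun i z => deriv β (f z) * G i z) := by
  have hC : 0 ≤ C := (abs_nonneg _).trans (hC1 0)
  have hdβ : ContDiff ℝ ∞ (deriv β) := by
    simpa using (contDiff_infty_iff_deriv.1 hβ).2
  have hlip1 : ∀ s r, |β s - β r| ≤ C * |s - r| := fun s r =>
    Convex.norm_image_sub_le_of_norm_deriv_le (s := univ)
      (fun x _ => hβ.differentiable (by simp) x) (fun x _ => hC1 x) convex_univ trivial trivial
  have hlip2 : ∀ s r, |deriv β s - deriv β r| ≤ C * |s - r| := fun s r =>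
    Convex.norm_image_sub_le_of_norm_deriv_le (s := univ)
      (fun x _ => hdβ.differentiable (by simp) x) (fun x _ => hC2 x) convex_univ trivial trivial
  intro φ hφ i
  obtain ⟨Cφ, hCφ⟩ := HasCompactSupport.exists_abs_le hφ.1.continuous hφ.2.1
  have hφ2 : MemLp φ 2 := hφ.1.continuous.memLp_of_hasCompactSupport hφ.2.1
  have hdφ2 : MemLp (dV i φ) 2 :=
    (contDiff_dV i hφ.1).continuous.memLp_of_hasCompactSupport (hasCompactSupport_dV i hφ.2.1)
  have hfM := L2Tendsto.moll hf
  have m1 : ∀ {u : Ph d → ℝ}, MemLp u 2 → MemLp (fun z => β (u z)) 2 := fun {u} hu =>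
    hu.of_le_mul (c := C) (hβ.continuous.comp_aestronglyMeasurable hu.1)
      (Eventually.of_forall fun z => by simpa [hβ0] using hlip1 (u z) 0)
  have m2 : ∀ {u : Ph d → ℝ}, MemLp u 2 → MemLp (fun z => φ z * deriv β (u z)) 2 := fun {u} hu =>
    hφ2.of_le_mul (c := C)
      (hφ.1.continuous.aestronglyMeasurable.mul (hdβ.continuous.comp_aestronglyMeasurable hu.1))
      (Eventually.of_forall fun z => by
        rw [norm_mul, mul_comm]
        exact mul_le_mul_of_nonneg_right (hC1 _) (norm_nonneg _))
  have c1 : L2Tendsto (fun n z => β (moll (bumpSeq n) f z)) (fun z => β (f z)) :=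
    hfM.of_norm_sub_le (fun n => m1 (memLp_moll _ hf)) (m1 hf) C fun n z => hlip1 _ _
  have c2 : L2Tendsto (fun n z => φ z * deriv β (moll (bumpSeq n) f z))
      (fun z => φ z * deriv β (f z)) := by
    refine hfM.of_norm_sub_le (fun n => m2 (memLp_moll _ hf)) (m2 hf) (Cφ * C) fun n z => ?_
    rw [← mul_sub, norm_mul, mul_assoc]
    exact mul_le_mul (hCφ z) (hlip2 _ _) (norm_nonneg _) ((abs_nonneg _).trans (hCφ z))
  have c3 : L2Tendsto (fun _ => dV i φ) (dV i φ) := ⟨fun _ => hdφ2, hdφ2, by simp⟩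
  have t1 := c1.integral_mul c3
  have t2 := (c2.integral_mul (L2Tendsto.moll (hG i))).neg
  have heq : (fun z => φ z * (deriv β (f z) * G i z)) =
      fun z => φ z * deriv β (f z) * G i z := by
    ext z
    ring
  rw [heq]
  refine tendsto_nhds_unique_of_eventuallyEq t1 t2 ?_
  filter_upwards [eventually_gal_mem hV hφ.2.1 hφ.2.2] with n hn
  set F := moll (bumpSeq n) f
  have hF : ContDiff ℝ ∞ F := contDiff_moll _ (locallyIntegrable_of_memLp hf)
  have hβF : ContDiff ℝ ∞ fun z => β (F z) := hβ.comp hF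
  have hz := integral_dV_eq_zero i (hφ.1.mul hβF) hφ.2.1.mul_right
  have hpt : ∀ z, dV i (fun z => φ z * β (F z)) z =
      φ z * deriv β (F z) * moll (bumpSeq n) (G i) z + β (F z) * dV i φ z := by
    intro z
    rw [dV_mul i (hφ.1.differentiable (by simp) z) (hβF.differentiable (by simp) z)]
    by_cases hzφ : z ∈ tsupport φ
    · have h1 : dV i (fun z => β (F z)) z = deriv β (F z) * dV i F z := by
        have h2 := ((hβ.differentiable (by simp) (F z)).hasDerivAt).comp_hasFDerivAt z
          ((hF.differentiable (by simp) z).hasFDerivAt)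
        have h3 : fderiv ℝ (fun z => β (F z)) z = _ := h2.fderiv
        simp [dV, h3]
      rw [h1, hw.dV_moll (locallyIntegrable_of_memLp hf) (hn z hzφ)]
      ring
    · simp [image_eq_zero_of_notMem_tsupport hzφ]
  have k1 : Integrable fun z => β (F z) * dV i φ z :=
    (hβF.continuous.mul (contDiff_dV i hφ.1).continuous).integrable_of_hasCompactSupport
      (hasCompactSupport_dV i hφ.2.1).mul_left
  have k2 : Integrable fun z => φ z * deriv β (F z) * moll (bumpSeq n) (G i) z := by
    refine Continuous.integrable_of_hasCompactSupport ?_ (hφ.2.1.mul_right.mul_right)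
    exact (hφ.1.continuous.mul (hdβ.continuous.comp hF.continuous)).mul
      (contDiff_moll _ (locallyIntegrable_of_memLp (hG i))).continuous
  have hz' : ∫ z, (φ z * deriv β (F z) * moll (bumpSeq n) (G i) z + β (F z) * dV i φ z) = 0 := by
    rw [← hz]
    exact integral_congr_ae (Eventually.of_forall fun z => (hpt z).symm)
  rw [integral_add k2 k1] at hz'
  linarith

/-! ### Averages along kinetic paths -/

/-- The endpoint at parameter `τ` of the path from the origin whose velocity is `τ m₁ + τ² m₂` at
time `τ³`, for `p = (τ, m₁, m₂)`. With this choice of time scale the velocity increments, the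
densities of the endpoints and the weights below are polynomial in `τ`, so no singular kernels
occur. -/
def pathPt (p : Ph d) : Ph d :=
  (p.1 ^ 3, (p.1 ^ 4 / 4) • p.2.1 + (2 * p.1 ^ 5 / 5) • p.2.2, p.1 • p.2.1 + p.1 ^ 2 • p.2.2)

/-- A smooth weight on the space of paths, vanishing unless `|m₁|, |m₂| ≤ 1`. -/
structure IsWeight (c : Ph d → ℝ) : Prop where
  contDiff : ContDiff ℝ ∞ c
  support : ∀ p : Ph d, p.2 ∉ Metric.closedBall (0 : Sp d × Sp d) 1 → c p = 0

/-- The average of `ψ` over the endpoints of the paths that start at `z`, with parameter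
`τ ∈ T` and weight `c`. -/
def pathAvg (T : Set ℝ) (c ψ : Ph d → ℝ) (z : Ph d) : ℝ :=
  ∫ p, (Prod.fst ⁻¹' T).indicator c p * ψ (gal z (pathPt p))

theorem contDiff_pathPt : ContDiff ℝ ∞ (pathPt (d := d)) := by
  unfold pathPt
  fun_prop

theorem contDiff_path_kernel {ψ : Ph d → ℝ} (hψ : ContDiff ℝ ∞ ψ) :
    ContDiff ℝ ∞ (Function.uncurry fun p z => ψ (gal z (pathPt p))) :=
  hψ.comp (contDiff_gal.comp (contDiff_snd.prodMk (contDiff_pathPt.comp contDiff_fst)))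

theorem IsWeight.locallyIntegrable {c : Ph d → ℝ} (hc : IsWeight c) {T : Set ℝ}
    (hT : MeasurableSet T) : LocallyIntegrable ((Prod.fst ⁻¹' T).indicator c) :=
  hc.contDiff.continuous.locallyIntegrable.indicator (measurable_fst hT)

theorem IsWeight.locCompactKernel {c : Ph d → ℝ} (hc : IsWeight c) {T : Set ℝ}
    (hT : T ⊆ Icc 0 1) (K : Ph d → Ph d → ℝ) :
    LocCompactKernel ((Prod.fst ⁻¹' T).indicator c) K := by
  intro R
  refine ⟨Icc 0 1 ×ˢ Metric.closedBall (0 : Sp d × Sp d) 1,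
    isCompact_Icc.prod (isCompact_closedBall _ _), fun z _ p hp => ?_⟩
  suffices h : (Prod.fst ⁻¹' T).indicator c p = 0 by simp [h]
  by_cases h1 : p.1 ∈ T
  · rw [indicator_of_mem (by exact h1)]
    exact hc.support p fun h2 => hp ⟨hT h1, h2⟩
  · exact indicator_of_notMem (by exact h1) _

section

variable {T : Set ℝ} {c ψ : Ph d → ℝ}

theorem contDiff_pathAvg (hc : IsWeight c) (hψ : ContDiff ℝ ∞ ψ) (hT : MeasurableSet T)
    (hT' : T ⊆ Icc 0 1) : ContDiff ℝ ∞ (pathAvg T c ψ) :=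
  contDiff_integral_mul_kernel (hc.locallyIntegrable hT) (contDiff_path_kernel hψ)
    (hc.locCompactKernel hT' _)

theorem fderiv_pathAvg (hc : IsWeight c) (hψ : ContDiff ℝ ∞ ψ) (hT : MeasurableSet T)
    (hT' : T ⊆ Icc 0 1) (z e : Ph d) : fderiv ℝ (pathAvg T c ψ) z e =
      ∫ p, (Prod.fst ⁻¹' T).indicator c p * fderiv ℝ (fun z => ψ (gal z (pathPt p))) z e :=
  fderiv_integral_mul_kernel (hc.locallyIntegrable hT) (contDiff_path_kernel hψ)
    (hc.locCompactKernel hT' _) z e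

theorem IsWeight.integrable_mul (hc : IsWeight c) (hT : MeasurableSet T)
    (hT' : T ⊆ Icc 0 1) {F : Ph d → ℝ} (hF : Continuous F) :
    Integrable fun p => (Prod.fst ⁻¹' T).indicator c p * F p :=
  (hc.locCompactKernel hT' fun p _ => F p).integrable (hc.locallyIntegrable hT)
    (hF.comp continuous_fst) 0

end

theorem IsWeight.mul_left {c a : Ph d → ℝ} (hc : IsWeight c) (ha : ContDiff ℝ ∞ a) :
    IsWeight fun p => a p * c p :=
  ⟨ha.mul hc.contDiff, fun p hp => by rw [hc.support p hp, mul_zero]⟩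

theorem IsWeight.add {c c' : Ph d → ℝ} (hc : IsWeight c) (hc' : IsWeight c') :
    IsWeight fun p => c p + c' p :=
  ⟨hc.contDiff.add hc'.contDiff, fun p hp => by rw [hc.support p hp, hc'.support p hp, add_zero]⟩

theorem IsWeight.fderiv_apply {c : Ph d → ℝ} (hc : IsWeight c) (e : Ph d) :
    IsWeight fun p => fderiv ℝ c p e := by
  refine ⟨(hc.contDiff.fderiv_right (m := ∞) le_rfl).clm_apply contDiff_const, fun p hp => ?_⟩
  have : c =ᶠ[𝓝 p] fun _ => 0 := by
    have ho : IsOpen (Prod.snd ⁻¹' (Metric.closedBall (0 : Sp d × Sp d) 1)ᶜ : Set (Ph d)) :=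
      Metric.isClosed_closedBall.isOpen_compl.preimage continuous_snd
    filter_upwards [ho.mem_nhds hp] with y hy
    exact hc.support y hy
  simp [this.fderiv_eq]

/-- On the relevant range of `τ`, a weight is bounded. -/
theorem IsWeight.exists_bound {c : Ph d → ℝ} (hc : IsWeight c) :
    ∃ C : ℝ, 0 ≤ C ∧ ∀ p : Ph d, p.1 ∈ Icc (0 : ℝ) 1 → |c p| ≤ C := by
  obtain ⟨C, hC⟩ := ((isCompact_Icc (a := (0 : ℝ)) (b := 1)).prod
    (isCompact_closedBall (0 : Sp d × Sp d) 1)).exists_bound_of_continuousOn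
    hc.contDiff.continuous.continuousOn
  refine ⟨max C 0, le_max_right _ _, fun p hp => ?_⟩
  by_cases h : p.2 ∈ Metric.closedBall (0 : Sp d × Sp d) 1
  · exact (hC p ⟨hp, h⟩).trans (le_max_left _ _)
  · rw [hc.support p h, abs_zero]
    exact le_max_right _ _

/-- The probability density of the path directions `(m₁, m₂)`. -/
def dirDensity (m : Sp d × Sp d) : ℝ :=
  (⟨1 / 2, 1, by norm_num, by norm_num⟩ : ContDiffBump (0 : Sp d × Sp d)).normed volume m

theorem dirDensity_nonneg (m : Sp d × Sp d) : 0 ≤ dirDensity m := ContDiffBump.nonneg_normed _ _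

theorem integral_dirDensity : ∫ m : Sp d × Sp d, dirDensity m = 1 :=
  ContDiffBump.integral_normed _

theorem isWeight_dirDensity : IsWeight fun p : Ph d => dirDensity p.2 := by
  refine ⟨(ContDiffBump.contDiff_normed _).comp contDiff_snd, fun p hp => ?_⟩
  by_contra h
  have h2 : p.2 ∈ Function.support (dirDensity (d := d)) := h
  unfold dirDensity at h2
  rw [ContDiffBump.support_normed_eq] at h2
  exact hp (Metric.ball_subset_closedBall h2)

/-- The weight of the dual function `φ = ∫ 3τ² ρ(m) ψ(z ∘ pathPt p) dp`. -/
def dualWeight (p : Ph d) : ℝ := 3 * p.1 ^ 2 * dirDensity p.2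

/-- The weight of the `i`-th component of the flux of the dual function. -/
def fluxWeight (i : Fin d) (p : Ph d) : ℝ := (p.2.1 i + 2 * p.1 * p.2.2 i) * dirDensity p.2

/-- The weight of the `i`-th velocity derivative of the dual function. The factors `12 τ` and `-15`
are `-3` times the coefficients of the directions `-4 τ e_i` and `5 e_i`, which reproduce `τ² e_i`;
see `dV_pathAvg_dualWeight`. -/
def gradWeight (i : Fin d) (p : Ph d) : ℝ :=
  fderiv ℝ (fun p : Ph d => (12 * p.1) * dirDensity p.2) p (0, EuclideanSpace.single i 1, 0) +
    fderiv ℝ (fun p : Ph d => (-15) * dirDensity p.2) p (0, 0, EuclideanSpace.single i 1)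

theorem isWeight_dualWeight : IsWeight (dualWeight (d := d)) :=
  isWeight_dirDensity.mul_left (by fun_prop)

theorem isWeight_fluxWeight (i : Fin d) : IsWeight (fluxWeight i) :=
  isWeight_dirDensity.mul_left (by fun_prop)

theorem isWeight_gradWeight (i : Fin d) : IsWeight (gradWeight i) :=
  ((isWeight_dirDensity.mul_left (a := fun p => 12 * p.1) (by fun_prop)).fderiv_apply _).add
    ((isWeight_dirDensity.mul_left (a := fun _ => -15) (by fun_prop)).fderiv_apply _)

theorem fderiv_comp_gal_left {ψ : Ph d → ℝ} (hψ : ContDiff ℝ ∞ ψ) (q z e : Ph d) :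
    fderiv ℝ (fun z => ψ (gal z q)) z e =
      fderiv ℝ ψ (gal z q) (e.1, e.2.1 + q.1 • e.2.2, e.2.2) := by
  have hsm : ContDiff ℝ ∞ fun z => gal z q := contDiff_gal.comp (contDiff_id.prodMk contDiff_const)
  have hcs : ContDiff ℝ ∞ fun z => ψ (gal z q) := hψ.comp hsm
  rw [← (hcs.differentiable (by simp) z).lineDeriv_eq_fderiv]
  have h1 : HasDerivAt (fun r : ℝ => gal (z + r • e) q) (e.1, e.2.1 + q.1 • e.2.2, e.2.2) 0 := by
    have h2 : ∀ {E : Type} [NormedAddCommGroup E] [NormedSpace ℝ E] (a b : E),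
        HasDerivAt (fun r : ℝ => a + r • b) b 0 := fun a b => by
      simpa using ((hasDerivAt_id (0 : ℝ)).smul_const b).const_add a
    have h3 := ((h2 z.1 e.1).add_const q.1).prodMk
      ((((h2 z.2.1 e.2.1).add_const q.2.1).add ((h2 z.2.2 e.2.2).const_smul q.1)).prodMk
        ((h2 z.2.2 e.2.2).add_const q.2.2))
    exact h3
  have hd : HasFDerivAt ψ (fderiv ℝ ψ (gal z q)) (gal (z + (0 : ℝ) • e) q) := by
    simpa using (hψ.differentiable (by simp) (gal z q)).hasFDerivAt
  exact (hd.comp_hasDerivAt (0 : ℝ) h1).deriv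

theorem sum_mul_fderiv_eV (L : Ph d →L[ℝ] ℝ) (w : Sp d) :
    ∑ i, w i * L (eV i) = L (0, 0, w) := by
  have : ((0, 0, w) : Ph d) = ∑ i, w i • eV i := by
    have h : w = ∑ i, w i • EuclideanSpace.single i (1 : ℝ) := by
      ext j
      simp [Finset.sum_apply, Pi.single_apply]
    ext1
    · simp [eV, Prod.fst_sum]
    ext1
    · simp [eV, Prod.fst_sum, Prod.snd_sum]
    · simp only [Prod.snd_sum, Prod.smul_snd, eV]
      exact h
  rw [this, map_sum]
  simp

/-- Along a path, `d/dτ` is `3τ² 𝒯` plus the velocity derivative in the direction `m₁ + 2τ m₂`. -/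
theorem hasDerivAt_path {ψ : Ph d → ℝ} (hψ : ContDiff ℝ ∞ ψ) (z : Ph d) (m : Sp d × Sp d) (τ : ℝ) :
    HasDerivAt (fun τ : ℝ => ψ (gal z (pathPt (τ, m))))
      (3 * τ ^ 2 * fderiv ℝ (fun z => ψ (gal z (pathPt (τ, m)))) z (1, z.2.2, 0) +
        ∑ i, (m.1 i + 2 * τ * m.2 i) *
          fderiv ℝ (fun z => ψ (gal z (pathPt (τ, m)))) z (eV i)) τ := by
  have h3 : HasDerivAt (fun τ : ℝ => τ ^ 3) (3 * τ ^ 2) τ := by simpa using hasDerivAt_pow 3 τ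
  have h4 : HasDerivAt (fun τ : ℝ => τ ^ 4 / 4) (τ ^ 3) τ := by
    refine ((hasDerivAt_pow 4 τ).div_const 4).congr_deriv ?_
    push_cast
    ring
  have h5 : HasDerivAt (fun τ : ℝ => 2 * τ ^ 5 / 5) (2 * τ ^ 4) τ := by
    refine (((hasDerivAt_pow 5 τ).const_mul 2).div_const 5).congr_deriv ?_
    push_cast
    ring
  have h2 : HasDerivAt (fun τ : ℝ => τ ^ 2) (2 * τ) τ := by simpa using hasDerivAt_pow 2 τ
  have h1 := hasDerivAt_id τ
  have hx := ((((h4.smul_const m.1).add (h5.smul_const m.2)).const_add z.2.1).add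
    (h3.smul_const z.2.2))
  have hv := (((h1.smul_const m.1).add (h2.smul_const m.2)).const_add z.2.2)
  have hc : HasDerivAt (fun τ : ℝ => gal z (pathPt (τ, m))) _ τ :=
    (h3.const_add z.1).prodMk (hx.prodMk hv)
  have hd := ((hψ.differentiable (by simp) (gal z (pathPt (τ, m)))).hasFDerivAt).comp_hasDerivAt τ hc
  refine hd.congr_deriv ?_
  have hs := sum_mul_fderiv_eV (fderiv ℝ (fun z => ψ (gal z (pathPt (τ, m)))) z)
    (m.1 + (2 * τ) • m.2)
  simp only [PiLp.add_apply, PiLp.smul_apply, smul_eq_mul] at hs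
  have hL : ∀ (L : Ph d →L[ℝ] ℝ) (a : ℝ) (x : Ph d), a * L x = L (a • x) := fun L a x => by simp
  rw [hs, fderiv_comp_gal_left hψ, fderiv_comp_gal_left hψ, hL, ← map_add]
  congr 1
  simp only [pathPt]
  ext1
  · simp
  ext1
  · simp only [Prod.smul_mk, Prod.mk_add_mk, smul_zero, add_zero, zero_add, smul_add, smul_smul]
    rw [show τ ^ 3 * (2 * τ) = 2 * τ ^ 4 by ring]
    abel
  · simp

/-- The derivative along a path integrates to `-ψ z` if `ψ` vanishes at the endpoint: the path
starts at `z`. -/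
theorem integral_path_deriv {ψ : Ph d → ℝ} (hψ : ContDiff ℝ ∞ ψ) (z : Ph d) (m : Sp d × Sp d)
    (h0 : ψ (gal z (pathPt (1, m))) = 0) :
    ∫ τ in Ioo (0 : ℝ) 1, (3 * τ ^ 2 * fderiv ℝ (fun z => ψ (gal z (pathPt (τ, m)))) z (1, z.2.2, 0)
      + ∑ i, (m.1 i + 2 * τ * m.2 i) *
          fderiv ℝ (fun z => ψ (gal z (pathPt (τ, m)))) z (eV i)) = -ψ z := by
  have hcont : ∀ e : Ph d, Continuous fun τ : ℝ =>
      fderiv ℝ (fun z => ψ (gal z (pathPt (τ, m)))) z e := fun e => by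
    have := (contDiff_fderiv_kernel (contDiff_path_kernel hψ)).continuous.comp
      (f := fun τ : ℝ => (((τ, m) : Ph d), z)) (by fun_prop)
    exact this.clm_apply continuous_const
  rw [← integral_Ioc_eq_integral_Ioo, ← intervalIntegral.integral_of_le zero_le_one,
    intervalIntegral.integral_eq_sub_of_hasDerivAt (fun τ _ => hasDerivAt_path hψ z m τ) ?_, h0]
  · have : pathPt ((0, m) : Ph d) = 0 := by simp [pathPt]
    have h2 : gal z (0 : Ph d) = z := by simp [gal]
    rw [this, h2, zero_sub]
  · apply Continuous.intervalIntegrable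
    refine ((by fun_prop : Continuous fun τ : ℝ => 3 * τ ^ 2).mul (hcont _)).add
      (continuous_finsetSum _ fun i _ => ?_)
    exact (by fun_prop : Continuous fun τ : ℝ => m.1 i + 2 * τ * m.2 i).mul (hcont _)

/-- The dual function `φ` solves `-𝒯 φ = ψ + div_v Φ` as long as `ψ` vanishes at the
endpoints of the paths from `z`. -/
theorem transport_pathAvg_add {ψ : Ph d → ℝ} (hψ : ContDiff ℝ ∞ ψ) (z : Ph d)
    (h0 : ∀ m : Sp d × Sp d, ψ (gal z (pathPt (1, m))) = 0) :
    transport (pathAvg (Ioo 0 1) dualWeight ψ) z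
      + ∑ i, dV i (pathAvg (Ioo 0 1) (fluxWeight i) ψ) z = -ψ z := by
  have hT : Ioo (0 : ℝ) 1 ⊆ Icc 0 1 := Ioo_subset_Icc_self
  have hcont : ∀ e : Ph d, Continuous fun p : Ph d =>
      fderiv ℝ (fun z => ψ (gal z (pathPt p))) z e := fun e => by
    have := (contDiff_fderiv_kernel (contDiff_path_kernel hψ)).continuous.comp
      (f := fun p : Ph d => (p, z)) (by fun_prop)
    exact this.clm_apply continuous_const
  set D : Ph d → ℝ := fun p => 3 * p.1 ^ 2 *
    fderiv ℝ (fun z => ψ (gal z (pathPt p))) z (1, z.2.2, 0) + ∑ i, (p.2.1 i + 2 * p.1 * p.2.2 i) *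
          fderiv ℝ (fun z => ψ (gal z (pathPt p))) z (eV i) with hD
  have hDc : Continuous D := by
    refine ((by fun_prop : Continuous fun p : Ph d => 3 * p.1 ^ 2).mul (hcont _)).add
      (continuous_finsetSum _ fun i _ => ?_)
    exact (by fun_prop : Continuous fun p : Ph d => p.2.1 i + 2 * p.1 * p.2.2 i).mul (hcont _)
  have h1 : transport (pathAvg (Ioo 0 1) dualWeight ψ) z
      + ∑ i, dV i (pathAvg (Ioo 0 1) (fluxWeight i) ψ) z =
      ∫ p, (Prod.fst ⁻¹' Ioo (0 : ℝ) 1).indicator (fun p : Ph d => dirDensity p.2) p * D p := by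
    unfold transport dV
    rw [fderiv_pathAvg isWeight_dualWeight hψ measurableSet_Ioo hT]
    simp only [fderiv_pathAvg (isWeight_fluxWeight _) hψ measurableSet_Ioo hT]
    rw [← integral_finsetSum _ fun i _ =>
      (isWeight_fluxWeight i).integrable_mul measurableSet_Ioo hT (hcont _),
      ← integral_add (isWeight_dualWeight.integrable_mul measurableSet_Ioo hT (hcont _))
        (integrable_finsetSum _ fun i _ =>
          (isWeight_fluxWeight i).integrable_mul measurableSet_Ioo hT (hcont _))]
    refine integral_congr_ae (Eventually.of_forall fun p => ?_)
    by_cases hp : p ∈ (Prod.fst ⁻¹' Ioo (0 : ℝ) 1 : Set (Ph d))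
    · simp only [indicator_of_mem hp, hD, dualWeight, fluxWeight, mul_add, Finset.mul_sum]
      congr 1
      · ring
      · exact Finset.sum_congr rfl fun i _ => by ring
    · simp only [indicator_of_notMem hp, zero_mul, Finset.sum_const_zero, add_zero]
  rw [h1]
  have hint := isWeight_dirDensity.integrable_mul measurableSet_Ioo hT hDc
  change ∫ p, _ ∂(volume.prod volume) = _
  rw [integral_prod_symm _ hint]
  have h2 : ∀ m : Sp d × Sp d, ∫ τ : ℝ, (Prod.fst ⁻¹' Ioo (0 : ℝ) 1).indicator
      (fun p : Ph d => dirDensity p.2) (τ, m) * D (τ, m) = dirDensity m * -ψ z := by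
    intro m
    rw [← integral_path_deriv hψ z m (h0 m), ← integral_const_mul,
      ← integral_indicator measurableSet_Ioo]
    refine integral_congr_ae (Eventually.of_forall fun τ => ?_)
    by_cases hτ : τ ∈ Ioo (0 : ℝ) 1
    · simp only [indicator_of_mem hτ]
      rw [indicator_of_mem (by exact hτ)]
    · simp only [indicator_of_notMem hτ]
      rw [indicator_of_notMem (by exact hτ), zero_mul]
  simp only [h2]
  rw [integral_mul_const, integral_dirDensity, one_mul]

/-- Integration by parts in the directions `m₁, m₂`. -/
theorem integral_weight_mul_fderiv {c F : Ph d → ℝ} (hc : IsWeight c) (hF : ContDiff ℝ ∞ F)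
    {T : Set ℝ} (hT : MeasurableSet T) (hT' : T ⊆ Icc 0 1) {e : Ph d} (he : e.1 = 0) :
    ∫ p, (Prod.fst ⁻¹' T).indicator c p * fderiv ℝ F p e =
      -∫ p, (Prod.fst ⁻¹' T).indicator (fun p => fderiv ℝ c p e) p * F p := by
  have hdF : Continuous fun p => fderiv ℝ F p e :=
    ((hF.fderiv_right (m := ∞) le_rfl).clm_apply contDiff_const).continuous
  refine integral_bilinear_hasLineDerivAt_right_eq_neg_left_of_integrable
    (B := ContinuousLinearMap.mul ℝ ℝ) (v := e)
    ((hc.fderiv_apply e).integrable_mul hT hT' hF.continuous)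
    (hc.integrable_mul hT hT' hdF) (hc.integrable_mul hT hT' hF.continuous) ?_ ?_
  · intro p _
    have hl := ((hc.contDiff.differentiable (by simp)) p).hasFDerivAt.hasLineDerivAt e
    unfold HasLineDerivAt at hl ⊢
    have hmem : ∀ r : ℝ, (p + r • e ∈ (Prod.fst ⁻¹' T : Set (Ph d))) ↔
        p ∈ (Prod.fst ⁻¹' T : Set (Ph d)) := fun r => by simp [he]
    by_cases hp : p ∈ (Prod.fst ⁻¹' T : Set (Ph d))
    · simp only [indicator_of_mem hp]
      refine hl.congr_of_eventuallyEq (Eventually.of_forall fun r => ?_)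
      exact indicator_of_mem ((hmem r).2 hp) c
    · simp only [indicator_of_notMem hp]
      refine (hasDerivAt_const (0 : ℝ) (0 : ℝ)).congr_of_eventuallyEq
        (Eventually.of_forall fun r => ?_)
      exact indicator_of_notMem (fun h => hp ((hmem r).1 h)) c
  · intro p _
    exact ((hF.differentiable (by simp)) p).hasFDerivAt.hasLineDerivAt e

theorem fderiv_path_dir {ψ : Ph d → ℝ} (hψ : ContDiff ℝ ∞ ψ) (z p : Ph d) (a b : Sp d) :
    fderiv ℝ (fun p => ψ (gal z (pathPt p))) p (0, a, b) = fderiv ℝ ψ (gal z (pathPt p))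
      (0, (p.1 ^ 4 / 4) • a + (2 * p.1 ^ 5 / 5) • b, p.1 • a + p.1 ^ 2 • b) := by
  have hF : ContDiff ℝ ∞ fun p => ψ (gal z (pathPt p)) :=
    (contDiff_path_kernel hψ).comp (contDiff_id.prodMk contDiff_const)
  rw [← (hF.differentiable (by simp) p).lineDeriv_eq_fderiv]
  have h2 : ∀ a b : Sp d, HasDerivAt (fun r : ℝ => a + r • b) b 0 := fun a b => by
    simpa using ((hasDerivAt_id (0 : ℝ)).smul_const b).const_add a
  have h3 : ∀ c c' : ℝ, HasDerivAt (fun r : ℝ => c • (p.2.1 + r • a) + c' • (p.2.2 + r • b))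
      (c • a + c' • b) 0 := fun c c' =>
    ((h2 p.2.1 a).fun_const_smul c).fun_add ((h2 p.2.2 b).fun_const_smul c')
  have h1 := (hasDerivAt_const (0 : ℝ) (z.1 + p.1 ^ 3)).prodMk
    ((((h3 (p.1 ^ 4 / 4) (2 * p.1 ^ 5 / 5)).const_add z.2.1).add_const (p.1 ^ 3 • z.2.2)).prodMk
      ((h3 p.1 (p.1 ^ 2)).const_add z.2.2))
  have hc : ∀ r : ℝ, gal z (pathPt (p + r • ((0, a, b) : Ph d))) =
      (z.1 + p.1 ^ 3,
      z.2.1 + ((p.1 ^ 4 / 4) • (p.2.1 + r • a) + (2 * p.1 ^ 5 / 5) • (p.2.2 + r • b))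
        + p.1 ^ 3 • z.2.2,
      z.2.2 + (p.1 • (p.2.1 + r • a) + p.1 ^ 2 • (p.2.2 + r • b))) := fun r => by
    simp [pathPt, gal]
  unfold lineDeriv
  simp only [hc]
  have hp : gal z (pathPt p) = (z.1 + p.1 ^ 3,
      z.2.1 + ((p.1 ^ 4 / 4) • (p.2.1 + (0 : ℝ) • a) + (2 * p.1 ^ 5 / 5) • (p.2.2 + (0 : ℝ) • b))
        + p.1 ^ 3 • z.2.2,
      z.2.2 + (p.1 • (p.2.1 + (0 : ℝ) • a) + p.1 ^ 2 • (p.2.2 + (0 : ℝ) • b))) := by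
    simp [pathPt, gal]
  rw [hp]
  exact (((hψ.differentiable (by simp)) _).hasFDerivAt.comp_hasDerivAt (0 : ℝ) h1).deriv

/-- The velocity derivatives of the dual function are path averages too. The directions
`-4τ e_i` in `m₁` and `5 e_i` in `m₂` displace the endpoint in the same way as `τ² e_i` displaces
it when added to the initial velocity. -/
theorem dV_pathAvg_dualWeight {ψ : Ph d → ℝ} (hψ : ContDiff ℝ ∞ ψ) (i : Fin d) (z : Ph d) :
    dV i (pathAvg (Ioo 0 1) dualWeight ψ) z = pathAvg (Ioo 0 1) (gradWeight i) ψ z := by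
  have hT : Ioo (0 : ℝ) 1 ⊆ Icc 0 1 := Ioo_subset_Icc_self
  set e : Sp d := EuclideanSpace.single i 1 with he
  set F : Ph d → ℝ := fun p => ψ (gal z (pathPt p)) with hFdef
  have hF : ContDiff ℝ ∞ F := (contDiff_path_kernel hψ).comp (contDiff_id.prodMk contDiff_const)
  have w1 : IsWeight fun p : Ph d => (12 * p.1) * dirDensity p.2 :=
    isWeight_dirDensity.mul_left (by fun_prop)
  have w2 : IsWeight fun p : Ph d => (-15) * dirDensity p.2 :=
    isWeight_dirDensity.mul_left (by fun_prop)
  have hdF : ∀ e, Continuous fun p => fderiv ℝ F p e := fun e =>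
    ((hF.fderiv_right (m := ∞) le_rfl).clm_apply contDiff_const).continuous
  have key : ∀ p : Ph d, ∀ a b : Sp d, fderiv ℝ F p (0, a, b) = fderiv ℝ ψ (gal z (pathPt p))
      (0, (p.1 ^ 4 / 4) • a + (2 * p.1 ^ 5 / 5) • b, p.1 • a + p.1 ^ 2 • b) :=
    fun p a b => fderiv_path_dir hψ z p a b
  have hpt : ∀ p : Ph d, dualWeight p * fderiv ℝ (fun z => ψ (gal z (pathPt p))) z (eV i) =
      -((12 * p.1) * dirDensity p.2 * fderiv ℝ F p (0, e, 0) +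
        (-15) * dirDensity p.2 * fderiv ℝ F p (0, 0, e)) := by
    intro p
    rw [key, key, fderiv_comp_gal_left hψ]
    set L := fderiv ℝ ψ (gal z (pathPt p))
    -- in the position variables `τ³ ⬝ τ² = -4 τ ⬝ τ⁴ / 4 + 5 ⬝ 2 τ⁵ / 5`, in the velocity variables
    -- `τ² = -4 τ ⬝ τ + 5 τ²`
    have hL : L (0, p.1 ^ 3 • e, e) * p.1 ^ 2 =
        -4 * p.1 * L (0, (p.1 ^ 4 / 4) • e, p.1 • e)
          + 5 * L (0, (2 * p.1 ^ 5 / 5) • e, p.1 ^ 2 • e) := by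
      have hLs : ∀ (a : ℝ) (x : Ph d), a * L x = L (a • x) := fun a x => by simp
      rw [mul_comm, hLs, hLs, hLs, ← map_add]
      congr 1
      ext1
      · simp
      ext1
      · simp only [Prod.smul_mk, Prod.mk_add_mk, smul_smul, ← add_smul]
        congr 1
        ring
      · simp only [Prod.smul_mk, Prod.mk_add_mk, smul_smul, ← add_smul]
        congr 1
        ring
    simp only [eV, smul_zero, add_zero, zero_add, ← he, pathPt, dualWeight]
    linear_combination 3 * dirDensity p.2 * hL
  unfold dV
  rw [fderiv_pathAvg isWeight_dualWeight hψ measurableSet_Ioo hT]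
  have e1 := integral_weight_mul_fderiv w1 hF measurableSet_Ioo hT (e := (0, e, 0)) rfl
  have e2 := integral_weight_mul_fderiv w2 hF measurableSet_Ioo hT (e := (0, 0, e)) rfl
  have i1 := w1.integrable_mul measurableSet_Ioo hT (hdF (0, e, 0))
  have i2 := w2.integrable_mul measurableSet_Ioo hT (hdF (0, 0, e))
  have j1 := (w1.fderiv_apply (0, e, 0)).integrable_mul measurableSet_Ioo hT hF.continuous
  have j2 := (w2.fderiv_apply (0, 0, e)).integrable_mul measurableSet_Ioo hT hF.continuous
  calc _ = -∫ p, ((Prod.fst ⁻¹' Ioo (0 : ℝ) 1).indicator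
          (fun p : Ph d => (12 * p.1) * dirDensity p.2) p * fderiv ℝ F p (0, e, 0) +
        (Prod.fst ⁻¹' Ioo (0 : ℝ) 1).indicator
          (fun p : Ph d => (-15) * dirDensity p.2) p * fderiv ℝ F p (0, 0, e)) := by
        rw [← integral_neg]
        refine integral_congr_ae (Eventually.of_forall fun p => ?_)
        by_cases hp : p ∈ (Prod.fst ⁻¹' Ioo (0 : ℝ) 1 : Set (Ph d))
        · simp only [indicator_of_mem hp]
          exact hpt p
        · simp only [indicator_of_notMem hp, zero_mul, add_zero, neg_zero]
    _ = _ := by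
        rw [integral_add i1 i2, e1, e2, ← neg_add, neg_neg, ← integral_add j1 j2]
        refine integral_congr_ae (Eventually.of_forall fun p => ?_)
        by_cases hp : p ∈ (Prod.fst ⁻¹' Ioo (0 : ℝ) 1 : Set (Ph d))
        · simp only [indicator_of_mem hp, gradWeight, ← he, hFdef]
          ring
        · simp only [indicator_of_notMem hp, zero_mul, add_zero]

/-! ### Bounds for path averages -/

theorem lintegral_comp_smul_add {c : ℝ} (hc : 0 < c) (b : Sp d) {F : Sp d → ℝ≥0∞}
    (hF : Measurable F) :
    ∫⁻ m, F (c • m + b) = ENNReal.ofReal ((c ^ d)⁻¹) * ∫⁻ y, F y := by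
  have h1 : ∫⁻ m, F (c • m + b) = ∫⁻ y, F (y + b) ∂(Measure.map (c • ·) (volume : Measure (Sp d))) :=
    (lintegral_map (f := fun y => F (y + b)) (hF.comp (measurable_add_const b))
      (measurable_const_smul c)).symm
  rw [h1, Measure.map_addHaar_smul _ hc.ne', lintegral_smul_measure, lintegral_add_right_eq_self,
    abs_of_pos (by positivity)]
  simp

theorem measurable_lintegral_slice {h : Ph d → ℝ≥0∞} (hh : Measurable h) :
    Measurable fun t : ℝ => ∫⁻ y : Sp d × Sp d, h (t, y) :=
  Measurable.lintegral_prod_right' hh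

/-- Change of variables from path directions to endpoints, at a fixed time: `m₁` is exchanged for
the final velocity, and then `m₂`, on which the final position depends affinely, for the position. -/
theorem lintegral_path_dir {h : Ph d → ℝ≥0∞} (hh : Measurable h) (z : Ph d) {τ : ℝ} (hτ : 0 < τ) :
    ∫⁻ m : Sp d × Sp d, h (gal z (pathPt (τ, m))) =
      ENNReal.ofReal (((3 * τ ^ 6 / 20) ^ d)⁻¹) * ∫⁻ y : Sp d × Sp d, h (z.1 + τ ^ 3, y) := by
  have hcont : Continuous fun m : Sp d × Sp d => gal z (pathPt (τ, m)) :=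
    (continuous_gal_left z).comp (contDiff_pathPt.continuous.comp (by fun_prop))
  have hm : Measurable fun m : Sp d × Sp d => h (gal z (pathPt (τ, m))) := hh.comp hcont.measurable
  have h3 : ∀ m₁ m₂ : Sp d, gal z (pathPt (τ, m₁, m₂)) =
      (z.1 + τ ^ 3,
        (3 * τ ^ 5 / 20) • m₂ + (z.2.1 + τ ^ 3 • z.2.2
          + (τ ^ 3 / 4) • ((τ • m₁ + (z.2.2 + τ ^ 2 • m₂)) - z.2.2)),
        τ • m₁ + (z.2.2 + τ ^ 2 • m₂)) := by
    intro m₁ m₂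
    simp only [gal, pathPt]
    ext1
    · rfl
    ext1
    · module
    · simp only
      abel
  have e1 : ∀ m₂ : Sp d, ∫⁻ m₁ : Sp d, h (gal z (pathPt (τ, m₁, m₂))) =
      ENNReal.ofReal ((τ ^ d)⁻¹) * ∫⁻ w : Sp d, h (z.1 + τ ^ 3,
        (3 * τ ^ 5 / 20) • m₂ + (z.2.1 + τ ^ 3 • z.2.2 + (τ ^ 3 / 4) • (w - z.2.2)), w) := by
    intro m₂
    simp only [h3]
    exact lintegral_comp_smul_add hτ (z.2.2 + τ ^ 2 • m₂)
      (F := fun w => h (z.1 + τ ^ 3, (3 * τ ^ 5 / 20) • m₂ + (z.2.1 + τ ^ 3 • z.2.2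
        + (τ ^ 3 / 4) • (w - z.2.2)), w)) (hh.comp (Continuous.measurable (by fun_prop)))
  have e2 : ∀ w : Sp d, ∫⁻ m₂ : Sp d, h (z.1 + τ ^ 3,
        (3 * τ ^ 5 / 20) • m₂ + (z.2.1 + τ ^ 3 • z.2.2 + (τ ^ 3 / 4) • (w - z.2.2)), w) =
      ENNReal.ofReal (((3 * τ ^ 5 / 20) ^ d)⁻¹) * ∫⁻ x : Sp d, h (z.1 + τ ^ 3, x, w) := by
    intro w
    exact lintegral_comp_smul_add (by positivity) _
      (F := fun x => h (z.1 + τ ^ 3, x, w)) (hh.comp (Continuous.measurable (by fun_prop)))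
  change ∫⁻ m : Sp d × Sp d, h (gal z (pathPt (τ, m))) ∂(volume.prod volume) = _
  rw [lintegral_prod_symm' _ hm]
  simp only [e1]
  rw [lintegral_const_mul' _ _ ENNReal.ofReal_ne_top, lintegral_lintegral_swap]
  · simp only [e2]
    rw [lintegral_const_mul' _ _ ENNReal.ofReal_ne_top, ← mul_assoc,
      ← ENNReal.ofReal_mul (by positivity)]
    congr 1
    · congr 1
      rw [← mul_inv, ← mul_pow]
      congr 2
      ring
    · change _ = ∫⁻ y : Sp d × Sp d, h (z.1 + τ ^ 3, y) ∂(volume.prod volume)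
      exact (lintegral_prod_symm' (fun y : Sp d × Sp d => h (z.1 + τ ^ 3, y))
        (hh.comp measurable_prodMk_left)).symm
  · refine (hh.comp (Continuous.measurable ?_)).aemeasurable
    fun_prop

/-- Away from `τ = 0` the path averages are bounded by the `L¹` norm. -/
theorem lintegral_path_far {h : Ph d → ℝ≥0∞} (hh : Measurable h) (z : Ph d) {τ₀ : ℝ} (hτ : 0 < τ₀) :
    ∫⁻ p in Ico τ₀ 1 ×ˢ (univ : Set (Sp d × Sp d)), h (gal z (pathPt p)) ≤
      ENNReal.ofReal (((3 * τ₀ ^ 6 / 20) ^ d)⁻¹ * (3 * τ₀ ^ 2)⁻¹) * ∫⁻ y, h y := by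
  have hm : Measurable fun p : Ph d => h (gal z (pathPt p)) :=
    hh.comp ((continuous_gal_left z).comp contDiff_pathPt.continuous).measurable
  set I : ℝ → ℝ≥0∞ := fun t => ∫⁻ y : Sp d × Sp d, h (t, y) with hI
  have hIm : Measurable I := measurable_lintegral_slice hh
  have htime : ∫⁻ τ in Ico τ₀ 1, I (z.1 + τ ^ 3) ≤
      ENNReal.ofReal ((3 * τ₀ ^ 2)⁻¹) * ∫⁻ t, I t := by
    have hinj : InjOn (fun τ : ℝ => z.1 + τ ^ 3) (Ico τ₀ 1) := by
      intro a ha b hb hab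
      have h1 : a ^ 3 = b ^ 3 := add_left_cancel hab
      exact (pow_left_inj₀ (hτ.le.trans ha.1) (hτ.le.trans hb.1) (by norm_num)).1 h1
    have h2 := lintegral_image_eq_lintegral_abs_deriv_mul (s := Ico τ₀ 1) measurableSet_Ico
      (f := fun τ : ℝ => z.1 + τ ^ 3) (f' := fun τ => 3 * τ ^ 2)
      (fun τ _ => by simpa using ((hasDerivAt_pow 3 τ).const_add z.1).hasDerivWithinAt) hinj I
    calc ∫⁻ τ in Ico τ₀ 1, I (z.1 + τ ^ 3)
        ≤ ∫⁻ τ in Ico τ₀ 1, ENNReal.ofReal ((3 * τ₀ ^ 2)⁻¹) *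
            (ENNReal.ofReal |3 * τ ^ 2| * I (z.1 + τ ^ 3)) := by
          refine setLIntegral_mono' measurableSet_Ico fun τ hτ' => ?_
          rw [← mul_assoc, ← ENNReal.ofReal_mul (by positivity)]
          refine le_mul_of_one_le_left zero_le ?_
          rw [ENNReal.one_le_ofReal, abs_of_nonneg (by positivity), inv_mul_eq_div,
            one_le_div (by positivity)]
          have := hτ'.1
          gcongr
      _ = ENNReal.ofReal ((3 * τ₀ ^ 2)⁻¹) * ∫⁻ t in (fun τ : ℝ => z.1 + τ ^ 3) '' Ico τ₀ 1, I t := by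
          rw [lintegral_const_mul' _ _ ENNReal.ofReal_ne_top, h2]
      _ ≤ _ := by
          gcongr
          exact Measure.restrict_le_self
  calc ∫⁻ p in Ico τ₀ 1 ×ˢ (univ : Set (Sp d × Sp d)), h (gal z (pathPt p))
      = ∫⁻ τ in Ico τ₀ 1, ∫⁻ m : Sp d × Sp d, h (gal z (pathPt (τ, m))) := by
        change ∫⁻ p in Ico τ₀ 1 ×ˢ (univ : Set (Sp d × Sp d)), h (gal z (pathPt p))
          ∂(volume.prod volume) = _
        rw [← Measure.prod_restrict, lintegral_prod _ hm.aemeasurable, Measure.restrict_univ]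
    _ ≤ ∫⁻ τ in Ico τ₀ 1, ENNReal.ofReal (((3 * τ₀ ^ 6 / 20) ^ d)⁻¹) * I (z.1 + τ ^ 3) := by
        refine setLIntegral_mono' measurableSet_Ico fun τ hτ' => ?_
        rw [lintegral_path_dir hh z (hτ.trans_le hτ'.1)]
        have := hτ'.1
        gcongr
    _ ≤ ENNReal.ofReal (((3 * τ₀ ^ 6 / 20) ^ d)⁻¹) *
          (ENNReal.ofReal ((3 * τ₀ ^ 2)⁻¹) * ∫⁻ t, I t) := by
        rw [lintegral_const_mul' _ _ ENNReal.ofReal_ne_top]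
        gcongr
    _ = _ := by
        rw [← mul_assoc, ← ENNReal.ofReal_mul (by positivity)]
        congr 1
        change _ = ∫⁻ y, h y ∂(volume.prod volume)
        rw [lintegral_prod _ hh.aemeasurable]

theorem enorm_pathAvg_le {T : Set ℝ} (hT : MeasurableSet T) (hT' : T ⊆ Icc 0 1) {c ψ : Ph d → ℝ}
    (hc : IsWeight c) {C : ℝ} (hC : ∀ p : Ph d, p.1 ∈ Icc (0 : ℝ) 1 → |c p| ≤ C) (z : Ph d) :
    ‖pathAvg T c ψ z‖ₑ ≤ ENNReal.ofReal C *
      ∫⁻ p in T ×ˢ Metric.closedBall (0 : Sp d × Sp d) 1, ‖ψ (gal z (pathPt p))‖ₑ := by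
  refine (enorm_integral_le_lintegral_enorm _).trans ?_
  rw [← lintegral_indicator (hT.prod Metric.isClosed_closedBall.measurableSet),
    ← lintegral_const_mul' _ _ ENNReal.ofReal_ne_top]
  refine lintegral_mono fun p => ?_
  rw [enorm_mul]
  by_cases h1 : p.1 ∈ T
  · rw [indicator_of_mem (by exact h1)]
    by_cases h2 : p.2 ∈ Metric.closedBall (0 : Sp d × Sp d) 1
    · rw [indicator_of_mem (by exact ⟨h1, h2⟩)]
      gcongr
      rw [Real.enorm_eq_ofReal_abs]
      exact ENNReal.ofReal_le_ofReal (hC p (hT' h1))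
    · rw [hc.support p h2]
      simp
  · rw [indicator_of_notMem (by exact h1)]
    simp

/-- Paths with small `τ` contribute little to the `L²` norm of a path average: the Cauchy-Schwarz
inequality in the path variables, and invariance of the measure under right translations. -/
theorem eLpNorm_pathAvg_near {c ψ : Ph d → ℝ} (hc : IsWeight c) {C : ℝ}
    (hC : ∀ p : Ph d, p.1 ∈ Icc (0 : ℝ) 1 → |c p| ≤ C) (hψ : Continuous ψ) {τ₀ : ℝ}
    (h1 : τ₀ ≤ 1) :
    eLpNorm (pathAvg (Ioo 0 τ₀) c ψ) 2 ≤ ENNReal.ofReal C * (ENNReal.ofReal τ₀ *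
      volume (Metric.closedBall (0 : Sp d × Sp d) 1)) * eLpNorm ψ 2 := by
  have hT' : Ioo 0 τ₀ ⊆ Icc 0 1 := fun t ht => ⟨ht.1.le, ht.2.le.trans h1⟩
  set ν : Measure (Ph d) := volume.restrict (Ioo 0 τ₀ ×ˢ Metric.closedBall (0 : Sp d × Sp d) 1)
  have hν : ν univ = ENNReal.ofReal τ₀ * volume (Metric.closedBall (0 : Sp d × Sp d) 1) := by
    rw [Measure.restrict_apply_univ]
    change (volume.prod volume) _ = _
    rw [Measure.prod_prod, Real.volume_Ioo, sub_zero]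
  have hν' : ν univ ≠ ⊤ := by
    rw [hν]
    exact ENNReal.mul_ne_top ENNReal.ofReal_ne_top (isCompact_closedBall _ _).measure_lt_top.ne
  have : IsFiniteMeasure ν := ⟨hν'.lt_top⟩
  rw [← hν, ← ENNReal.pow_le_pow_left_iff two_ne_zero, mul_pow, mul_pow, eLpNorm_two_sq,
    eLpNorm_two_sq]
  have hcont : Continuous fun q : Ph d × Ph d => ψ (gal q.1 (pathPt q.2)) :=
    hψ.comp (continuous_gal.comp (continuous_fst.prodMk
      (contDiff_pathPt.continuous.comp continuous_snd)))
  calc ∫⁻ z, ‖pathAvg (Ioo 0 τ₀) c ψ z‖ₑ ^ 2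
      ≤ ∫⁻ z, ENNReal.ofReal C ^ 2 * (ν univ * ∫⁻ p, ‖ψ (gal z (pathPt p))‖ₑ ^ 2 ∂ν) := by
        refine lintegral_mono fun z => ?_
        calc ‖pathAvg (Ioo 0 τ₀) c ψ z‖ₑ ^ 2
            ≤ (ENNReal.ofReal C * ∫⁻ p, ‖ψ (gal z (pathPt p))‖ₑ ∂ν) ^ 2 := by
              gcongr
              exact enorm_pathAvg_le measurableSet_Ioo hT' hc hC z
          _ ≤ _ := by
              rw [mul_pow]
              gcongr
              exact lintegral_sq_le ν (hcont.comp
                (continuous_const.prodMk continuous_id)).enorm.measurable.aemeasurable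
    _ = ENNReal.ofReal C ^ 2 * (ν univ * ∫⁻ p, (∫⁻ z, ‖ψ (gal z (pathPt p))‖ₑ ^ 2) ∂ν) := by
        rw [lintegral_const_mul' _ _ (by simp), lintegral_const_mul' _ _ hν',
          lintegral_lintegral_swap]
        exact (hcont.enorm.measurable.pow_const 2).aemeasurable
    _ = ENNReal.ofReal C ^ 2 * (ν univ * ∫⁻ p, (∫⁻ z, ‖ψ z‖ₑ ^ 2) ∂ν) := by
        congr 2
        refine lintegral_congr fun p => ?_
        exact (measurePreserving_gal_right (pathPt p)).lintegral_comp
          (f := fun z => ‖ψ z‖ₑ ^ 2) (hψ.enorm.measurable.pow_const 2)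
    _ = _ := by
        rw [lintegral_const]
        ring

/-- The gain of integrability of path averages: a small multiple of the `L²` norm plus a large
multiple of the `L¹` norm. -/
theorem exists_eLpNorm_pathAvg_le {V : Set (Ph d)} (hV : volume V ≠ ⊤) {c : Ph d → ℝ}
    (hc : IsWeight c) :
    ∃ C : ℝ≥0, ∀ ψ : Ph d → ℝ, ContDiff ℝ ∞ ψ → ∀ τ₀ : ℝ, 0 < τ₀ → τ₀ ≤ 1 →
      eLpNorm (pathAvg (Ioo 0 1) c ψ) 2 (volume.restrict V) ≤
        C * (ENNReal.ofReal τ₀ * eLpNorm ψ 2 +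
          ENNReal.ofReal ((τ₀ ^ (6 * d + 2))⁻¹) * eLpNorm ψ 1) := by
  obtain ⟨Cc, hC0, hCc⟩ := hc.exists_bound
  have hB : volume (Metric.closedBall (0 : Sp d × Sp d) 1) ≠ ⊤ :=
    (isCompact_closedBall _ _).measure_lt_top.ne
  have hV2 : volume V ^ (1 / 2 : ℝ) ≠ ⊤ := ENNReal.rpow_ne_top_of_nonneg (by norm_num) hV
  set b := (volume (Metric.closedBall (0 : Sp d × Sp d) 1)).toNNReal
  set v := (volume V ^ (1 / 2 : ℝ)).toNNReal
  refine ⟨Cc.toNNReal * (b + v * (20 ^ d : ℝ).toNNReal), fun ψ hψ τ₀ h0 h1 => ?_⟩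
  have hψc := hψ.continuous
  have hTn : Ioo 0 τ₀ ⊆ Icc 0 1 := fun t ht => ⟨ht.1.le, ht.2.le.trans h1⟩
  have hTf : Ico τ₀ 1 ⊆ Icc 0 1 := fun t ht => ⟨h0.le.trans ht.1, ht.2.le⟩
  have hsplit : pathAvg (Ioo 0 1) c ψ = fun z =>
      pathAvg (Ioo 0 τ₀) c ψ z + pathAvg (Ico τ₀ 1) c ψ z := by
    ext z
    have hF : Continuous fun p : Ph d => ψ (gal z (pathPt p)) :=
      hψc.comp ((continuous_gal_left z).comp contDiff_pathPt.continuous)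
    unfold pathAvg
    rw [← integral_add (hc.integrable_mul measurableSet_Ioo hTn hF)
      (hc.integrable_mul measurableSet_Ico hTf hF)]
    congr 1
    ext p
    rw [← add_mul, ← Ioo_union_Ico_eq_Ioo h0 h1, preimage_union, indicator_union_of_disjoint]
    rw [Set.disjoint_left]
    intro p hp hp'
    exact absurd hp.2 (not_lt.2 hp'.1)
  have hnear : eLpNorm (pathAvg (Ioo 0 τ₀) c ψ) 2 (volume.restrict V) ≤
      Cc.toNNReal * (ENNReal.ofReal τ₀ * b) * eLpNorm ψ 2 := by
    refine (eLpNorm_mono_measure _ Measure.restrict_le_self).trans ?_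
    refine (eLpNorm_pathAvg_near hc hCc hψc h1).trans (le_of_eq ?_)
    rw [ENNReal.coe_toNNReal hB]
    rfl
  have hfar : eLpNorm (pathAvg (Ico τ₀ 1) c ψ) 2 (volume.restrict V) ≤
      v * (Cc.toNNReal * ((20 ^ d : ℝ).toNNReal * ENNReal.ofReal ((τ₀ ^ (6 * d + 2))⁻¹)
        * eLpNorm ψ 1)) := by
    have hb : ∀ z, ‖pathAvg (Ico τ₀ 1) c ψ z‖ₑ ≤ Cc.toNNReal * ((20 ^ d : ℝ).toNNReal *
        ENNReal.ofReal ((τ₀ ^ (6 * d + 2))⁻¹) * eLpNorm ψ 1) := by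
      intro z
      refine (enorm_pathAvg_le measurableSet_Ico hTf hc hCc z).trans ?_
      change (Cc.toNNReal : ℝ≥0∞) * _ ≤ _
      gcongr
      calc ∫⁻ p in Ico τ₀ 1 ×ˢ Metric.closedBall (0 : Sp d × Sp d) 1, ‖ψ (gal z (pathPt p))‖ₑ
          ≤ ∫⁻ p in Ico τ₀ 1 ×ˢ (univ : Set (Sp d × Sp d)), ‖ψ (gal z (pathPt p))‖ₑ :=
            lintegral_mono_set (prod_mono_right (subset_univ _))
        _ ≤ _ := lintegral_path_far (h := fun y => ‖ψ y‖ₑ) hψc.enorm.measurable z h0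
        _ ≤ _ := by
            rw [eLpNorm_one_eq_lintegral_enorm]
            gcongr
            change _ ≤ ENNReal.ofReal (20 ^ d) * _
            rw [← ENNReal.ofReal_mul (by positivity)]
            apply ENNReal.ofReal_le_ofReal
            rw [← mul_inv, show (20 : ℝ) ^ d * (τ₀ ^ (6 * d + 2))⁻¹ =
              ((20 ^ d)⁻¹ * τ₀ ^ (6 * d + 2))⁻¹ by rw [mul_inv, inv_inv]]
            apply inv_anti₀ (by positivity)
            rw [pow_add, pow_mul, ← mul_assoc, ← inv_pow, ← mul_pow]
            gcongr
            · nlinarith [pow_pos h0 6]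
            · nlinarith [pow_pos h0 2]
    refine (eLpNorm_le_of_ae_enorm_bound (Eventually.of_forall hb)).trans (le_of_eq ?_)
    rw [ENNReal.coe_toNNReal hV2, Measure.restrict_apply_univ]
    norm_num [mul_comm]
  rw [hsplit]
  refine (eLpNorm_add_le
    (contDiff_pathAvg hc hψ measurableSet_Ioo hTn).continuous.aestronglyMeasurable
    (contDiff_pathAvg hc hψ measurableSet_Ico hTf).continuous.aestronglyMeasurable
    (by norm_num)).trans ?_
  refine (add_le_add hnear hfar).trans ?_
  push_cast
  set X := ENNReal.ofReal τ₀ * eLpNorm ψ 2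
  set Y := ENNReal.ofReal ((τ₀ ^ (6 * d + 2))⁻¹) * eLpNorm ψ 1
  calc _ = (Cc.toNNReal : ℝ≥0∞) * b * X
        + (Cc.toNNReal : ℝ≥0∞) * (v * (20 ^ d : ℝ).toNNReal) * Y := by ring
    _ ≤ (Cc.toNNReal : ℝ≥0∞) * (b + v * (20 ^ d : ℝ).toNNReal) * X +
        (Cc.toNNReal : ℝ≥0∞) * (b + v * (20 ^ d : ℝ).toNNReal) * Y := by
        gcongr
        · exact le_self_add
        · exact le_add_self
    _ = _ := by ring

/-! ### Boxes and cutoff functions -/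

/-- The box `(-r, 0) × B_r × B_r`. -/
def box (r : ℝ) : Set (Ph d) := {z | -r < z.1 ∧ z.1 < 0 ∧ ‖z.2.1‖ < r ∧ ‖z.2.2‖ < r}

theorem isOpen_box (r : ℝ) : IsOpen (box (d := d) r) := by
  have h1 : IsOpen {z : Ph d | -r < z.1} := isOpen_lt (by fun_prop) (by fun_prop)
  have h2 : IsOpen {z : Ph d | z.1 < 0} := isOpen_lt (by fun_prop) (by fun_prop)
  have h3 : IsOpen {z : Ph d | ‖z.2.1‖ < r} := isOpen_lt (by fun_prop) (by fun_prop)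
  have h4 : IsOpen {z : Ph d | ‖z.2.2‖ < r} := isOpen_lt (by fun_prop) (by fun_prop)
  exact h1.inter (h2.inter (h3.inter h4))

theorem measurableSet_box (r : ℝ) : MeasurableSet (box (d := d) r) := (isOpen_box r).measurableSet

theorem box_mono {r r' : ℝ} (h : r ≤ r') : box (d := d) r ⊆ box r' := fun _ hz =>
  ⟨by linarith [hz.1], hz.2.1, hz.2.2.1.trans_le h, hz.2.2.2.trans_le h⟩

/-- The closed box `[-r, T] × B_r × B_r`. -/
def closedBox (r T : ℝ) : Set (Ph d) :=
  Icc (-r) T ×ˢ (Metric.closedBall 0 r ×ˢ Metric.closedBall 0 r)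

theorem isCompact_closedBox (r T : ℝ) : IsCompact (closedBox (d := d) r T) :=
  isCompact_Icc.prod ((isCompact_closedBall _ _).prod (isCompact_closedBall _ _))

theorem mem_closedBox {r T : ℝ} {z : Ph d} :
    z ∈ closedBox r T ↔ (-r ≤ z.1 ∧ z.1 ≤ T) ∧ ‖z.2.1‖ ≤ r ∧ ‖z.2.2‖ ≤ r := by
  simp [closedBox, Set.mem_prod]

theorem closedBox_subset_box {r r' T : ℝ} (h : r < r') (hT : T < 0) :
    closedBox (d := d) r T ⊆ box r' := by
  intro z hz
  rw [mem_closedBox] at hz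
  exact ⟨by linarith [hz.1.1], hz.1.2.trans_lt hT, hz.2.1.trans_lt h, hz.2.2.trans_lt h⟩

theorem volume_box_ne_top (r : ℝ) : volume (box (d := d) r) ≠ ⊤ := by
  refine ((measure_mono (t := closedBox r 0) fun z hz => ?_).trans_lt
    (isCompact_closedBox r 0).measure_lt_top).ne
  exact mem_closedBox.2 ⟨⟨hz.1.le, hz.2.1.le⟩, hz.2.2.1.le, hz.2.2.2.le⟩

theorem differentiable_smoothTransition : Differentiable ℝ Real.smoothTransition :=
  (Real.smoothTransition.contDiff (n := 1)).differentiable (by simp)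

theorem deriv_smoothTransition_of_neg {s : ℝ} (hs : s < 0) : deriv Real.smoothTransition s = 0 := by
  have : Real.smoothTransition =ᶠ[𝓝 s] fun _ => 0 := by
    filter_upwards [Iio_mem_nhds hs] with y hy
    exact Real.smoothTransition.zero_of_nonpos hy.le
  simp [this.deriv_eq]

theorem deriv_smoothTransition_of_one_lt {s : ℝ} (hs : 1 < s) :
    deriv Real.smoothTransition s = 0 := by
  have : Real.smoothTransition =ᶠ[𝓝 s] fun _ => 1 := by
    filter_upwards [Ioi_mem_nhds hs] with y hy
    exact Real.smoothTransition.one_of_one_le (le_of_lt hy)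
  simp [this.deriv_eq]

theorem deriv_smoothTransition_nonneg (s : ℝ) : 0 ≤ deriv Real.smoothTransition s :=
  Real.smoothTransition.monotone.deriv_nonneg

theorem exists_deriv_smoothTransition_le : ∃ L : ℝ, 0 ≤ L ∧ ∀ s, deriv Real.smoothTransition s ≤ L := by
  have hc : Continuous (deriv Real.smoothTransition) :=
    (Real.smoothTransition.contDiff (n := 1)).continuous_deriv le_rfl
  obtain ⟨C, hC⟩ := (isCompact_Icc (a := (0 : ℝ)) (b := 1)).exists_bound_of_continuousOn
    hc.continuousOn
  refine ⟨max C 0, le_max_right _ _, fun s => ?_⟩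
  by_cases h0 : s < 0
  · rw [deriv_smoothTransition_of_neg h0]
    exact le_max_right _ _
  by_cases h1 : 1 < s
  · rw [deriv_smoothTransition_of_one_lt h1]
    exact le_max_right _ _
  exact ((le_abs_self _).trans (hC s ⟨not_lt.1 h0, not_lt.1 h1⟩)).trans (le_max_left _ _)

/-- A radial cutoff between the balls of radius `r` and `m`. -/
def radialCut (r m : ℝ) (x : Sp d) : ℝ :=
  Real.smoothTransition ((m ^ 2 - ‖x‖ ^ 2) / (m ^ 2 - r ^ 2))

section radialCut

variable {r m : ℝ}

theorem contDiff_radialCut : ContDiff ℝ ∞ (radialCut (d := d) r m) :=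
  Real.smoothTransition.contDiff.comp ((contDiff_const.sub (contDiff_norm_sq ℝ)).div_const _)

theorem radialCut_eq_one (hr : 0 ≤ r) (hm : r < m) {x : Sp d} (hx : ‖x‖ ≤ r) :
    radialCut r m x = 1 := by
  apply Real.smoothTransition.one_of_one_le
  rw [one_le_div (by nlinarith)]
  nlinarith [norm_nonneg x]

theorem radialCut_eq_zero (hr : 0 ≤ r) (hm : r < m) {x : Sp d} (hx : m ≤ ‖x‖) :
    radialCut r m x = 0 := by
  apply Real.smoothTransition.zero_of_nonpos
  apply div_nonpos_of_nonpos_of_nonneg <;> nlinarith [norm_nonneg x]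

theorem radialCut_nonneg (x : Sp d) : 0 ≤ radialCut r m x := Real.smoothTransition.nonneg _

theorem radialCut_le_one (x : Sp d) : radialCut r m x ≤ 1 := Real.smoothTransition.le_one _

theorem exists_hasDerivAt_radialCut (hr : 1 / 2 ≤ r) (hm : r < m) (hm1 : m ≤ 1) {L : ℝ}
    (hL0 : 0 ≤ L) (hL : ∀ s, deriv Real.smoothTransition s ≤ L) (x w : Sp d) :
    ∃ D : ℝ, HasDerivAt (fun s : ℝ => radialCut r m (x + s • w)) D 0 ∧
      |D| ≤ 2 * L / (m - r) * ‖w‖ := by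
  have hd : 0 < m ^ 2 - r ^ 2 := by nlinarith
  have h1 : HasDerivAt (fun s : ℝ => x + s • w) w 0 := by
    simpa using ((hasDerivAt_id (0 : ℝ)).smul_const w).const_add x
  have h2 : HasDerivAt (fun s : ℝ => (m ^ 2 - ‖x + s • w‖ ^ 2) / (m ^ 2 - r ^ 2))
      (-(2 * inner ℝ x w) / (m ^ 2 - r ^ 2)) 0 := by
    have := (h1.norm_sq.const_sub (m ^ 2)).div_const (m ^ 2 - r ^ 2)
    simpa using this
  have h3 := (differentiable_smoothTransition
    ((m ^ 2 - ‖x + (0 : ℝ) • w‖ ^ 2) / (m ^ 2 - r ^ 2))).hasDerivAt.comp (0 : ℝ) h2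
  refine ⟨_, h3, ?_⟩
  simp only [zero_smul, add_zero]
  set s := (m ^ 2 - ‖x‖ ^ 2) / (m ^ 2 - r ^ 2) with hs
  have hmr : 0 < m - r := sub_pos.2 hm
  by_cases hs0 : s < 0
  · rw [deriv_smoothTransition_of_neg hs0, zero_mul, abs_zero]
    positivity
  have hx : ‖x‖ ≤ 1 := by
    by_contra hx
    apply hs0
    apply div_neg_of_neg_of_pos _ hd
    nlinarith
  have hin : |inner ℝ x w| ≤ ‖w‖ := (abs_real_inner_le_norm x w).trans
    (mul_le_of_le_one_left (norm_nonneg _) hx)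
  rw [abs_mul, abs_of_nonneg (deriv_smoothTransition_nonneg s), abs_div, abs_of_pos hd, abs_neg,
    abs_mul, abs_two]
  calc deriv Real.smoothTransition s * (2 * |inner ℝ x w| / (m ^ 2 - r ^ 2))
      ≤ L * (2 * ‖w‖ / (m - r)) := by
        have hle : m - r ≤ m ^ 2 - r ^ 2 := by nlinarith
        have h4 : 2 * |inner ℝ x w| / (m ^ 2 - r ^ 2) ≤ 2 * ‖w‖ / (m - r) :=
          div_le_div₀ (by positivity) (by linarith) hmr hle
        exact mul_le_mul (hL s) h4 (by positivity) hL0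
    _ = 2 * L / (m - r) * ‖w‖ := by ring

end radialCut

/-- A temporal cutoff, increasing on `[-m, -r]` and decreasing on `[T, T/2]`. -/
def timeCut (r m T t : ℝ) : ℝ :=
  Real.smoothTransition ((t + m) / (m - r)) * Real.smoothTransition ((T / 2 - t) / (-T / 2))

theorem contDiff_timeCut (r m T : ℝ) : ContDiff ℝ ∞ (timeCut r m T) :=
  (Real.smoothTransition.contDiff.comp (by fun_prop)).mul
    (Real.smoothTransition.contDiff.comp (by fun_prop))

theorem exists_hasDerivAt_timeCut {r m T : ℝ} (hm : r < m) (hT : T < 0) {L : ℝ}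
    (hL0 : 0 ≤ L) (hL : ∀ s, deriv Real.smoothTransition s ≤ L) (t : ℝ) :
    ∃ D : ℝ, HasDerivAt (timeCut r m T) D t ∧ D ≤ L / (m - r) ∧ (t < T → |D| ≤ L / (m - r)) := by
  have hmr : 0 < m - r := sub_pos.2 hm
  have h1 : HasDerivAt (fun t : ℝ => (t + m) / (m - r)) (1 / (m - r)) t :=
    ((hasDerivAt_id t).add_const m).div_const _
  have h2 : HasDerivAt (fun t : ℝ => (T / 2 - t) / (-T / 2)) (-1 / (-T / 2)) t :=
    ((hasDerivAt_id t).const_sub (T / 2)).div_const _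
  have h3 := (differentiable_smoothTransition ((t + m) / (m - r))).hasDerivAt.comp t h1
  have h4 := (differentiable_smoothTransition ((T / 2 - t) / (-T / 2))).hasDerivAt.comp t h2
  refine ⟨_, h3.mul h4, ?_⟩
  simp only [Function.comp_apply]
  set a := (t + m) / (m - r)
  set b := (T / 2 - t) / (-T / 2)
  have hda := deriv_smoothTransition_nonneg a
  have hdb := deriv_smoothTransition_nonneg b
  have ha0 := Real.smoothTransition.nonneg a
  have hb0 := Real.smoothTransition.nonneg b
  have hb1 := Real.smoothTransition.le_one b
  have hX : deriv Real.smoothTransition a * (1 / (m - r)) * Real.smoothTransition b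
      ≤ L / (m - r) := by
    calc _ ≤ L * (1 / (m - r)) * 1 := by
          gcongr
          exact hL a
      _ = _ := by ring
  have hX0 : 0 ≤ deriv Real.smoothTransition a * (1 / (m - r)) * Real.smoothTransition b := by
    positivity
  have hY : Real.smoothTransition a * (deriv Real.smoothTransition b * (-1 / (-T / 2))) ≤ 0 := by
    apply mul_nonpos_of_nonneg_of_nonpos ha0
    apply mul_nonpos_of_nonneg_of_nonpos hdb
    apply div_nonpos_of_nonpos_of_nonneg <;> linarith
  refine ⟨by linarith, fun htT => ?_⟩
  have hb : 1 < b := by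
    rw [one_lt_div (by linarith)]
    linarith
  rw [deriv_smoothTransition_of_one_lt hb, zero_mul, mul_zero, add_zero, abs_of_nonneg hX0]
  exact hX

/-- A cutoff between two boxes which equals `1` on the smaller one up to the time `T < 0`. The upper
bound on `𝒯 χ` does not depend on `T`, since `χ` decreases in time after `T`; a bound from below is
available only before `T`. -/
theorem exists_cutoff : ∃ L : ℝ, 1 ≤ L ∧ ∀ (d : ℕ) (r r' T : ℝ), 1 / 2 ≤ r → r < r' → r' ≤ 1 → T < 0 →
    ∃ χ : Ph d → ℝ, IsTestFun (box r') χ ∧ (∀ z, 0 ≤ χ z) ∧ (∀ z, χ z ≤ 1) ∧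
      (∀ z ∈ box r, z.1 ≤ T → χ z = 1) ∧ (∀ z, transport χ z ≤ L / (r' - r)) ∧
      (∀ z : Ph d, z.1 < T → |transport χ z| ≤ L / (r' - r)) ∧
      ∀ i z, |dV i χ z| ≤ L / (r' - r) := by
  obtain ⟨L₀, hL0, hL⟩ := exists_deriv_smoothTransition_le
  refine ⟨6 * L₀ + 1, by linarith, fun d r r' T hr hrr' hr' hT => ?_⟩
  set m := (r + r') / 2 with hm
  have hrm : r < m := by linarith
  have hmr' : m < r' := by linarith
  have hm1 : m ≤ 1 := by linarith
  have hr0 : 0 ≤ r := by linarith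
  have hδ : 0 < r' - r := by linarith
  set χ : Ph d → ℝ := fun z => timeCut r m T z.1 * radialCut r m z.2.1 * radialCut r m z.2.2 with hχ
  have hsmooth : ContDiff ℝ ∞ χ :=
    (((contDiff_timeCut r m T).comp contDiff_fst).mul
      (contDiff_radialCut.comp (contDiff_fst.comp contDiff_snd))).mul
      (contDiff_radialCut.comp (contDiff_snd.comp contDiff_snd))
  have t0 : ∀ t, 0 ≤ timeCut r m T t := fun t =>
    mul_nonneg (Real.smoothTransition.nonneg _) (Real.smoothTransition.nonneg _)
  have t1 : ∀ t, timeCut r m T t ≤ 1 := fun t =>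
    mul_le_one₀ (Real.smoothTransition.le_one _) (Real.smoothTransition.nonneg _)
      (Real.smoothTransition.le_one _)
  have hsupp : Function.support χ ⊆ closedBox m (T / 2) := by
    intro z hz
    have hz' := hz
    simp only [hχ, Function.mem_support, timeCut, mul_ne_zero_iff] at hz'
    obtain ⟨⟨⟨h1, h2⟩, h3⟩, h4⟩ := hz'
    refine mem_closedBox.2 ⟨⟨?_, ?_⟩, ?_, ?_⟩
    · by_contra h
      refine h1 (Real.smoothTransition.zero_of_nonpos ?_)
      apply div_nonpos_of_nonpos_of_nonneg <;> linarith
    · by_contra h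
      refine h2 (Real.smoothTransition.zero_of_nonpos ?_)
      apply div_nonpos_of_nonpos_of_nonneg <;> linarith
    · by_contra h
      exact h3 (radialCut_eq_zero hr0 hrm (not_le.1 h).le)
    · by_contra h
      exact h4 (radialCut_eq_zero hr0 hrm (not_le.1 h).le)
  have htest : IsTestFun (box r') χ := by
    refine ⟨hsmooth, HasCompactSupport.of_support_subset_isCompact (isCompact_closedBox m (T / 2))
      hsupp, ?_⟩
    exact (closure_minimal hsupp (isCompact_closedBox m (T / 2)).isClosed).trans
      (closedBox_subset_box hmr' (by linarith))
  have hmr : m - r = (r' - r) / 2 := by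
    rw [hm]
    ring
  have hT : ∀ z : Ph d, ∃ D E : ℝ, transport χ z = (D * radialCut r m z.2.1 + timeCut r m T z.1 * E)
      * radialCut r m z.2.2 ∧ D ≤ 2 * L₀ / (r' - r) ∧ (z.1 < T → |D| ≤ 2 * L₀ / (r' - r)) ∧
      |E| * radialCut r m z.2.2 ≤ 4 * L₀ / (r' - r) := by
    intro z
    obtain ⟨D, hD, hD1, hD2⟩ := exists_hasDerivAt_timeCut hrm hT hL0 hL z.1
    obtain ⟨E, hE, hE1⟩ := exists_hasDerivAt_radialCut hr hrm hm1 hL0 hL z.2.1 z.2.2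
    have e1 : L₀ / (m - r) = 2 * L₀ / (r' - r) := by
      rw [hmr]
      field_simp
    rw [e1] at hD1 hD2
    have e2 : 2 * L₀ / (m - r) = 4 * L₀ / (r' - r) := by
      rw [hmr]
      field_simp
      ring
    rw [e2] at hE1
    refine ⟨D, E, ?_, hD1, hD2, ?_⟩
    · have h1 : HasDerivAt (fun s : ℝ => timeCut r m T (z.1 + s)) D 0 := by
        have h5 : HasDerivAt (fun s : ℝ => z.1 + s) 1 0 := (hasDerivAt_id (0 : ℝ)).const_add z.1
        have h6 : HasDerivAt (timeCut r m T) D (z.1 + 0) := by simpa using hD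
        exact (h6.comp (0 : ℝ) h5).congr_deriv (mul_one D)
      have h2 := ((h1.mul hE).mul_const (radialCut r m z.2.2)).deriv
      unfold transport
      rw [← (hsmooth.differentiable (by simp) z).lineDeriv_eq_fderiv]
      unfold lineDeriv
      simp only [hχ, Prod.fst_add, Prod.snd_add, Prod.smul_fst, Prod.smul_snd, smul_eq_mul, mul_one,
        smul_zero, add_zero]
      simpa using h2
    · by_cases hv : ‖z.2.2‖ ≤ 1
      · calc |E| * radialCut r m z.2.2 ≤ (4 * L₀ / (r' - r) * ‖z.2.2‖) * 1 := by
              gcongr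
              · exact radialCut_nonneg _
              · exact radialCut_le_one _
          _ ≤ (4 * L₀ / (r' - r) * 1) * 1 := by gcongr
          _ = _ := by ring
      · rw [radialCut_eq_zero hr0 hrm (hm1.trans (not_le.1 hv).le), mul_zero]
        positivity
  have key : ∀ z : Ph d, ∀ D E : ℝ, ∀ B : ℝ, 0 ≤ B → D ≤ B → |E| * radialCut r m z.2.2 ≤ 2 * B →
      (D * radialCut r m z.2.1 + timeCut r m T z.1 * E) * radialCut r m z.2.2 ≤ 3 * B := by
    intro z D E B hB hD hE
    have a0 := radialCut_nonneg (r := r) (m := m) z.2.1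
    have a1 := radialCut_le_one (r := r) (m := m) z.2.1
    have b0 := radialCut_nonneg (r := r) (m := m) z.2.2
    have b1 := radialCut_le_one (r := r) (m := m) z.2.2
    have c1 : D * radialCut r m z.2.1 * radialCut r m z.2.2 ≤ B := by
      calc _ = D * (radialCut r m z.2.1 * radialCut r m z.2.2) := by ring
        _ ≤ B * (radialCut r m z.2.1 * radialCut r m z.2.2) := by gcongr
        _ ≤ B * 1 := by
            gcongr
            exact mul_le_one₀ a1 b0 b1
        _ = B := mul_one B
    have c2 : timeCut r m T z.1 * E * radialCut r m z.2.2 ≤ 2 * B := by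
      calc _ ≤ timeCut r m T z.1 * |E| * radialCut r m z.2.2 := by
            gcongr
            · exact t0 _
            · exact le_abs_self E
        _ ≤ 1 * |E| * radialCut r m z.2.2 := by
            gcongr
            exact t1 _
        _ ≤ _ := by rwa [one_mul]
    linarith [add_mul (D * radialCut r m z.2.1) (timeCut r m T z.1 * E) (radialCut r m z.2.2)]
  have hB : 3 * (2 * L₀ / (r' - r)) ≤ (6 * L₀ + 1) / (r' - r) := by
    rw [← mul_div_assoc]
    gcongr
    linarith
  have hB0 : 0 ≤ 2 * L₀ / (r' - r) := by positivity
  have hB4 : 4 * L₀ / (r' - r) = 2 * (2 * L₀ / (r' - r)) := by ring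
  refine ⟨χ, htest, ?_, ?_, ?_, ?_, ?_, ?_⟩
  · exact fun z => mul_nonneg (mul_nonneg (t0 _) (radialCut_nonneg _)) (radialCut_nonneg _)
  · exact fun z => mul_le_one₀ (mul_le_one₀ (t1 _) (radialCut_nonneg _) (radialCut_le_one _))
      (radialCut_nonneg _) (radialCut_le_one _)
  · intro z hz hzT
    have h1 : timeCut r m T z.1 = 1 := by
      unfold timeCut
      rw [Real.smoothTransition.one_of_one_le, Real.smoothTransition.one_of_one_le, one_mul]
      · rw [one_le_div (by linarith)]
        linarith
      · rw [one_le_div (by linarith)]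
        linarith [hz.1]
    simp only [hχ]
    rw [h1, radialCut_eq_one hr0 hrm hz.2.2.1.le, radialCut_eq_one hr0 hrm hz.2.2.2.le]
    norm_num
  · intro z
    obtain ⟨D, E, h1, h2, -, h4⟩ := hT z
    rw [h1]
    rw [hB4] at h4
    exact (key z D E _ hB0 h2 h4).trans hB
  · intro z hzT
    obtain ⟨D, E, h1, -, h3, h4⟩ := hT z
    rw [h1]
    rw [hB4] at h4
    have h3' := abs_le.1 (h3 hzT)
    refine abs_le.2 ⟨?_, (key z D E _ hB0 h3'.2 h4).trans hB⟩
    have h5 := key z (-D) (-E) _ hB0 (by linarith) (by rwa [abs_neg])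
    have h6 : (-D * radialCut r m z.2.1 + timeCut r m T z.1 * -E) * radialCut r m z.2.2 =
        -((D * radialCut r m z.2.1 + timeCut r m T z.1 * E) * radialCut r m z.2.2) := by ring
    rw [h6] at h5
    linarith
  · intro i z
    obtain ⟨E, hE, hE1⟩ := exists_hasDerivAt_radialCut hr hrm hm1 hL0 hL z.2.2
      (EuclideanSpace.single i (1 : ℝ))
    have h2 := (hE.const_mul (timeCut r m T z.1 * radialCut r m z.2.1)).deriv
    have h3 : dV i χ z = timeCut r m T z.1 * radialCut r m z.2.1 * E := by
      unfold dV
      rw [← (hsmooth.differentiable (by simp) z).lineDeriv_eq_fderiv]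
      unfold lineDeriv
      simp only [hχ, eV, Prod.fst_add, Prod.snd_add, Prod.smul_fst, Prod.smul_snd,
        smul_zero, add_zero]
      exact h2
    rw [h3, abs_mul, abs_of_nonneg (mul_nonneg (t0 _) (radialCut_nonneg _))]
    calc _ ≤ 1 * (2 * L₀ / (m - r) * ‖EuclideanSpace.single i (1 : ℝ)‖) := by
          gcongr
          exact mul_le_one₀ (t1 _) (radialCut_nonneg _) (radialCut_le_one _)
      _ = 2 * (2 * L₀ / (r' - r)) := by
          rw [hmr]
          simp
          field_simp
      _ ≤ _ := by linarith

/-! ### The Caccioppoli inequality -/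

/-- The length of the vector with components `H i`. -/
def gradNorm (H : Fin d → Ph d → ℝ) (z : Ph d) : ℝ := √(∑ i, H i z ^ 2)

theorem gradNorm_nonneg (H : Fin d → Ph d → ℝ) (z : Ph d) : 0 ≤ gradNorm H z := Real.sqrt_nonneg _

theorem abs_le_gradNorm (H : Fin d → Ph d → ℝ) (i : Fin d) (z : Ph d) : |H i z| ≤ gradNorm H z :=
  Real.abs_le_sqrt (Finset.single_le_sum (f := fun i => H i z ^ 2) (fun _ _ => sq_nonneg _)
    (Finset.mem_univ i))

theorem gradNorm_le_sum (H : Fin d → Ph d → ℝ) (z : Ph d) : gradNorm H z ≤ ∑ i, |H i z| := by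
  refine Real.sqrt_le_iff.2 ⟨Finset.sum_nonneg fun _ _ => abs_nonneg _, ?_⟩
  have := Finset.sum_sq_le_sq_sum_of_nonneg (s := Finset.univ) (f := fun i => |H i z|)
    fun _ _ => abs_nonneg _
  simpa using this

theorem memLp_gradNorm {H : Fin d → Ph d → ℝ} (hH : ∀ i, MemLp (H i) 2) : MemLp (gradNorm H) 2 := by
  have h1 : MemLp (fun z => ∑ i, |H i z|) 2 := memLp_finsetSum _ fun i _ => (hH i).abs
  refine h1.mono ?_ (Eventually.of_forall fun z => ?_)
  · refine Real.continuous_sqrt.comp_aestronglyMeasurable ?_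
    exact Finset.aestronglyMeasurable_fun_sum _ fun i _ => (hH i).1.pow 2
  · rw [Real.norm_of_nonneg (gradNorm_nonneg H z)]
    exact (gradNorm_le_sum H z).trans (le_abs_self _)

/-- A weak sub-solution `g` on `V`, with the structure conditions on the flux `P` and the
lower-order term `q` that come from an elliptic equation; `u` dominates `g` and measures the
source. -/
structure EnergySub (V : Set (Ph d)) (lam Lam c : ℝ) (g u : Ph d → ℝ) (H P : Fin d → Ph d → ℝ)
    (q : Ph d → ℝ) : Prop extends WeakSub V g H P q where
  nonneg : ∀ z, 0 ≤ g z
  le_u : ∀ z, g z ≤ u z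
  memLp_u : MemLp u 2
  elliptic : ∀ᵐ z, lam * gradNorm H z ^ 2 ≤ ∑ i, H i z * P i z
  bound_P : ∀ᵐ z, gradNorm P z ≤ Lam * gradNorm H z
  bound_q : ∀ᵐ z, |q z| ≤ Lam * gradNorm H z + c * u z

theorem eLpNorm_two_restrict_sq {a : Ph d → ℝ} (ha : MemLp a 2) (S : Set (Ph d)) :
    eLpNorm a 2 (volume.restrict S) ^ 2 = ENNReal.ofReal (∫ z in S, a z ^ 2) := by
  rw [eLpNorm_two_sq, ofReal_integral_eq_lintegral_ofReal ha.integrable_sq.integrableOn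
    (Eventually.of_forall fun z => sq_nonneg _)]
  refine lintegral_congr fun z => ?_
  rw [Real.enorm_eq_ofReal_abs, ← ENNReal.ofReal_pow (abs_nonneg _), sq_abs]

theorem eLpNorm_le_of_integral_sq_le {a b : Ph d → ℝ} (ha : MemLp a 2) (hb : MemLp b 2)
    {S S' : Set (Ph d)} {A : ℝ} (hA : 0 ≤ A)
    (h : ∫ z in S, a z ^ 2 ≤ A ^ 2 * ∫ z in S', b z ^ 2) :
    eLpNorm a 2 (volume.restrict S) ≤ ENNReal.ofReal A * eLpNorm b 2 (volume.restrict S') := by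
  rw [← ENNReal.pow_le_pow_left_iff two_ne_zero, mul_pow, eLpNorm_two_restrict_sq ha,
    eLpNorm_two_restrict_sq hb, ← ENNReal.ofReal_pow hA, ← ENNReal.ofReal_mul (sq_nonneg _)]
  exact ENNReal.ofReal_le_ofReal h

/-- The pointwise absorption argument behind the Caccioppoli inequality; here `A = ∇_v χ · P`. -/
theorem caccioppoli_pointwise {lam Lam c L M D g u hh χ Tχ A q HP : ℝ} (hlam : 0 < lam)
    (hc : 0 ≤ c) (hL : 0 ≤ L) (hD : 1 ≤ D) (hg : 0 ≤ g) (hgu : g ≤ u)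
    (hχ0 : 0 ≤ χ) (hχ1 : χ ≤ 1) (hT : Tχ ≤ L * D) (hA : |A| ≤ M * D * hh)
    (hq : |q| ≤ Lam * hh + c * u) (hHP : lam * hh ^ 2 ≤ HP) :
    χ * Tχ * g * g - 2 * χ * A * g + χ ^ 2 * g * q - χ ^ 2 * HP ≤
      (L + 4 * M ^ 2 / lam + Lam ^ 2 / lam + 1) * (1 + c) * D ^ 2 * u ^ 2
        - lam / 2 * (χ ^ 2 * hh ^ 2) := by
  have hu : 0 ≤ u := hg.trans hgu
  have hg2 : g ^ 2 ≤ u ^ 2 := by gcongr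
  have hχ2 : χ ^ 2 ≤ 1 := pow_le_one₀ hχ0 hχ1
  have hDD : D ≤ D ^ 2 := by nlinarith
  have hD2 : 1 ≤ D ^ 2 := by nlinarith
  have h1 : χ * Tχ * g * g ≤ L * D ^ 2 * u ^ 2 := by
    calc χ * Tχ * g * g = Tχ * (χ * g ^ 2) := by ring
      _ ≤ (L * D) * (χ * g ^ 2) := by gcongr
      _ ≤ (L * D ^ 2) * (1 * u ^ 2) := by gcongr
      _ = _ := by ring
  have h2 : -(2 * χ * A * g) ≤ lam / 4 * (χ ^ 2 * hh ^ 2) + 4 * M ^ 2 / lam * D ^ 2 * u ^ 2 := by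
    calc -(2 * χ * A * g) ≤ 2 * χ * |A| * g := by
          have := neg_abs_le A
          nlinarith [mul_nonneg hχ0 hg]
      _ ≤ 2 * χ * (M * D * hh) * g := by gcongr
      _ ≤ lam / 4 * (χ ^ 2 * hh ^ 2) + 4 * M ^ 2 / lam * D ^ 2 * g ^ 2 := by
          have := sq_nonneg (√lam / 2 * (χ * hh) - 2 / √lam * (M * D * g))
          have hs : √lam ^ 2 = lam := Real.sq_sqrt hlam.le
          have hs0 : √lam ≠ 0 := (Real.sqrt_pos.2 hlam).ne'
          have e : (√lam / 2 * (χ * hh) - 2 / √lam * (M * D * g)) ^ 2 =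
              lam / 4 * (χ ^ 2 * hh ^ 2) + 4 * M ^ 2 / lam * D ^ 2 * g ^ 2
                - 2 * χ * (M * D * hh) * g := by
            have e1 : (√lam / 2 * (χ * hh) - 2 / √lam * (M * D * g)) ^ 2 =
                √lam ^ 2 / 4 * (χ ^ 2 * hh ^ 2) + 4 * M ^ 2 / √lam ^ 2 * D ^ 2 * g ^ 2
                - 2 * χ * (M * D * hh) * g := by
              field_simp
              ring
            rw [e1, hs]
          linarith
      _ ≤ _ := by gcongr
  have h3 : χ ^ 2 * g * q ≤ lam / 4 * (χ ^ 2 * hh ^ 2) + Lam ^ 2 / lam * u ^ 2 + c * u ^ 2 := by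
    have h4 : q ≤ Lam * hh + c * u := (le_abs_self q).trans hq
    have h5 : g * Lam * hh ≤ lam / 4 * hh ^ 2 + Lam ^ 2 / lam * g ^ 2 := by
      have := sq_nonneg (lam / 2 * hh - Lam * g)
      have e : lam / 4 * hh ^ 2 + Lam ^ 2 / lam * g ^ 2 - g * Lam * hh =
        (lam / 2 * hh - Lam * g) ^ 2 / lam := by
        field_simp
        ring
      have h6 : 0 ≤ (lam / 2 * hh - Lam * g) ^ 2 / lam := by positivity
      linarith
    have h7 : g * (c * u) ≤ c * u ^ 2 := by nlinarith [mul_nonneg hc hu]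
    calc χ ^ 2 * g * q ≤ χ ^ 2 * (g * (Lam * hh + c * u)) := by
          rw [mul_assoc]
          gcongr
      _ ≤ χ ^ 2 * (lam / 4 * hh ^ 2 + (Lam ^ 2 / lam * g ^ 2 + c * u ^ 2)) := by
          gcongr
          linarith
      _ = lam / 4 * (χ ^ 2 * hh ^ 2) + χ ^ 2 * (Lam ^ 2 / lam * g ^ 2 + c * u ^ 2) := by ring
      _ ≤ lam / 4 * (χ ^ 2 * hh ^ 2) + 1 * (Lam ^ 2 / lam * u ^ 2 + c * u ^ 2) := by gcongr
      _ = _ := by ring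
  have h8 : χ ^ 2 * (lam * hh ^ 2) ≤ χ ^ 2 * HP := by gcongr
  have h9 : L * D ^ 2 * u ^ 2 + 4 * M ^ 2 / lam * D ^ 2 * u ^ 2 + Lam ^ 2 / lam * u ^ 2 + c * u ^ 2 ≤
      (L + 4 * M ^ 2 / lam + Lam ^ 2 / lam + 1) * (1 + c) * D ^ 2 * u ^ 2 := by
    have a1 : Lam ^ 2 / lam * u ^ 2 ≤ Lam ^ 2 / lam * D ^ 2 * u ^ 2 := by
      have : 0 ≤ Lam ^ 2 / lam * u ^ 2 := by positivity
      nlinarith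
    have a2 : c * u ^ 2 ≤ c * D ^ 2 * u ^ 2 := by
      have : 0 ≤ c * u ^ 2 := by positivity
      nlinarith
    have a3 : 0 ≤ (L + 4 * M ^ 2 / lam + Lam ^ 2 / lam) * c * D ^ 2 * u ^ 2 := by positivity
    have a4 : 0 ≤ D ^ 2 * u ^ 2 := by positivity
    nlinarith
  linarith

/-- The Caccioppoli inequality up to a time `T < 0`, with a constant that does not depend on `T`: in
the energy inequality for `χ²`, only an upper bound on `𝒯 χ` is needed. -/
theorem EnergySub.exists_caccioppoli (d : ℕ) {lam : ℝ} (hlam : 0 < lam) (Lam : ℝ) :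
    ∃ C : ℝ, 0 ≤ C ∧ ∀ (c : ℝ) (g u : Ph d → ℝ) (H P : Fin d → Ph d → ℝ) (q : Ph d → ℝ),
      0 ≤ c → EnergySub (box 1) lam Lam c g u H P q → ∀ r r' T : ℝ, 1 / 2 ≤ r → r < r' → r' ≤ 1 → T < 0 →
        eLpNorm (gradNorm H) 2 (volume.restrict (box r ∩ {z | z.1 ≤ T})) ≤
          ENNReal.ofReal (C * (1 + c) / (r' - r)) * eLpNorm u 2 (volume.restrict (box r')) := by
  obtain ⟨L, hL1, hcut⟩ := exists_cutoff
  -- `M` bounds `∇_v χ · P` in terms of `|∇_v g|`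
  set M := d * L * Lam with hM
  set K := L + 4 * M ^ 2 / lam + Lam ^ 2 / lam + 1 with hK
  have hK1 : 1 ≤ K := by
    have : 0 ≤ L + 4 * M ^ 2 / lam + Lam ^ 2 / lam := by positivity
    linarith
  refine ⟨1 + 2 * K / lam, by positivity, ?_⟩
  intro c g u H P q hc hs r r' T hr hrr' hr' hT
  obtain ⟨χ, hχt, hχ0, hχ1, hχeq, hTχ, -, hVχ⟩ := hcut d r r' T hr hrr' hr' hT
  set D := 1 / (r' - r) with hD
  have hδ : 0 < r' - r := sub_pos.2 hrr'
  have hD1 : 1 ≤ D := by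
    rw [hD, one_le_div hδ]
    linarith
  have hLD : L / (r' - r) = L * D := by rw [hD]; ring
  rw [hLD] at hTχ hVχ
  have hχ' : IsTestFun (box 1) χ := ⟨hχt.1, hχt.2.1, hχt.2.2.trans (box_mono hr')⟩
  have hω := hχ'.mul_left hχ'.1
  have dχ := hχt.1.differentiable (by simp)
  have hen := hs.toWeakSub.energy (isOpen_box 1) hs.nonneg hω fun z => mul_nonneg (hχ0 z) (hχ0 z)
  have eT : ∀ z, transport (fun z => χ z * χ z) z = 2 * (χ z * transport χ z) := fun z => by
    rw [transport_mul (dχ z) (dχ z)]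
    ring
  have eV : ∀ i z, dV i (fun z => χ z * χ z) z = 2 * (χ z * dV i χ z) := fun i z => by
    rw [dV_mul i (dχ z) (dχ z)]
    ring
  have hbd : ∀ {a b : Ph d → ℝ} {m : Ph d → ℝ}, Continuous m → HasCompactSupport m → MemLp a 2 →
      MemLp b 2 → Integrable fun z => (m z * a z) * b z := by
    intro a b m hm hmc ha hb
    obtain ⟨B, hB⟩ := HasCompactSupport.exists_abs_le hm hmc
    exact (memLp_bdd_mul hm hB ha).integrable_mul hb
  have i1 : ∀ i, Integrable fun z => ((χ z * χ z) * H i z) * P i z := fun i =>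
    hbd hω.1.continuous hω.2.1 (hs.memLp_H i) (hs.memLp_P i)
  have i2 : Integrable fun z => (transport (fun z => χ z * χ z) z * g z) * g z :=
    hbd (contDiff_transport hω.1).continuous (hasCompactSupport_transport hω.2.1) hs.memLp_g hs.memLp_g
  have i3 : ∀ i, Integrable fun z => (dV i (fun z => χ z * χ z) z * g z) * P i z := fun i =>
    hbd (contDiff_dV i hω.1).continuous (hasCompactSupport_dV i hω.2.1) hs.memLp_g (hs.memLp_P i)
  have i4 : Integrable fun z => ((χ z * χ z) * g z) * q z :=
    hbd hω.1.continuous hω.2.1 hs.memLp_g hs.memLp_q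
  have s1 : Integrable fun z => ∑ i, ((χ z * χ z) * H i z) * P i z :=
    integrable_finsetSum _ fun i _ => i1 i
  have s3 : Integrable fun z => ∑ i, (dV i (fun z => χ z * χ z) z * g z) * P i z :=
    integrable_finsetSum _ fun i _ => i3 i
  have s23 : Integrable fun z => (transport (fun z => χ z * χ z) z * g z) * g z / 2
      - ∑ i, (dV i (fun z => χ z * χ z) z * g z) * P i z := (i2.div_const 2).sub s3
  have s234 : Integrable fun z => (transport (fun z => χ z * χ z) z * g z) * g z / 2
      - ∑ i, (dV i (fun z => χ z * χ z) z * g z) * P i z + ((χ z * χ z) * g z) * q z := s23.add i4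
  have hhL := memLp_gradNorm hs.memLp_H
  have hχh : Integrable fun z => χ z ^ 2 * gradNorm H z ^ 2 := by
    have := hbd hω.1.continuous hω.2.1 hhL hhL
    refine this.congr (Eventually.of_forall fun z => ?_)
    simp only
    ring
  have hu2 : Integrable ((box r').indicator fun z => u z ^ 2) :=
    hs.memLp_u.integrable_sq.indicator (measurableSet_box r')
  have hpt : ∀ᵐ z, ((transport (fun z => χ z * χ z) z * g z) * g z / 2
      - ∑ i, (dV i (fun z => χ z * χ z) z * g z) * P i z + ((χ z * χ z) * g z) * q z)
      - ∑ i, ((χ z * χ z) * H i z) * P i z ≤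
      K * (1 + c) * D ^ 2 * (box r').indicator (fun z => u z ^ 2) z
        - lam / 2 * (χ z ^ 2 * gradNorm H z ^ 2) := by
    filter_upwards [hs.elliptic, hs.bound_P, hs.bound_q] with z h1 h2 h3
    by_cases hz : z ∈ tsupport χ
    · have hzb := hχt.2.2 hz
      rw [indicator_of_mem hzb]
      have hA : |∑ i, dV i χ z * P i z| ≤ M * D * gradNorm H z := by
        calc |∑ i, dV i χ z * P i z| ≤ ∑ i : Fin d, |dV i χ z * P i z| :=
              Finset.abs_sum_le_sum_abs _ _
          _ ≤ ∑ i : Fin d, (L * D) * (Lam * gradNorm H z) := by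
              refine Finset.sum_le_sum fun i _ => ?_
              rw [abs_mul]
              exact mul_le_mul (hVχ i z) ((abs_le_gradNorm P i z).trans h2) (abs_nonneg _)
                (by positivity)
          _ = _ := by
              rw [Finset.sum_const, Finset.card_univ, Fintype.card_fin, nsmul_eq_mul, hM]
              ring
      have := caccioppoli_pointwise (lam := lam) (Lam := Lam) (c := c) (L := L) (M := M) (D := D)
        hlam hc (by linarith) hD1 (hs.nonneg z) (hs.le_u z) (hχ0 z) (hχ1 z) (hTχ z) hA h3 h1
      refine le_trans (le_of_eq ?_) this
      rw [eT]
      simp only [eV]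
      have e1 : ∑ i, 2 * (χ z * dV i χ z) * g z * P i z =
          2 * χ z * (∑ i, dV i χ z * P i z) * g z := by
        rw [Finset.mul_sum, Finset.sum_mul]
        exact Finset.sum_congr rfl fun i _ => by ring
      have e2 : ∑ i, χ z * χ z * H i z * P i z = χ z ^ 2 * ∑ i, H i z * P i z := by
        rw [Finset.mul_sum]
        exact Finset.sum_congr rfl fun i _ => by ring
      rw [e1, e2]
      ring
    · have hχz : χ z = 0 := image_eq_zero_of_notMem_tsupport hz
      rw [eT]
      simp only [eV, hχz]
      simp only [zero_mul, mul_zero, zero_div, Finset.sum_const_zero, sub_zero, add_zero, ne_eq,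
        OfNat.ofNat_ne_zero, not_false_eq_true, zero_pow]
      have : 0 ≤ (box r').indicator (fun z => u z ^ 2) z := indicator_nonneg (fun _ _ => sq_nonneg _) z
      positivity
  have hI := integral_mono_ae (s234.sub s1) ((hu2.const_mul (K * (1 + c) * D ^ 2)).sub
    (hχh.const_mul (lam / 2))) hpt
  simp only [Pi.sub_apply] at hI
  rw [integral_sub s234 s1, integral_finsetSum _ fun i _ => i1 i,
    integral_add s23 i4, integral_sub (i2.div_const 2) s3, integral_div,
    integral_finsetSum _ fun i _ => i3 i,
    integral_sub (hu2.const_mul (K * (1 + c) * D ^ 2)) (hχh.const_mul (lam / 2)),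
    integral_const_mul, integral_const_mul, integral_indicator (measurableSet_box r')] at hI
  have hmain : lam / 2 * ∫ z, χ z ^ 2 * gradNorm H z ^ 2 ≤
      K * (1 + c) * D ^ 2 * ∫ z in box r', u z ^ 2 := by linarith
  have hW : MeasurableSet (box r ∩ {z : Ph d | z.1 ≤ T}) :=
    (measurableSet_box r).inter (measurableSet_le measurable_fst measurable_const)
  have hleft : ∫ z in box r ∩ {z | z.1 ≤ T}, gradNorm H z ^ 2 ≤
      ∫ z, χ z ^ 2 * gradNorm H z ^ 2 := by
    rw [← integral_indicator hW]
    refine integral_mono (hhL.integrable_sq.indicator hW) hχh fun z => ?_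
    by_cases hz : z ∈ box r ∩ {z | z.1 ≤ T}
    · simp only [indicator_of_mem hz, hχeq z hz.1 hz.2]
      linarith
    · simp only [indicator_of_notMem hz]
      positivity
  refine eLpNorm_le_of_integral_sq_le hhL hs.memLp_u (by positivity) ?_
  have hI0 : 0 ≤ ∫ z in box r', u z ^ 2 := integral_nonneg fun z => sq_nonneg _
  calc ∫ z in box r ∩ {z | z.1 ≤ T}, gradNorm H z ^ 2
      ≤ (2 * K / lam) * (1 + c) * D ^ 2 * ∫ z in box r', u z ^ 2 := by
        have e : (2 * K / lam) * (1 + c) * D ^ 2 * (∫ z in box r', u z ^ 2) =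
          (K * (1 + c) * D ^ 2 * ∫ z in box r', u z ^ 2) / (lam / 2) := by
          field_simp
        rw [e, le_div_iff₀ (by positivity)]
        have := mul_le_mul_of_nonneg_right hleft (half_pos hlam).le
        linarith
    _ ≤ ((1 + 2 * K / lam) ^ 2) * ((1 + c) ^ 2) * D ^ 2 * ∫ z in box r', u z ^ 2 := by
        have hk : 0 ≤ 2 * K / lam := by positivity
        gcongr
        · nlinarith
        · nlinarith
    _ = _ := by
        rw [hD]
        ring

/-! ### The duality estimate -/

theorem pathAvg_eq_zero {c ψ : Ph d → ℝ} {T : ℝ} (hψ : ∀ z, T < z.1 → ψ z = 0) {z : Ph d}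
    (hz : T ≤ z.1) : pathAvg (Ioo 0 1) c ψ z = 0 := by
  refine integral_eq_zero_of_ae (Eventually.of_forall fun p => ?_)
  by_cases hp : p ∈ (Prod.fst ⁻¹' Ioo 0 1 : Set (Ph d))
  · have h1 : (gal z (pathPt p)).1 = z.1 + p.1 ^ 3 := rfl
    have h2 : 0 < p.1 ^ 3 := pow_pos hp.1 3
    simp [hψ (gal z (pathPt p)) (by linarith)]
  · simp [indicator_of_notMem hp]

theorem pathAvg_nonneg {T : Set ℝ} {c ψ : Ph d → ℝ} (hc : ∀ p, 0 ≤ c p) (hψ : ∀ z, 0 ≤ ψ z)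
    (z : Ph d) : 0 ≤ pathAvg T c ψ z :=
  integral_nonneg fun p => mul_nonneg (indicator_nonneg (fun p _ => hc p) p) (hψ _)

/-- The size of the dual function, of its velocity gradient and of its flux. -/
def dualSize (ψ : Ph d → ℝ) (z : Ph d) : ℝ :=
  |pathAvg (Ioo 0 1) dualWeight ψ z| + ∑ i, |pathAvg (Ioo 0 1) (gradWeight i) ψ z|
    + ∑ i, |pathAvg (Ioo 0 1) (fluxWeight i) ψ z|

theorem continuous_pathAvg {c ψ : Ph d → ℝ} (hc : IsWeight c) (hψ : ContDiff ℝ ∞ ψ) :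
    Continuous (pathAvg (Ioo 0 1) c ψ) :=
  (contDiff_pathAvg hc hψ measurableSet_Ioo Ioo_subset_Icc_self).continuous

theorem continuous_dualSize {ψ : Ph d → ℝ} (hψ : ContDiff ℝ ∞ ψ) : Continuous (dualSize ψ) := by
  refine ((continuous_pathAvg isWeight_dualWeight hψ).abs.add
    (continuous_finsetSum _ fun i _ => ?_)).add (continuous_finsetSum _ fun i _ => ?_)
  · exact (continuous_pathAvg (isWeight_gradWeight i) hψ).abs
  · exact (continuous_pathAvg (isWeight_fluxWeight i) hψ).abs

theorem exists_eLpNorm_dualSize_le (d : ℕ) :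
    ∃ C : ℝ≥0, ∀ ψ : Ph d → ℝ, ContDiff ℝ ∞ ψ → ∀ τ₀ : ℝ, 0 < τ₀ → τ₀ ≤ 1 →
      eLpNorm (dualSize ψ) 2 (volume.restrict (box 1)) ≤
        C * (ENNReal.ofReal τ₀ * eLpNorm ψ 2 +
          ENNReal.ofReal ((τ₀ ^ (6 * d + 2))⁻¹) * eLpNorm ψ 1) := by
  have hV : volume (box (d := d) 1) ≠ ⊤ := volume_box_ne_top 1
  obtain ⟨C1, h1⟩ := exists_eLpNorm_pathAvg_le hV (isWeight_dualWeight (d := d))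
  choose C2 h2 using fun i : Fin d => exists_eLpNorm_pathAvg_le hV (isWeight_gradWeight i)
  choose C3 h3 using fun i : Fin d => exists_eLpNorm_pathAvg_le hV (isWeight_fluxWeight i)
  refine ⟨C1 + ∑ i, C2 i + ∑ i, C3 i, fun ψ hψ τ₀ h0 h01 => ?_⟩
  set X := ENNReal.ofReal τ₀ * eLpNorm ψ 2 +
          ENNReal.ofReal ((τ₀ ^ (6 * d + 2))⁻¹) * eLpNorm ψ 1
  have m : ∀ {c : Ph d → ℝ}, IsWeight c → AEStronglyMeasurable
      (fun z => |pathAvg (Ioo 0 1) c ψ z|) (volume.restrict (box 1)) := fun hc =>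
    (continuous_pathAvg hc hψ).abs.aestronglyMeasurable
  have ms : ∀ {c : Fin d → Ph d → ℝ}, (∀ i, IsWeight (c i)) → AEStronglyMeasurable
      (fun z => ∑ i, |pathAvg (Ioo 0 1) (c i) ψ z|) (volume.restrict (box 1)) := fun hc =>
    Finset.aestronglyMeasurable_fun_sum _ fun i _ => m (hc i)
  have key : ∀ {c : Fin d → Ph d → ℝ} {C : Fin d → ℝ≥0}, (∀ i, IsWeight (c i)) →
      (∀ i, eLpNorm (pathAvg (Ioo 0 1) (c i) ψ) 2 (volume.restrict (box 1)) ≤ C i * X) →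
      eLpNorm (fun z => ∑ i, |pathAvg (Ioo 0 1) (c i) ψ z|) 2 (volume.restrict (box 1)) ≤
        (∑ i, C i : ℝ≥0) * X := by
    intro c C hc hC
    refine (le_of_eq (congrArg (eLpNorm · 2 _) (by ext z; simp [Finset.sum_apply]))).trans
      ((eLpNorm_sum_le (s := Finset.univ) (f := fun i z => |pathAvg (Ioo 0 1) (c i) ψ z|) (fun i _ => m (hc i))
        one_le_two).trans ?_)
    push_cast
    rw [Finset.sum_mul]
    exact Finset.sum_le_sum fun i _ => (eLpNorm_norm (pathAvg (Ioo 0 1) (c i) ψ)).le.trans (hC i)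
  refine (eLpNorm_add_le ((m isWeight_dualWeight).add (ms isWeight_gradWeight))
    (ms isWeight_fluxWeight) one_le_two).trans ?_
  refine (add_le_add_left (eLpNorm_add_le (m isWeight_dualWeight) (ms isWeight_gradWeight)
    one_le_two) _).trans ?_
  push_cast
  rw [add_mul, add_mul]
  refine add_le_add (add_le_add ?_ ?_) ?_
  · exact (eLpNorm_norm (pathAvg (Ioo 0 1) dualWeight ψ)).le.trans (h1 ψ hψ τ₀ h0 h01)
  · simpa using key isWeight_gradWeight fun i => h2 i ψ hψ τ₀ h0 h01
  · simpa using key isWeight_fluxWeight fun i => h3 i ψ hψ τ₀ h0 h01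

/-- Pointwise bound for the terms that remain after a sub-solution has been tested with `χ φ` and
its weak gradient with `χ Φ`. Here `hh` is the length of `H = ∇_v g`, and `D` measures the steepness
of `χ`. -/
theorem EnergySub.exists_duality_pointwise {Lam : ℝ} (hLam : 0 ≤ Lam) {L : ℝ} (hL : 1 ≤ L) :
    ∃ K : ℝ, 0 ≤ K ∧ ∀ (c D g u hh χ φ Tχ q : ℝ) (H P dχ dφ Φ : Fin d → ℝ), 0 ≤ c → 1 ≤ D → 0 ≤ g →
      g ≤ u → 0 ≤ χ → χ ≤ 1 → 0 ≤ hh → |Tχ| ≤ L * D → (∀ i, |dχ i| ≤ L * D) → (∀ i, |H i| ≤ hh) →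
      (∀ i, |P i| ≤ Lam * hh) → |q| ≤ Lam * hh + c * u →
      -(∑ i, P i * (χ * dφ i + φ * dχ i)) + q * (χ * φ) + ∑ i, χ * Φ i * H i
        + g * φ * Tχ + ∑ i, g * Φ i * dχ i ≤
      K * (1 + c) * D * ((u + hh) * (|φ| + ∑ i, |dφ i| + ∑ i, |Φ i|)) := by
  refine ⟨Lam + d * Lam * L + Lam + 1 + 1 + 2 * L, by positivity, ?_⟩
  intro c D g u hh χ φ Tχ q H P dχ dφ Φ hc hD hg hgu hχ0 hχ1 hh0 hT hdχ hH hP hq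
  set Sd := ∑ i, |dφ i|
  set SF := ∑ i, |Φ i|
  have hSd : 0 ≤ Sd := Finset.sum_nonneg fun i _ => abs_nonneg _
  have hSF : 0 ≤ SF := Finset.sum_nonneg fun i _ => abs_nonneg _
  have hφ0 := abs_nonneg φ
  have hu : 0 ≤ u := hg.trans hgu
  set A := |φ| + Sd + SF with hA
  have hA0 : 0 ≤ A := by positivity
  have hφA : |φ| ≤ A := by linarith
  have hSFA : SF ≤ A := by linarith
  have hSdA : Sd ≤ A := by linarith
  have hcD : 1 ≤ (1 + c) * D := by nlinarith
  have hcD' : D ≤ (1 + c) * D := by nlinarith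
  have hcc : c ≤ (1 + c) * D := by nlinarith
  have b1 : -(∑ i, P i * (χ * dφ i + φ * dχ i)) ≤ Lam * hh * Sd + d * (Lam * hh * (|φ| * (L * D))) := by
    rw [← Finset.sum_neg_distrib]
    have : ∀ i, -(P i * (χ * dφ i + φ * dχ i)) ≤ Lam * hh * |dφ i| + Lam * hh * (|φ| * (L * D)) := by
      intro i
      refine (neg_le_abs _).trans ?_
      rw [abs_mul, ← mul_add]
      refine mul_le_mul (hP i) ((abs_add_le _ _).trans (add_le_add ?_ ?_)) (abs_nonneg _)
        (by positivity)
      · rw [abs_mul, abs_of_nonneg hχ0]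
        exact mul_le_of_le_one_left (abs_nonneg _) hχ1
      · rw [abs_mul]
        exact mul_le_mul_of_nonneg_left (hdχ i) hφ0
    refine (Finset.sum_le_sum fun i _ => this i).trans (le_of_eq ?_)
    rw [Finset.sum_add_distrib, ← Finset.mul_sum, Finset.sum_const, Finset.card_univ,
      Fintype.card_fin, nsmul_eq_mul]
  have b2 : q * (χ * φ) ≤ (Lam * hh + c * u) * |φ| := by
    refine (le_abs_self _).trans ?_
    rw [abs_mul, abs_mul, abs_of_nonneg hχ0]
    exact mul_le_mul hq (mul_le_of_le_one_left hφ0 hχ1) (by positivity) (by positivity)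
  have b3 : ∑ i, χ * Φ i * H i ≤ SF * hh := by
    rw [Finset.sum_mul]
    refine Finset.sum_le_sum fun i _ => (le_abs_self _).trans ?_
    rw [abs_mul, abs_mul, abs_of_nonneg hχ0]
    exact mul_le_mul (mul_le_of_le_one_left (abs_nonneg _) hχ1) (hH i) (abs_nonneg _) (abs_nonneg _)
  have b4 : g * φ * Tχ ≤ u * |φ| * (L * D) := by
    refine (le_abs_self _).trans ?_
    rw [abs_mul, abs_mul, abs_of_nonneg hg]
    gcongr
  have b5 : ∑ i, g * Φ i * dχ i ≤ u * SF * (L * D) := by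
    rw [Finset.mul_sum, Finset.sum_mul]
    refine Finset.sum_le_sum fun i _ => (le_abs_self _).trans ?_
    rw [abs_mul, abs_mul, abs_of_nonneg hg]
    have := hdχ i
    gcongr
  set Y := (1 + c) * D * ((u + hh) * A) with hY
  have huA : 0 ≤ u * A := by positivity
  have hhA : 0 ≤ hh * A := by positivity
  have e : (u + hh) * A = u * A + hh * A := by ring
  have hXY : ∀ {a : ℝ}, a ≤ (1 + c) * D → a * ((u + hh) * A) ≤ Y := fun h =>
    mul_le_mul_of_nonneg_right h (by positivity)
  have hy1 := hXY hcD
  have hy2 := hXY hcD'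
  have hy3 := hXY hcc
  have hAu : ∀ {x : ℝ}, x ≤ A → u * x ≤ (u + hh) * A := fun h => by
    have := mul_le_mul_of_nonneg_left h hu
    linarith
  have hAh : ∀ {x : ℝ}, x ≤ A → hh * x ≤ (u + hh) * A := fun h => by
    have := mul_le_mul_of_nonneg_left h hh0
    linarith
  have hD0 : 0 ≤ D := by linarith
  have c1 : hh * Sd ≤ Y := by linarith [hAh hSdA]
  have c2 : hh * |φ| * D ≤ Y := by linarith [mul_le_mul_of_nonneg_right (hAh hφA) hD0]
  have c3 : hh * |φ| ≤ Y := by linarith [hAh hφA]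
  have c4 : c * u * |φ| ≤ Y := by linarith [mul_le_mul_of_nonneg_left (hAu hφA) hc]
  have c5 : SF * hh ≤ Y := by linarith [hAh hSFA]
  have c6 : u * |φ| * D ≤ Y := by linarith [mul_le_mul_of_nonneg_right (hAu hφA) hD0]
  have c7 : u * SF * D ≤ Y := by linarith [mul_le_mul_of_nonneg_right (hAu hSFA) hD0]
  calc _ ≤ Lam * (hh * Sd) + d * Lam * L * (hh * |φ| * D) + Lam * (hh * |φ|) + c * u * |φ| + SF * hh
        + L * (u * |φ| * D) + L * (u * SF * D) := by linarith
    _ ≤ Lam * Y + d * Lam * L * Y + Lam * Y + Y + Y + L * Y + L * Y := by gcongr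
    _ = (Lam + d * Lam * L + Lam + 1 + 1 + 2 * L) * Y := by ring
    _ = _ := by rw [hY]; ring

/-- Testing a sub-solution with the dual function of `ψ` bounds `∫ g ψ`. The term with `‖ψ‖₂`
comes with a small factor, so that only the weaker norm `‖ψ‖₁` is expensive. -/
theorem EnergySub.exists_duality (d : ℕ) {lam Lam : ℝ} (hlam : 0 < lam) (hLam : 0 ≤ Lam) :
    ∃ C : ℝ≥0, ∀ (c : ℝ) (g u : Ph d → ℝ) (H P : Fin d → Ph d → ℝ) (q : Ph d → ℝ),
      0 ≤ c → EnergySub (box 1) lam Lam c g u H P q → ∀ r r' : ℝ, 1 / 2 ≤ r → r < r' → r' ≤ 1 →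
      ∀ ψ : Ph d → ℝ, IsTestFun (box r) ψ → (∀ z, 0 ≤ ψ z) → ∀ τ₀ : ℝ, 0 < τ₀ → τ₀ ≤ 1 →
        ENNReal.ofReal (∫ z, g z * ψ z) ≤ C * ENNReal.ofReal ((1 + c) ^ 2 / (r' - r) ^ 2) *
          eLpNorm u 2 (volume.restrict (box r')) * (ENNReal.ofReal τ₀ * eLpNorm ψ 2 +
            ENNReal.ofReal ((τ₀ ^ (6 * d + 2))⁻¹) * eLpNorm ψ 1) := by
  obtain ⟨L, hL1, hcut⟩ := exists_cutoff
  obtain ⟨K, hK0, hKp⟩ := EnergySub.exists_duality_pointwise (d := d) hLam hL1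
  obtain ⟨Cc, hCc0, hCc⟩ := EnergySub.exists_caccioppoli d hlam Lam
  obtain ⟨CA, hCA⟩ := exists_eLpNorm_dualSize_le d
  refine ⟨Real.toNNReal (2 * K * (1 + 2 * Cc)) * CA, ?_⟩
  intro c g u H P q hc hs r r' hr hrr' hr' ψ hψ hψ0 τ₀ hτ0 hτ1
  have hδ : 0 < r' - r := sub_pos.2 hrr'
  set m := (r + r') / 2 with hm
  have hrm : r < m := by rw [hm]; linarith
  have hmr' : m < r' := by rw [hm]; linarith
  -- by compactness of its support, `ψ` vanishes after some time `T < 0`; so do the path averages,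
  -- and the steep part of the cutoff after `T` does not contribute
  obtain ⟨T, hT, hψT⟩ : ∃ T < 0, ∀ z, T < z.1 → ψ z = 0 := by
    rcases (tsupport ψ).eq_empty_or_nonempty with he | hne
    · exact ⟨-1, by norm_num, fun z _ => image_eq_zero_of_notMem_tsupport (he ▸ notMem_empty z)⟩
    · obtain ⟨z₁, hz₁, hmax⟩ := hψ.2.1.exists_isMaxOn hne continuous_fst.continuousOn
      refine ⟨z₁.1, (hψ.2.2 hz₁).2.1, fun z hz => image_eq_zero_of_notMem_tsupport fun hz' => ?_⟩
      exact absurd (hmax hz') (not_le.2 hz)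
  obtain ⟨χ, hχt, hχ0, hχ1, hχeq, -, hTχ, hVχ⟩ := hcut d r m T hr hrm (hmr'.le.trans hr') hT
  set D := 1 / (m - r) with hD
  have hD' : D = 2 / (r' - r) := by
    have : m - r = (r' - r) / 2 := by rw [hm]; ring
    rw [hD, this]
    field_simp
  have hD1 : 1 ≤ D := by
    rw [hD', one_le_div hδ]
    linarith
  have hLD : L / (m - r) = L * D := by rw [hD]; ring
  rw [hLD] at hTχ hVχ
  set φ := pathAvg (Ioo 0 1) dualWeight ψ with hφ
  set Φ := fun i => pathAvg (Ioo 0 1) (fluxWeight i) ψ with hΦ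
  set dφ := fun i => pathAvg (Ioo 0 1) (gradWeight i) ψ with hdφ
  have sφ : ContDiff ℝ ∞ φ :=
    contDiff_pathAvg isWeight_dualWeight hψ.1 measurableSet_Ioo Ioo_subset_Icc_self
  have sΦ : ∀ i, ContDiff ℝ ∞ (Φ i) := fun i =>
    contDiff_pathAvg (isWeight_fluxWeight i) hψ.1 measurableSet_Ioo Ioo_subset_Icc_self
  have hφ0 : ∀ z, 0 ≤ φ z := pathAvg_nonneg (fun p => mul_nonneg (by positivity)
    (dirDensity_nonneg _)) hψ0
  have hχ' : IsTestFun (box 1) χ := ⟨hχt.1, hχt.2.1, hχt.2.2.trans (box_mono (hmr'.le.trans hr'))⟩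
  have tφ := hχ'.mul_left sφ
  have tΦ := fun i => hχ'.mul_left (sΦ i)
  have dχ := hχt.1.differentiable (by simp)
  have d1 := sφ.differentiable (by simp)
  have d2 := fun i => (sΦ i).differentiable (by simp)
  have hineq := hs.ineq _ tφ fun z => mul_nonneg (hχ0 z) (hφ0 z)
  have hweak := fun i => hs.weakDV _ (tΦ i) i
  have hint : ∀ {a b : Ph d → ℝ}, Continuous b → HasCompactSupport b → MemLp a 2 →
      Integrable fun z => a z * b z := by
    intro a b hb hbc ha
    have hb2 : MemLp b 2 := hb.memLp_of_hasCompactSupport hbc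
    exact ha.integrable_mul hb2
  have i0 : Integrable fun z => g z * ψ z := hint hψ.1.continuous hψ.2.1 hs.memLp_g
  have i1 : Integrable fun z => g z * transport (fun z => χ z * φ z) z :=
    hint (contDiff_transport tφ.1).continuous (hasCompactSupport_transport tφ.2.1) hs.memLp_g
  have i2 : ∀ i, Integrable fun z => g z * dV i (fun z => χ z * Φ i z) z := fun i =>
    hint (contDiff_dV i (tΦ i).1).continuous (hasCompactSupport_dV i (tΦ i).2.1) hs.memLp_g
  have i3 : ∀ i, Integrable fun z => P i z * dV i (fun z => χ z * φ z) z := fun i =>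
    hint (contDiff_dV i tφ.1).continuous (hasCompactSupport_dV i tφ.2.1) (hs.memLp_P i)
  have i4 : Integrable fun z => q z * (χ z * φ z) :=
    hint tφ.1.continuous tφ.2.1 hs.memLp_q
  have i5 : ∀ i, Integrable fun z => χ z * Φ i z * H i z := fun i =>
    (hint (tΦ i).1.continuous (tΦ i).2.1 (hs.memLp_H i)).congr
      (Eventually.of_forall fun z => mul_comm _ _)
  have i6 : Integrable fun z => g z * φ z * transport χ z := by
    have := hint (sφ.continuous.mul (contDiff_transport hχt.1).continuous)
      (hasCompactSupport_transport hχt.2.1).mul_left hs.memLp_g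
    exact this.congr (Eventually.of_forall fun z => (mul_assoc _ _ _).symm)
  have i7 : ∀ i, Integrable fun z => g z * Φ i z * dV i χ z := fun i => by
    have := hint ((sΦ i).continuous.mul (contDiff_dV i hχt.1).continuous)
      (hasCompactSupport_dV i hχt.2.1).mul_left hs.memLp_g
    exact this.congr (Eventually.of_forall fun z => (mul_assoc _ _ _).symm)
  have s2 : Integrable fun z => ∑ i, g z * dV i (fun z => χ z * Φ i z) z :=
    integrable_finsetSum _ fun i _ => i2 i
  have s3 : Integrable fun z => ∑ i, P i z * dV i (fun z => χ z * φ z) z :=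
    integrable_finsetSum _ fun i _ => i3 i
  have s5 : Integrable fun z => ∑ i, χ z * Φ i z * H i z := integrable_finsetSum _ fun i _ => i5 i
  have s7 : Integrable fun z => ∑ i, g z * Φ i z * dV i χ z :=
    integrable_finsetSum _ fun i _ => i7 i
  set E : Ph d → ℝ := fun z => -(∑ i, P i z * dV i (fun z => χ z * φ z) z) + q z * (χ z * φ z)
    + ∑ i, χ z * Φ i z * H i z + g z * φ z * transport χ z + ∑ i, g z * Φ i z * dV i χ z with hE
  -- the dual equation multiplied by `χ`; note that `χ ψ = ψ`
  have hpt : ∀ z, g z * ψ z = -(g z * transport (fun z => χ z * φ z) z)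
      - ∑ i, g z * dV i (fun z => χ z * Φ i z) z + g z * φ z * transport χ z
      + ∑ i, g z * Φ i z * dV i χ z := by
    intro z
    rw [transport_mul (dχ z) (d1 z)]
    have e1 : ∀ i, dV i (fun z => χ z * Φ i z) z = χ z * dV i (Φ i) z + Φ i z * dV i χ z :=
      fun i => dV_mul i (dχ z) (d2 i z)
    by_cases hz : z ∈ tsupport χ
    · have hzb := hχ'.2.2 hz
      -- all paths that start after time `-1` end at positive times, where `ψ` vanishes
      have hdual := transport_pathAvg_add hψ.1 z fun m => by
        refine hψT _ ?_
        have h1 : (gal z (pathPt (1, m))).1 = z.1 + 1 ^ 3 := rfl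
        have h2 : -1 < z.1 := hzb.1
        rw [h1]
        linarith
      have hχψ : χ z * ψ z = ψ z := by
        by_cases hψz : ψ z = 0
        · rw [hψz, mul_zero]
        · have hzr := hψ.2.2 (subset_tsupport ψ hψz)
          rw [hχeq z hzr (not_lt.1 fun h => hψz (hψT z h)), one_mul]
      have e2 : ∑ i, g z * dV i (fun z => χ z * Φ i z) z =
          g z * χ z * ∑ i, dV i (Φ i) z + ∑ i, g z * Φ i z * dV i χ z := by
        rw [Finset.mul_sum, ← Finset.sum_add_distrib]
        refine Finset.sum_congr rfl fun i _ => ?_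
        rw [e1 i]
        ring
      rw [e2]
      have e3 : ∑ i, dV i (Φ i) z = -ψ z - transport φ z := by
        rw [← hdual]
        ring
      rw [e3]
      linear_combination g z * (-hχψ)
    · have hψz : ψ z = 0 := by
        by_contra h
        have hzr := hψ.2.2 (subset_tsupport ψ h)
        have := hχeq z hzr (not_lt.1 fun h' => h (hψT z h'))
        exact hz (subset_tsupport χ (by rw [Function.mem_support, this]; exact one_ne_zero))
      have hχz : χ z = 0 := image_eq_zero_of_notMem_tsupport hz
      simp [e1, transport_eq_zero hz, dV_eq_zero _ hz, hψz, hχz]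
  have k0 : Integrable fun z => -(g z * transport (fun z => χ z * φ z) z) := i1.neg
  have l0 : Integrable fun z => -(∑ i, P i z * dV i (fun z => χ z * φ z) z) := s3.neg
  have k1 : Integrable fun z => -(g z * transport (fun z => χ z * φ z) z)
      - ∑ i, g z * dV i (fun z => χ z * Φ i z) z := i1.neg.sub s2
  have k2 : Integrable fun z => -(g z * transport (fun z => χ z * φ z) z)
      - ∑ i, g z * dV i (fun z => χ z * Φ i z) z + g z * φ z * transport χ z := k1.add i6
  have l1 : Integrable fun z => -(∑ i, P i z * dV i (fun z => χ z * φ z) z)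
      + q z * (χ z * φ z) := s3.neg.add i4
  have l2 : Integrable fun z => -(∑ i, P i z * dV i (fun z => χ z * φ z) z)
      + q z * (χ z * φ z) + ∑ i, χ z * Φ i z * H i z := l1.add s5
  have l3 : Integrable fun z => -(∑ i, P i z * dV i (fun z => χ z * φ z) z)
      + q z * (χ z * φ z) + ∑ i, χ z * Φ i z * H i z + g z * φ z * transport χ z := l2.add i6
  have hmain : ∫ z, g z * ψ z ≤ ∫ z, E z := by
    have hI : ∫ z, g z * ψ z = -(∫ z, g z * transport (fun z => χ z * φ z) z)
        - ∑ i, (∫ z, g z * dV i (fun z => χ z * Φ i z) z) + (∫ z, g z * φ z * transport χ z)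
        + ∑ i, (∫ z, g z * Φ i z * dV i χ z) := by
      rw [integral_congr_ae (Eventually.of_forall hpt), integral_add k2 s7,
        integral_add k1 i6, integral_sub k0 s2, integral_neg,
        integral_finsetSum _ fun i _ => i2 i, integral_finsetSum _ fun i _ => i7 i]
    have hE' : ∫ z, E z = -∑ i, (∫ z, P i z * dV i (fun z => χ z * φ z) z)
        + (∫ z, q z * (χ z * φ z)) + ∑ i, (∫ z, χ z * Φ i z * H i z)
        + (∫ z, g z * φ z * transport χ z) + ∑ i, (∫ z, g z * Φ i z * dV i χ z) := by
      rw [hE, integral_add l3 s7, integral_add l2 i6, integral_add l1 s5, integral_add l0 i4, integral_neg, integral_finsetSum _ fun i _ => i3 i,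
        integral_finsetSum _ fun i _ => i5 i, integral_finsetSum _ fun i _ => i7 i]
    rw [hI, hE']
    simp only [hweak, Finset.sum_neg_distrib]
    linarith
  set W : Set (Ph d) := box m ∩ {z | z.1 ≤ T} with hW
  have hWm : MeasurableSet W :=
    (measurableSet_box m).inter (measurableSet_le measurable_fst measurable_const)
  have hEle : ∀ᵐ z, ENNReal.ofReal (E z) ≤ W.indicator (fun z => ENNReal.ofReal (K * (1 + c) * D) *
      ‖(u z + gradNorm H z) * dualSize ψ z‖ₑ) z := by
    filter_upwards [hs.bound_P, hs.bound_q] with z h2 h3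
    by_cases hzT : z.1 < T
    · by_cases hz : z ∈ tsupport χ
      · have hzW : z ∈ W := ⟨hχt.2.2 hz, hzT.le⟩
        rw [indicator_of_mem hzW]
        have hp := hKp c D (g z) (u z) (gradNorm H z) (χ z) (φ z) (transport χ z) (q z)
          (fun i => H i z) (fun i => P i z) (fun i => dV i χ z) (fun i => dφ i z) (fun i => Φ i z)
          hc hD1 (hs.nonneg z) (hs.le_u z) (hχ0 z) (hχ1 z) (gradNorm_nonneg H z) (hTχ z hzT)
          (fun i => hVχ i z) (fun i => abs_le_gradNorm H i z)
          (fun i => (abs_le_gradNorm P i z).trans h2) h3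
        have e1 : ∀ i, dV i (fun z => χ z * φ z) z = χ z * dφ i z + φ z * dV i χ z := fun i => by
          rw [dV_mul i (dχ z) (d1 z), hφ, dV_pathAvg_dualWeight hψ.1]
        rw [Real.enorm_eq_ofReal_abs, ← ENNReal.ofReal_mul (by positivity)]
        refine ENNReal.ofReal_le_ofReal ?_
        rw [hE]
        simp only [e1]
        refine hp.trans (mul_le_mul_of_nonneg_left (le_abs_self _) (by positivity))
      · have hχz : χ z = 0 := image_eq_zero_of_notMem_tsupport hz
        have e1 : ∀ i, dV i (fun z => χ z * φ z) z = 0 := fun i => by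
          rw [dV_mul i (dχ z) (d1 z), hχz, dV_eq_zero i hz]
          ring
        have : E z = 0 := by
          rw [hE]
          simp [e1, hχz, transport_eq_zero hz, dV_eq_zero _ hz]
        simp [this]
    · have hzT' : T ≤ z.1 := not_lt.1 hzT
      have z1 : φ z = 0 := pathAvg_eq_zero hψT hzT'
      have z2 : ∀ i, Φ i z = 0 := fun i => pathAvg_eq_zero hψT hzT'
      have e1 : ∀ i, dV i (fun z => χ z * φ z) z = 0 := fun i => by
        rw [dV_mul i (dχ z) (d1 z), z1, hφ, dV_pathAvg_dualWeight hψ.1,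
          pathAvg_eq_zero hψT hzT']
        ring
      have : E z = 0 := by
        rw [hE]
        simp [e1, z1, z2]
      simp [this]
  have hsubW : W ⊆ box 1 := inter_subset_left.trans (box_mono (hmr'.le.trans hr'))
  have hsubW' : W ⊆ box r' := inter_subset_left.trans (box_mono hmr'.le)
  set U := eLpNorm u 2 (volume.restrict (box r')) with hU
  set X := ENNReal.ofReal τ₀ * eLpNorm ψ 2 +
    ENNReal.ofReal ((τ₀ ^ (6 * d + 2))⁻¹) * eLpNorm ψ 1 with hX
  have hhL := memLp_gradNorm hs.memLp_H
  have hAm := (continuous_dualSize hψ.1).aestronglyMeasurable (μ := volume.restrict W)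
  have hcδ : 1 ≤ (1 + c) / (r' - r) := by
    rw [one_le_div hδ]
    linarith
  have n1 : eLpNorm (fun z => u z + gradNorm H z) 2 (volume.restrict W) ≤
      ENNReal.ofReal ((1 + 2 * Cc) * ((1 + c) / (r' - r))) * U := by
    refine (eLpNorm_add_le hs.memLp_u.1.restrict hhL.1.restrict one_le_two).trans ?_
    have a1 : eLpNorm u 2 (volume.restrict W) ≤ U :=
      eLpNorm_mono_measure _ (Measure.restrict_mono hsubW' le_rfl)
    have a2 := hCc c g u H P q hc hs m r' T (hr.trans hrm.le) hmr' hr' hT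
    refine (add_le_add a1 a2).trans ?_
    rw [← one_add_mul (ENNReal.ofReal _) U]
    gcongr
    rw [← ENNReal.ofReal_one, ← ENNReal.ofReal_add zero_le_one (by have := sub_pos.2 hmr'; positivity)]
    refine ENNReal.ofReal_le_ofReal ?_
    have e : Cc * (1 + c) / (r' - m) = 2 * Cc * ((1 + c) / (r' - r)) := by
      rw [hm]
      have : r' - (r + r') / 2 = (r' - r) / 2 := by ring
      rw [this]
      field_simp
    rw [e]
    linarith
  have n2 : eLpNorm (dualSize ψ) 2 (volume.restrict W) ≤ CA * X :=
    (eLpNorm_mono_measure _ (Measure.restrict_mono hsubW le_rfl)).trans (hCA ψ hψ.1 τ₀ hτ0 hτ1)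
  calc ENNReal.ofReal (∫ z, g z * ψ z) ≤ ENNReal.ofReal (∫ z, E z) := ENNReal.ofReal_le_ofReal hmain
    _ ≤ ∫⁻ z, ENNReal.ofReal (E z) := by
        have hEi : Integrable E := l3.add s7
        rw [integral_eq_lintegral_pos_part_sub_lintegral_neg_part hEi]
        refine ENNReal.ofReal_le_of_le_toReal ?_ |>.trans le_rfl
        exact sub_le_self _ ENNReal.toReal_nonneg
    _ ≤ ∫⁻ z, W.indicator (fun z => ENNReal.ofReal (K * (1 + c) * D) *
          ‖(u z + gradNorm H z) * dualSize ψ z‖ₑ) z := lintegral_mono_ae hEle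
    _ = ENNReal.ofReal (K * (1 + c) * D) *
          eLpNorm (fun z => (u z + gradNorm H z) * dualSize ψ z) 1 (volume.restrict W) := by
        rw [lintegral_indicator hWm, lintegral_const_mul' _ _ ENNReal.ofReal_ne_top,
          eLpNorm_one_eq_lintegral_enorm]
    _ ≤ ENNReal.ofReal (K * (1 + c) * D) *
          (ENNReal.ofReal ((1 + 2 * Cc) * ((1 + c) / (r' - r))) * U * (CA * X)) := by
        refine mul_le_mul_right ((eLpNorm_smul_le_mul_eLpNorm (p := 2) (q := 2) (r := 1) hAm
          (hs.memLp_u.1.add hhL.1).restrict).trans ?_) _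
        exact mul_le_mul' n1 n2
    _ = _ := by
        rw [hD', ENNReal.coe_mul, ENNReal.ofNNReal_toNNReal]
        have e : K * (1 + c) * (2 / (r' - r)) * ((1 + 2 * Cc) * ((1 + c) / (r' - r))) =
            2 * K * (1 + 2 * Cc) * ((1 + c) ^ 2 / (r' - r) ^ 2) := by
          field_simp
        calc _ = ENNReal.ofReal (K * (1 + c) * (2 / (r' - r))) *
              ENNReal.ofReal ((1 + 2 * Cc) * ((1 + c) / (r' - r))) * (CA * U * X) := by ring
          _ = _ := by
            rw [← ENNReal.ofReal_mul (by positivity), e, ENNReal.ofReal_mul (by positivity)]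
            ring

/-! ### Gain of integrability -/

theorem gal_galInv_left (w z : Ph d) : gal (galInv w) (gal w z) = z := by
  simp only [gal, galInv]
  ext1
  · simp
  ext1
  · simp only [smul_neg, add_smul]
    abel
  · simp

theorem eventually_isTestFun_moll {V K : Set (Ph d)} (hV : IsOpen V) (hK : IsCompact K)
    (hKV : K ⊆ V) {u : Ph d → ℝ} (hu : MemLp u 2) (huK : ∀ z ∉ K, u z = 0) :
    ∀ᶠ n in atTop, IsTestFun V (moll (bumpSeq n) u) := by
  have hc : Continuous (Function.uncurry fun w z : Ph d => gal (galInv w) z) :=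
    continuous_gal.comp ((contDiff_galInv.continuous.comp continuous_fst).prodMk continuous_snd)
  have h0 : galInv (0 : Ph d) = 0 := by
    simp [galInv]
  obtain ⟨a, b, ha, -, h0a, hKb, hab⟩ := generalized_tube_lemma (isCompact_singleton (x := 0)) hK
    (n := (Function.uncurry fun w z : Ph d => gal (galInv w) z) ⁻¹' V) (hV.preimage hc) (by
      rintro ⟨w, z⟩ ⟨hw, hz⟩
      rw [mem_singleton_iff] at hw
      simp only at hw hz
      simp only [mem_preimage, Function.uncurry_apply_pair]
      rw [hw, h0, gal_zero_left]
      exact hKV hz)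
  obtain ⟨δ, hδ, hb⟩ := Metric.isOpen_iff.1 ha 0 (h0a rfl)
  filter_upwards [(tendsto_bumpSeq_rOut (d := d)).eventually (gt_mem_nhds hδ)] with n hn
  set S := (Function.uncurry fun w z : Ph d => gal (galInv w) z) ''
    (Metric.closedBall 0 (bumpSeq (d := d) n).rOut ×ˢ K) with hS
  have hSc : IsCompact S := ((isCompact_closedBall _ _).prod hK).image hc
  have hsupp : ∀ z ∉ S, moll (bumpSeq n) u z = 0 := by
    intro z hz
    rw [moll_eq]
    refine integral_eq_zero_of_ae (Eventually.of_forall fun w => ?_)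
    by_cases hw : w ∈ Metric.closedBall (0 : Ph d) (bumpSeq (d := d) n).rOut
    · have : gal w z ∉ K := fun h => hz ⟨(w, gal w z), ⟨hw, h⟩, gal_galInv_left w z⟩
      simp [huK _ this]
    · have : (bumpSeq n).normed volume w = 0 := by
        by_contra h
        have h2 : w ∈ Function.support ((bumpSeq (d := d) n).normed volume) := h
        rw [ContDiffBump.support_normed_eq] at h2
        exact hw (Metric.ball_subset_closedBall h2)
      simp [this]
  refine ⟨contDiff_moll _ (locallyIntegrable_of_memLp hu), HasCompactSupport.intro hSc hsupp, ?_⟩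
  have hss : Function.support (moll (bumpSeq n) u) ⊆ S := fun z hz =>
    by_contra fun h => hz (hsupp z h)
  refine (closure_minimal hss hSc.isClosed).trans ?_
  rintro _ ⟨⟨w, z⟩, ⟨hw, hz⟩, rfl⟩
  exact @hab (w, z) ⟨hb (Metric.closedBall_subset_ball hn hw), hKb hz⟩

theorem moll_nonneg (η : ContDiffBump (0 : Ph d)) {u : Ph d → ℝ} (hu : ∀ z, 0 ≤ u z) (z : Ph d) :
    0 ≤ moll η u z :=
  integral_nonneg fun w => mul_nonneg (hu w) (mollKer_nonneg η z w)

theorem le_of_sq_le_mul {x y X a b i U : ℝ≥0∞} (hx : x ≠ ⊤) (h : x ^ 2 ≤ X * (a * x + b * y))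
    (hy : y ≤ i * (x * U)) : x ≤ X * (a + b * (i * U)) := by
  by_cases h0 : x = 0
  · simp [h0]
  have h1 : x * x ≤ X * (a + b * (i * U)) * x := by
    rw [← sq]
    calc x ^ 2 ≤ X * (a * x + b * (i * (x * U))) := h.trans (by gcongr)
      _ = X * (a + b * (i * U)) * x := by ring
  exact (ENNReal.mul_le_mul_iff_left h0 hx).1 h1

theorem eLpNorm_one_le_of_mul_le {μ : Measure (Ph d)} {g u : Ph d → ℝ}
    (hg : AEStronglyMeasurable g μ) (hu : AEStronglyMeasurable u μ) (hg0 : ∀ z, 0 ≤ g z) {h : ℝ}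
    (hh : 0 < h) (hgu : ∀ z, h * g z ≤ g z * u z) :
    eLpNorm g 1 μ ≤ ENNReal.ofReal h⁻¹ * (eLpNorm g 2 μ * eLpNorm u 2 μ) := by
  have h4 : eLpNorm (g • u) 1 μ ≤ eLpNorm g 2 μ * eLpNorm u 2 μ :=
    eLpNorm_smul_le_mul_eLpNorm (p := 2) (q := 2) (r := 1) hu hg
  refine le_trans ?_ (mul_le_mul_right h4 _)
  have h5 : ENNReal.ofReal h⁻¹ = ‖h⁻¹‖ₑ := by
    rw [Real.enorm_of_nonneg (by positivity)]
  rw [h5, ← eLpNorm_const_smul]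
  refine eLpNorm_mono fun z => ?_
  rw [Real.norm_of_nonneg (hg0 z)]
  refine le_trans ?_ (le_abs_self _)
  change g z ≤ h⁻¹ * (g z * u z)
  rw [inv_mul_eq_div, le_div_iff₀ hh]
  linarith [hgu z]

/-- Restricted to compact sets, the gain follows from the duality estimate for `ψ = g 1_K`, or
rather for its mollifications. -/
theorem EnergySub.gain_of_duality {lam Lam c : ℝ} {g u : Ph d → ℝ}
    {H P : Fin d → Ph d → ℝ} {q : Ph d → ℝ} (hs : EnergySub (box 1) lam Lam c g u H P q) {h : ℝ}
    (hh : 0 < h) (hgu : ∀ z, h * g z ≤ g z * u z) {V K : Set (Ph d)} (hV : IsOpen V)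
    (hK : IsCompact K) (hKV : K ⊆ V) {X a b : ℝ≥0∞}
    (hdual : ∀ ψ : Ph d → ℝ, IsTestFun V ψ → (∀ z, 0 ≤ ψ z) →
      ENNReal.ofReal (∫ z, g z * ψ z) ≤ X * (a * eLpNorm ψ 2 + b * eLpNorm ψ 1)) :
    eLpNorm g 2 (volume.restrict K) ≤
      X * (a + b * (ENNReal.ofReal h⁻¹ * eLpNorm u 2 (volume.restrict K))) := by
  have hKm := hK.measurableSet
  set v := K.indicator g with hv
  have hvL : MemLp v 2 := hs.memLp_g.indicator hKm
  have hv0 : ∀ z, 0 ≤ v z := fun z => indicator_nonneg (fun z _ => hs.nonneg z) z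
  have hvK : ∀ z ∉ K, v z = 0 := fun z hz => indicator_of_notMem hz _
  set x := eLpNorm g 2 (volume.restrict K) with hx
  have hx2 : eLpNorm v 2 = x := eLpNorm_indicator_eq_eLpNorm_restrict hKm
  have hxt : x ≠ ⊤ := by
    rw [← hx2]
    exact hvL.2.ne
  have hx1 : eLpNorm v 1 = eLpNorm g 1 (volume.restrict K) :=
    eLpNorm_indicator_eq_eLpNorm_restrict hKm
  have hlim : Tendsto (fun n => ENNReal.ofReal (∫ z, g z * moll (bumpSeq n) v z)) atTop
      (𝓝 (ENNReal.ofReal (∫ z, g z * v z))) := by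
    have h0 : L2Tendsto (fun _ => g) g := ⟨fun _ => hs.memLp_g, hs.memLp_g, by simp⟩
    exact (ENNReal.continuous_ofReal.tendsto _).comp (h0.integral_mul (L2Tendsto.moll hvL))
  have h1 : ENNReal.ofReal (∫ z, g z * v z) ≤ X * (a * x + b * eLpNorm v 1) := by
    refine le_of_tendsto hlim ?_
    filter_upwards [eventually_isTestFun_moll hV hK hKV hvL hvK] with n hn
    refine (hdual _ hn (moll_nonneg _ hv0)).trans ?_
    rw [← hx2]
    gcongr
    · exact eLpNorm_moll_le _ hvL
    · exact eLpNorm_one_moll_le _ hvL.1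
  have h2 : ENNReal.ofReal (∫ z, g z * v z) = x ^ 2 := by
    rw [hx, eLpNorm_two_restrict_sq hs.memLp_g, ← integral_indicator hKm]
    congr 2
    ext z
    by_cases hz : z ∈ K
    · simp [hv, hz, sq]
    · simp [hv, hz]
  have h3 : eLpNorm v 1 ≤ ENNReal.ofReal h⁻¹ * (x * eLpNorm u 2 (volume.restrict K)) := by
    rw [hx1]
    exact eLpNorm_one_le_of_mul_le hs.memLp_g.1.restrict hs.memLp_u.1.restrict hs.nonneg hh hgu
  exact le_of_sq_le_mul hxt (h2 ▸ h1) h3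

/-- The nonlinear estimate that drives the iteration: if moreover `u ≥ h` where `g > 0`, the norm
of `g` on a smaller box is quadratic in the norm of `u`, up to a term that can be made small. -/
theorem EnergySub.exists_gain (d : ℕ) {lam Lam : ℝ} (hlam : 0 < lam) (hLam : 0 ≤ Lam) :
    ∃ C : ℝ≥0, ∀ (c : ℝ) (g u : Ph d → ℝ) (H P : Fin d → Ph d → ℝ) (q : Ph d → ℝ) (h : ℝ),
      0 ≤ c → EnergySub (box 1) lam Lam c g u H P q → 0 < h → (∀ z, h * g z ≤ g z * u z) →
      ∀ r r' : ℝ, 1 / 2 ≤ r → r < r' → r' ≤ 1 → ∀ τ₀ : ℝ, 0 < τ₀ → τ₀ ≤ 1 →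
        eLpNorm g 2 (volume.restrict (box r)) ≤ C * ENNReal.ofReal ((1 + c) ^ 2 / (r' - r) ^ 2) *
          eLpNorm u 2 (volume.restrict (box r')) * (ENNReal.ofReal τ₀ +
            ENNReal.ofReal ((τ₀ ^ (6 * d + 2))⁻¹) *
              (ENNReal.ofReal h⁻¹ * eLpNorm u 2 (volume.restrict (box r')))) := by
  obtain ⟨C, hC⟩ := EnergySub.exists_duality d hlam hLam
  refine ⟨4 * C, fun c g u H P q h hc hs hh hgu r r' hr hrr' hr' τ₀ hτ0 hτ1 => ?_⟩
  set m := (r + r') / 2 with hm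
  have hrm : r < m := by rw [hm]; linarith
  have hmr' : m < r' := by rw [hm]; linarith
  have hδ : 0 < r' - r := sub_pos.2 hrr'
  have he : ENNReal.ofReal ((1 + c) ^ 2 / (r' - m) ^ 2) =
      4 * ENNReal.ofReal ((1 + c) ^ 2 / (r' - r) ^ 2) := by
    have h4 : (4 : ℝ≥0∞) = ENNReal.ofReal 4 := by simp
    rw [h4, ← ENNReal.ofReal_mul (by norm_num)]
    congr 1
    have : r' - m = (r' - r) / 2 := by rw [hm]; ring
    rw [this]
    field_simp
    norm_num
  set U := eLpNorm u 2 (volume.restrict (box r'))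
  set R := (4 * C : ℝ≥0) * ENNReal.ofReal ((1 + c) ^ 2 / (r' - r) ^ 2) * U *
    (ENNReal.ofReal τ₀ + ENNReal.ofReal ((τ₀ ^ (6 * d + 2))⁻¹) * (ENNReal.ofReal h⁻¹ * U)) with hR
  -- the box is exhausted by compact sets, on which the bounds do not depend on `n`
  have hcomp : ∀ n : ℕ, eLpNorm g 2 (volume.restrict (closedBox r (-1 / (n + 1)))) ≤ R := by
    intro n
    have hT : (-1 / (n + 1) : ℝ) < 0 := div_neg_of_neg_of_pos (by norm_num) (by positivity)
    have hsub := closedBox_subset_box (d := d) hrm hT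
    have hgain := hs.gain_of_duality hh hgu (isOpen_box m) (isCompact_closedBox r (-1 / (n + 1)))
      hsub (fun ψ hψ hψ0 => hC c g u H P q hc hs m r' (hr.trans hrm.le) hmr' hr' ψ hψ hψ0 τ₀ hτ0 hτ1)
    refine hgain.trans ?_
    have hU : eLpNorm u 2 (volume.restrict (closedBox r (-1 / (n + 1)))) ≤ U :=
      eLpNorm_mono_measure _ (Measure.restrict_mono (hsub.trans (box_mono hmr'.le)) le_rfl)
    rw [he, hR]
    push_cast
    calc _ ≤ C * (4 * ENNReal.ofReal ((1 + c) ^ 2 / (r' - r) ^ 2)) * U *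
        (ENNReal.ofReal τ₀ + ENNReal.ofReal ((τ₀ ^ (6 * d + 2))⁻¹) * (ENNReal.ofReal h⁻¹ * U)) := by
          gcongr
      _ = _ := by ring
  have hdir : Directed (· ⊆ ·) fun n : ℕ => closedBox (d := d) r (-1 / (n + 1)) := by
    refine Monotone.directed_le (f := fun n : ℕ => closedBox (d := d) r (-1 / (n + 1))) ?_
    intro n k hnk z hz
    rw [mem_closedBox] at hz ⊢
    refine ⟨⟨hz.1.1, hz.1.2.trans ?_⟩, hz.2⟩
    rw [neg_div, neg_div, neg_le_neg_iff]
    exact one_div_le_one_div_of_le (by positivity) (by exact_mod_cast Nat.succ_le_succ hnk)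
  rw [← ENNReal.pow_le_pow_left_iff two_ne_zero, eLpNorm_two_sq]
  have hcov : box r ⊆ ⋃ n : ℕ, closedBox (d := d) r (-1 / (n + 1)) := by
    intro z hz
    obtain ⟨n, hn⟩ := exists_nat_one_div_lt (neg_pos.2 hz.2.1)
    refine mem_iUnion.2 ⟨n, mem_closedBox.2 ⟨⟨hz.1.le, ?_⟩, hz.2.2.1.le, hz.2.2.2.le⟩⟩
    rw [neg_div]
    linarith
  refine (lintegral_mono_set hcov).trans ?_
  rw [setLIntegral_iUnion_of_directed _ hdir]
  refine iSup_le fun n => ?_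
  rw [← eLpNorm_two_sq]
  gcongr
  exact hcomp n

/-! ### Iteration over levels -/

/-- The smoothed truncations of `f` at all levels `k ≥ 0` are energy sub-solutions on `V`.
The truncation with parameters `k` and `h` lies between `(f - k - 2h)₊` and `(f - k)₊`, and it
vanishes where `f ≤ k + h`; the source, of size `sig`, acts only where `f > k + h`. -/
def HasTruncations (V : Set (Ph d)) (lam Lam sig : ℝ) (f : Ph d → ℝ) : Prop :=
  ∀ k h : ℝ, 0 ≤ k → 0 < h → ∃ (g : Ph d → ℝ) (H P : Fin d → Ph d → ℝ) (q : Ph d → ℝ),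
    EnergySub V lam Lam (sig / h) g (fun z => max (f z - k) 0) H P q ∧
      (∀ z, h * g z ≤ g z * max (f z - k) 0) ∧ ∀ z, max (f z - (k + 2 * h)) 0 ≤ g z

/-- One step of the iteration, with the constants of step `n` in explicit form. -/
theorem HasTruncations.exists_step (d : ℕ) {lam Lam : ℝ} (hlam : 0 < lam) (hLam : 0 ≤ Lam) :
    ∃ C : ℝ, 1 ≤ C ∧ ∀ (sig : ℝ) (f : Ph d → ℝ), 0 ≤ sig → HasTruncations (box 1) lam Lam sig f →
      ∀ (K : ℝ) (n : ℕ) (y τ : ℝ), 0 < K → sig ≤ K → 0 < τ → τ ≤ 1 → 0 ≤ y →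
        eLpNorm (fun z => max (f z - K * (1 - (1 / 2) ^ n)) 0) 2
          (volume.restrict (box (1 / 2 + (1 / 2) ^ (n + 1)))) ≤ ENNReal.ofReal y →
        eLpNorm (fun z => max (f z - K * (1 - (1 / 2) ^ (n + 1))) 0) 2
          (volume.restrict (box (1 / 2 + (1 / 2) ^ (n + 2)))) ≤
          ENNReal.ofReal (C * 16 ^ n * y * (τ + (τ ^ (6 * d + 2))⁻¹ * (4 * 2 ^ n / K * y))) := by
  obtain ⟨C, hC⟩ := EnergySub.exists_gain d hlam hLam
  refine ⟨1024 * C + 1, by have := C.2; linarith [this, C.coe_nonneg], ?_⟩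
  intro sig f hsig hf K n y τ hK hsK hτ hτ1 hy0 hy
  -- the width `h` is chosen such that `k + 2 h` is the next level
  set k := K * (1 - (1 / 2 : ℝ) ^ n) with hk
  set h := K * (1 / 2 : ℝ) ^ (n + 2) with hh
  have hp0 : (0 : ℝ) < (1 / 2) ^ n := by positivity
  have hp1 : (1 / 2 : ℝ) ^ n ≤ 1 := pow_le_one₀ (by norm_num) (by norm_num)
  have e1 : (1 / 2 : ℝ) ^ (n + 1) = (1 / 2) ^ n / 2 := by rw [pow_succ]; ring
  have e2 : (1 / 2 : ℝ) ^ (n + 2) = (1 / 2) ^ n / 4 := by rw [pow_add]; ring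
  have hk0 : 0 ≤ k := mul_nonneg hK.le (by linarith)
  have hh0 : 0 < h := by positivity
  have e2n : (2 : ℝ) ^ n * (1 / 2) ^ n = 1 := by rw [← mul_pow]; norm_num
  have hhi : h⁻¹ = 4 * 2 ^ n / K := by
    rw [inv_eq_iff_eq_inv, inv_div, hh, e2, eq_div_iff (by positivity)]
    linear_combination K * e2n
  obtain ⟨g, H, P, q, hs, hgu, hle⟩ := hf k h hk0 hh0
  have hc : sig / h ≤ 4 * 2 ^ n := by
    rw [div_eq_mul_inv, hhi]
    calc sig * (4 * 2 ^ n / K) ≤ K * (4 * 2 ^ n / K) := by gcongr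
      _ = _ := by field_simp
  have hgain := hC (sig / h) g _ H P q h (by positivity) hs hh0 hgu (1 / 2 + (1 / 2) ^ (n + 2))
    (1 / 2 + (1 / 2) ^ (n + 1)) (by linarith) (by linarith) (by linarith) τ hτ hτ1
  have hkk : K * (1 - (1 / 2) ^ (n + 1)) = k + 2 * h := by
    rw [hk, hh, e1, e2]
    ring
  have hmono : eLpNorm (fun z => max (f z - K * (1 - (1 / 2) ^ (n + 1))) 0) 2
      (volume.restrict (box (1 / 2 + (1 / 2) ^ (n + 2)))) ≤
      eLpNorm g 2 (volume.restrict (box (1 / 2 + (1 / 2) ^ (n + 2)))) := by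
    refine eLpNorm_mono fun z => ?_
    rw [Real.norm_of_nonneg (le_max_right _ _), Real.norm_of_nonneg (hs.nonneg z), hkk]
    exact hle z
  refine (hmono.trans hgain).trans ?_
  have hA : (1 + sig / h) ^ 2 / ((1 / 2 + (1 / 2) ^ (n + 1)) - (1 / 2 + (1 / 2) ^ (n + 2))) ^ 2 ≤
      1024 * (16 : ℝ) ^ n := by
    have e3 : (1 / 2 + (1 / 2) ^ (n + 1)) - (1 / 2 + (1 / 2) ^ (n + 2)) = ((1 / 2 : ℝ) ^ n / 4) := by
      rw [e1, e2]
      ring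
    have h2n : (1 : ℝ) ≤ 2 ^ n := one_le_pow₀ (by norm_num)
    rw [e3, div_le_iff₀ (by positivity)]
    have e4 : (16 : ℝ) ^ n * ((1 / 2) ^ n) ^ 2 = (2 ^ n) ^ 2 := by
      have : (16 : ℝ) ^ n = (2 ^ n) ^ 4 := by rw [← pow_mul, mul_comm, pow_mul]; norm_num
      rw [this]
      linear_combination ((2 ^ n) ^ 2 * ((2 : ℝ) ^ n * (1 / 2) ^ n + 1)) * e2n
    have e5 : 1024 * (16 : ℝ) ^ n * ((1 / 2) ^ n / 4) ^ 2 = (8 * 2 ^ n) ^ 2 := by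
      linear_combination 64 * e4
    rw [e5]
    gcongr
    linarith
  calc _ ≤ C * ENNReal.ofReal (1024 * 16 ^ n) * ENNReal.ofReal y * (ENNReal.ofReal τ +
        ENNReal.ofReal ((τ ^ (6 * d + 2))⁻¹) * (ENNReal.ofReal h⁻¹ * ENNReal.ofReal y)) := by gcongr
    _ = ENNReal.ofReal (1024 * C * 16 ^ n * y * (τ + (τ ^ (6 * d + 2))⁻¹ * (4 * 2 ^ n / K * y))) := by
        rw [hhi, ← ENNReal.ofReal_coe_nnreal, ← ENNReal.ofReal_mul C.coe_nonneg,
          ← ENNReal.ofReal_mul (by positivity), ← ENNReal.ofReal_mul (by positivity),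
          ← ENNReal.ofReal_mul (by positivity), ← ENNReal.ofReal_add (by positivity) (by positivity),
          ← ENNReal.ofReal_mul (by positivity)]
        ring_nf
    _ ≤ _ := by
        refine ENNReal.ofReal_le_ofReal ?_
        have : (0 : ℝ) ≤ (4 * 2 ^ n / K * y) := by positivity
        gcongr
        linarith

/-- The bound from `L²` to `L^∞` on the unit box. -/
theorem HasTruncations.exists_ae_le (d : ℕ) {lam Lam : ℝ} (hlam : 0 < lam) (hLam : 0 ≤ Lam) :
    ∃ C : ℝ, 0 < C ∧ ∀ (sig : ℝ) (f : Ph d → ℝ), 0 ≤ sig → AEStronglyMeasurable f →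
      HasTruncations (box 1) lam Lam sig f → ∀ K : ℝ, 0 < K → sig ≤ K →
        ENNReal.ofReal C * eLpNorm f 2 (volume.restrict (box 1)) ≤ ENNReal.ofReal K →
        ∀ᵐ z ∂volume.restrict (box (1 / 2)), f z ≤ K := by
  obtain ⟨C, hC1, hC⟩ := HasTruncations.exists_step d hlam hLam
  set N := 6 * d + 2 with hN
  -- the ratio `ρ` beats the exponential factors of the step, which are at most `16`, `2` and, from
  -- the parameter `τ = ρ / (2 C 16 ^ n)`, `16 ^ N`
  set ρ : ℝ := 1 / (2 * (16 * 16 ^ N)) with hρ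
  have hρ0 : 0 < ρ := by positivity
  have hρ1 : ρ < 1 := by
    rw [hρ, div_lt_one (by positivity)]
    have : (1 : ℝ) ≤ 16 ^ N := one_le_pow₀ (by norm_num)
    linarith
  -- with this `η`, each of the two terms of the step is half of the next bound `η K ρ ^ (n + 1)`
  set η : ℝ := ρ / (8 * C * (2 * C / ρ) ^ N) with hη
  have hη0 : 0 < η := by positivity
  refine ⟨η⁻¹, by positivity, ?_⟩
  intro sig f hsig hfm hf K hK hsK hle
  have hstep : ∀ n : ℕ, eLpNorm (fun z => max (f z - K * (1 - (1 / 2) ^ n)) 0) 2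
      (volume.restrict (box (1 / 2 + (1 / 2) ^ (n + 1)))) ≤ ENNReal.ofReal (η * K * ρ ^ n) := by
    intro n
    induction n with
    | zero =>
      have e : (1 / 2 + (1 / 2) ^ (0 + 1) : ℝ) = 1 := by norm_num
      rw [e]
      have h1 : eLpNorm (fun z => max (f z - K * (1 - (1 / 2) ^ 0)) 0) 2 (volume.restrict (box 1)) ≤
          eLpNorm f 2 (volume.restrict (box 1)) := by
        refine eLpNorm_mono fun z => ?_
        rw [Real.norm_of_nonneg (le_max_right _ _), Real.norm_eq_abs]
        simp only [pow_zero, sub_self, mul_zero, sub_zero]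
        exact max_le (le_abs_self _) (abs_nonneg _)
      refine h1.trans ?_
      rw [pow_zero, mul_one, ENNReal.ofReal_mul hη0.le]
      refine le_trans (le_of_eq ?_) (mul_le_mul_right hle (ENNReal.ofReal η))
      rw [← mul_assoc, ← ENNReal.ofReal_mul hη0.le, mul_inv_cancel₀ hη0.ne', ENNReal.ofReal_one,
        one_mul]
    | succ n ih =>
      have h16 : (1 : ℝ) ≤ 16 ^ n := one_le_pow₀ (by norm_num)
      have hτ1 : ρ / (2 * C * 16 ^ n) ≤ 1 := by
        rw [div_le_one (by positivity)]
        nlinarith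
      have hs := hC sig f hsig hf K n (η * K * ρ ^ n) (ρ / (2 * C * 16 ^ n)) hK hsK
        (by positivity) hτ1 (by positivity) ih
      refine hs.trans (ENNReal.ofReal_le_ofReal (le_of_eq ?_))
      have hinv : ((ρ / (2 * C * 16 ^ n)) ^ N)⁻¹ = (2 * C / ρ) ^ N * (16 ^ N) ^ n := by
        rw [← inv_pow, inv_div, ← pow_mul, mul_comm N n, pow_mul, ← mul_pow]
        congr 1
        ring
      have hpow : (16 : ℝ) ^ n * (16 ^ N) ^ n * 2 ^ n * ρ ^ n = 1 := by
        rw [← mul_pow, ← mul_pow, ← mul_pow, hρ]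
        have : (16 * 16 ^ N * 2 * (1 / (2 * (16 * 16 ^ N))) : ℝ) = 1 := by field_simp
        rw [this, one_pow]
      have hηe : C * (2 * C / ρ) ^ N * 4 * η = ρ / 2 := by
        rw [hη]
        field_simp
        norm_num
      have hC0 : C ≠ 0 := by positivity
      rw [hinv]
      have t1 : C * 16 ^ n * (η * K * ρ ^ n) * (ρ / (2 * C * 16 ^ n)) = η * K * ρ ^ n * (ρ / 2) := by
        field_simp
      have t2 : C * 16 ^ n * (η * K * ρ ^ n) * ((2 * C / ρ) ^ N * (16 ^ N) ^ n *
          (4 * 2 ^ n / K * (η * K * ρ ^ n))) = η * K * ρ ^ n * (ρ / 2) := by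
        have e1 : 4 * 2 ^ n / K * (η * K * ρ ^ n) = 4 * 2 ^ n * η * ρ ^ n := by field_simp
        rw [e1, ← hηe]
        linear_combination (η * K * ρ ^ n * (C * (2 * C / ρ) ^ N * 4 * η)) * hpow
      rw [mul_add, t1, t2, pow_succ]
      ring
  have hzero : eLpNorm (fun z => max (f z - K) 0) 2 (volume.restrict (box (1 / 2))) = 0 := by
    have hlim : Tendsto (fun n : ℕ => ENNReal.ofReal (η * K * ρ ^ n)) atTop (𝓝 0) := by
      have := (tendsto_pow_atTop_nhds_zero_of_lt_one hρ0.le hρ1).const_mul (η * K)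
      have h2 := (ENNReal.continuous_ofReal.tendsto _).comp this
      rw [mul_zero, ENNReal.ofReal_zero] at h2
      exact h2
    refine le_antisymm (ge_of_tendsto' hlim fun n => ?_) zero_le
    refine le_trans ?_ (hstep n)
    have hsub : box (d := d) (1 / 2) ⊆ box (1 / 2 + (1 / 2) ^ (n + 1)) :=
      box_mono (by have : (0 : ℝ) < (1 / 2) ^ (n + 1) := by positivity
                   linarith)
    refine (eLpNorm_mono fun z => ?_).trans (eLpNorm_mono_measure _ (Measure.restrict_mono hsub le_rfl))
    rw [Real.norm_of_nonneg (le_max_right _ _), Real.norm_of_nonneg (le_max_right _ _)]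
    refine max_le_max (sub_le_sub_left ?_ _) le_rfl
    have : (0 : ℝ) < (1 / 2) ^ n := by positivity
    nlinarith
  have hm : AEStronglyMeasurable (fun z => max (f z - K) 0) (volume.restrict (box (1 / 2))) := by
    have h1 : AEStronglyMeasurable (fun z => f z - K) (volume.restrict (box (1 / 2))) :=
      hfm.restrict.sub aestronglyMeasurable_const
    exact (continuous_id.max continuous_const).comp_aestronglyMeasurable h1
  have h0 := (eLpNorm_eq_zero_iff hm two_ne_zero).1 hzero
  filter_upwards [h0] with z hz
  have : f z - K ≤ max (f z - K) 0 := le_max_left _ _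
  rw [hz] at this
  simp only [Pi.zero_apply] at this
  linarith

/-! ### Kinetic scaling -/

/-- The kinetic dilation by `ρ` followed by the Galilean translation to `z₁`. It maps a unit
cylinder at the origin to the cylinder of radius `ρ` at `z₁`. -/
def zoom (z₁ : Ph d) (ρ : ℝ) (z : Ph d) : Ph d :=
  gal z₁ (ρ ^ 2 * z.1, ρ ^ 3 • z.2.1, ρ • z.2.2)

/-- The inverse of `zoom`. -/
def zoomInv (z₁ : Ph d) (ρ : ℝ) (w : Ph d) : Ph d :=
  ((ρ ^ 2)⁻¹ * (gal (galInv z₁) w).1, (ρ ^ 3)⁻¹ • (gal (galInv z₁) w).2.1,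
    ρ⁻¹ • (gal (galInv z₁) w).2.2)

theorem gal_gal_galInv (w z : Ph d) : gal w (gal (galInv w) z) = z := by
  simp only [gal, galInv]
  ext1
  · simp
  ext1
  · simp only [smul_neg, add_smul, neg_smul]
    abel
  · simp

theorem continuous_zoom (z₁ : Ph d) (ρ : ℝ) : Continuous (zoom z₁ ρ) :=
  (continuous_gal_left z₁).comp (by fun_prop)

theorem contDiff_zoomInv (z₁ : Ph d) (ρ : ℝ) : ContDiff ℝ ∞ (zoomInv z₁ ρ) := by
  have h : ContDiff ℝ ∞ (gal (galInv z₁) : Ph d → Ph d) :=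
    contDiff_gal.comp (contDiff_const.prodMk contDiff_id)
  have h1 := h.snd.fst
  have h2 := h.snd.snd
  exact (contDiff_const.mul h.fst).prodMk ((h1.const_smul _).prodMk (h2.const_smul _))

/-- `zoom` as a homeomorphism. -/
def zoomHomeo (z₁ : Ph d) {ρ : ℝ} (hρ : 0 < ρ) : Ph d ≃ₜ Ph d where
  toFun := zoom z₁ ρ
  invFun := zoomInv z₁ ρ
  left_inv z := by
    simp only [zoomInv, zoom, gal_galInv_left]
    ext1
    · field_simp
    ext1
    · simp [smul_smul, hρ.ne']
    · simp [smul_smul, hρ.ne']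
  right_inv w := by
    have h : (ρ ^ 2 * (zoomInv z₁ ρ w).1, ρ ^ 3 • (zoomInv z₁ ρ w).2.1,
        ρ • (zoomInv z₁ ρ w).2.2) = gal (galInv z₁) w := by
      simp only [zoomInv]
      ext1
      · field_simp
      ext1
      · simp [smul_smul, hρ.ne']
      · simp [smul_smul, hρ.ne']
    rw [zoom, h, gal_gal_galInv]
  continuous_toFun := continuous_zoom z₁ ρ
  continuous_invFun := (contDiff_zoomInv z₁ ρ).continuous

/-- The linear part of `zoom`. -/
def zoomLin (z₁ : Ph d) (ρ : ℝ) : Ph d →L[ℝ] Ph d :=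
  (ρ ^ 2 • ContinuousLinearMap.fst ℝ ℝ (Sp d × Sp d)).prod
    ((ρ ^ 3 • (ContinuousLinearMap.fst ℝ (Sp d) (Sp d)).comp
        (ContinuousLinearMap.snd ℝ ℝ (Sp d × Sp d)) +
      (ρ ^ 2 • ContinuousLinearMap.fst ℝ ℝ (Sp d × Sp d)).smulRight z₁.2.2).prod
    (ρ • (ContinuousLinearMap.snd ℝ (Sp d) (Sp d)).comp
        (ContinuousLinearMap.snd ℝ ℝ (Sp d × Sp d))))

theorem zoomLin_apply (z₁ : Ph d) (ρ : ℝ) (z : Ph d) : zoomLin z₁ ρ z =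
    (ρ ^ 2 * z.1, ρ ^ 3 • z.2.1 + (ρ ^ 2 * z.1) • z₁.2.2, ρ • z.2.2) := rfl

theorem hasFDerivAt_zoom (z₁ : Ph d) (ρ : ℝ) (z : Ph d) :
    HasFDerivAt (zoom z₁ ρ) (zoomLin z₁ ρ) z := by
  have h : zoom z₁ ρ = fun z => z₁ + zoomLin z₁ ρ z := by
    ext1 z
    rw [zoomLin_apply]
    simp only [zoom, gal]
    ext1
    · rfl
    ext1
    · simp [add_assoc]
    · rfl
  rw [h]
  exact (zoomLin z₁ ρ).hasFDerivAt.const_add z₁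

theorem fderiv_comp_zoom (z₁ : Ph d) (ρ : ℝ) {φ : Ph d → ℝ} (hφ : Differentiable ℝ φ) (z e : Ph d) :
    fderiv ℝ (fun z => φ (zoom z₁ ρ z)) z e = fderiv ℝ φ (zoom z₁ ρ z) (zoomLin z₁ ρ e) := by
  have := (hφ (zoom z₁ ρ z)).hasFDerivAt.comp z (hasFDerivAt_zoom z₁ ρ z)
  rw [show (fun z => φ (zoom z₁ ρ z)) = φ ∘ zoom z₁ ρ from rfl, this.fderiv]
  rfl

theorem transport_comp_zoom (z₁ : Ph d) (ρ : ℝ) {φ : Ph d → ℝ} (hφ : Differentiable ℝ φ)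
    (z : Ph d) : transport (fun z => φ (zoom z₁ ρ z)) z = ρ ^ 2 * transport φ (zoom z₁ ρ z) := by
  unfold transport
  rw [fderiv_comp_zoom z₁ ρ hφ, ← smul_eq_mul, ← map_smul]
  congr 1
  rw [zoomLin_apply]
  simp only [zoom, gal, Prod.smul_mk, smul_eq_mul, mul_one, smul_zero, smul_add, smul_smul]
  congr 2
  rw [add_comm]
  congr 2

theorem dV_comp_zoom (z₁ : Ph d) (ρ : ℝ) {φ : Ph d → ℝ} (hφ : Differentiable ℝ φ)
    (i : Fin d) (z : Ph d) : dV i (fun z => φ (zoom z₁ ρ z)) z = ρ * dV i φ (zoom z₁ ρ z) := by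
  unfold dV
  rw [fderiv_comp_zoom z₁ ρ hφ, ← smul_eq_mul, ← map_smul]
  congr 1
  rw [zoomLin_apply]
  simp [eV]

theorem map_zoom_volume (z₁ : Ph d) {ρ : ℝ} (hρ : 0 < ρ) :
    Measure.map (zoom z₁ ρ) volume = ENNReal.ofReal ((ρ ^ (4 * d + 2))⁻¹) • volume := by
  have h1 : Measure.map (fun t : ℝ => ρ ^ 2 * t) volume = ENNReal.ofReal (ρ ^ 2)⁻¹ • volume := by
    have := Measure.map_addHaar_smul (volume : Measure ℝ) (r := ρ ^ 2) (by positivity)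
    simpa [abs_of_pos hρ] using this
  have h2 : Measure.map (fun x : Sp d => ρ ^ 3 • x) volume =
      ENNReal.ofReal ((ρ ^ 3) ^ d)⁻¹ • volume := by
    have := Measure.map_addHaar_smul (volume : Measure (Sp d)) (r := ρ ^ 3) (by positivity)
    rw [finrank_euclideanSpace_fin, abs_of_nonneg (by positivity)] at this
    exact this
  have h3 : Measure.map (fun x : Sp d => ρ • x) volume = ENNReal.ofReal (ρ ^ d)⁻¹ • volume := by
    have := Measure.map_addHaar_smul (volume : Measure (Sp d)) (r := ρ) hρ.ne'
    rw [finrank_euclideanSpace_fin, abs_of_nonneg (by positivity)] at this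
    exact this
  have m1 : Measurable fun t : ℝ => ρ ^ 2 * t := by fun_prop
  have m2 : Measurable fun x : Sp d => ρ ^ 3 • x := by fun_prop
  have m3 : Measurable fun x : Sp d => ρ • x := by fun_prop
  have h4 : Measure.map (Prod.map (fun t : ℝ => ρ ^ 2 * t) (Prod.map (fun x : Sp d => ρ ^ 3 • x)
      fun x : Sp d => ρ • x)) volume = ENNReal.ofReal ((ρ ^ (4 * d + 2))⁻¹) • volume := by
    rw [Measure.volume_eq_prod, Measure.volume_eq_prod, ← Measure.map_prod_map _ _ m1 (m2.prodMap m3),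
      ← Measure.map_prod_map _ _ m2 m3, h1, h2, h3]
    simp only [Measure.prod_smul_left, Measure.prod_smul_right, smul_smul]
    rw [← ENNReal.ofReal_mul (by positivity), ← ENNReal.ofReal_mul (by positivity)]
    congr 2
    rw [← mul_inv, ← mul_inv]
    congr 1
    ring
  have h5 : zoom z₁ ρ = gal z₁ ∘ Prod.map (fun t : ℝ => ρ ^ 2 * t)
      (Prod.map (fun x : Sp d => ρ ^ 3 • x) fun x : Sp d => ρ • x) := rfl
  rw [h5, ← Measure.map_map (continuous_gal_left z₁).measurable (m1.prodMap (m2.prodMap m3)), h4,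
    Measure.map_smul, (measurePreserving_gal_left z₁).map_eq]

theorem measurableEmbedding_zoom (z₁ : Ph d) {ρ : ℝ} (hρ : 0 < ρ) :
    MeasurableEmbedding (zoom z₁ ρ) := (zoomHomeo z₁ hρ).measurableEmbedding

theorem integral_comp_zoom (z₁ : Ph d) {ρ : ℝ} (hρ : 0 < ρ) (F : Ph d → ℝ) :
    ∫ z, F (zoom z₁ ρ z) = (ρ ^ (4 * d + 2))⁻¹ * ∫ z, F z := by
  rw [← (measurableEmbedding_zoom z₁ hρ).integral_map, map_zoom_volume z₁ hρ, integral_smul_measure,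
    ENNReal.toReal_ofReal (by positivity), smul_eq_mul]

theorem memLp_comp_zoom (z₁ : Ph d) {ρ : ℝ} (hρ : 0 < ρ) {u : Ph d → ℝ} (hu : MemLp u 2) :
    MemLp (fun z => u (zoom z₁ ρ z)) 2 := by
  have h : MemLp u 2 (Measure.map (zoom z₁ ρ) volume) := by
    rw [map_zoom_volume z₁ hρ]
    exact hu.smul_measure ENNReal.ofReal_ne_top
  exact (memLp_map_measure_iff h.1 (continuous_zoom z₁ ρ).measurable.aemeasurable).1 h

theorem ae_comp_zoom (z₁ : Ph d) {ρ : ℝ} (hρ : 0 < ρ) {p : Ph d → Prop} (hp : ∀ᵐ z, p z) :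
    ∀ᵐ z, p (zoom z₁ ρ z) := by
  refine ae_of_ae_map (continuous_zoom z₁ ρ).measurable.aemeasurable ?_
  rw [map_zoom_volume z₁ hρ]
  exact Measure.ae_smul_measure hp _

theorem IsTestFun.comp_zoomInv {z₁ : Ph d} {ρ : ℝ} (hρ : 0 < ρ) {W : Set (Ph d)} {φ : Ph d → ℝ}
    (hφ : IsTestFun (zoom z₁ ρ ⁻¹' W) φ) : IsTestFun W fun w => φ (zoomInv z₁ ρ w) := by
  refine ⟨hφ.1.comp (contDiff_zoomInv z₁ ρ), hφ.2.1.comp_homeomorph (zoomHomeo z₁ hρ).symm, ?_⟩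
  have h := tsupport_comp_eq_preimage φ (zoomHomeo z₁ hρ).symm
  refine h.trans_subset fun w hw => ?_
  have h1 : zoom z₁ ρ (zoomInv z₁ ρ w) ∈ W := hφ.2.2 hw
  rwa [show zoom z₁ ρ (zoomInv z₁ ρ w) = w from (zoomHomeo z₁ hρ).apply_symm_apply w] at h1

theorem WeakSub.comp_zoom {z₁ : Ph d} {ρ : ℝ} (hρ : 0 < ρ) {W : Set (Ph d)} {g q : Ph d → ℝ}
    {H P : Fin d → Ph d → ℝ} (hs : WeakSub W g H P q) :
    WeakSub (zoom z₁ ρ ⁻¹' W) (fun z => g (zoom z₁ ρ z)) (fun i z => ρ * H i (zoom z₁ ρ z))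
      (fun i z => ρ * P i (zoom z₁ ρ z)) (fun z => ρ ^ 2 * q (zoom z₁ ρ z)) where
  memLp_g := memLp_comp_zoom z₁ hρ hs.memLp_g
  memLp_H i := (memLp_comp_zoom z₁ hρ (hs.memLp_H i)).const_mul ρ
  memLp_P i := (memLp_comp_zoom z₁ hρ (hs.memLp_P i)).const_mul ρ
  memLp_q := (memLp_comp_zoom z₁ hρ hs.memLp_q).const_mul (ρ ^ 2)
  weakDV φ hφ i := by
    have ht := hφ.comp_zoomInv hρ
    set φ' := fun w => φ (zoomInv z₁ ρ w) with hφ'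
    have hφe : ∀ z, φ z = φ' (zoom z₁ ρ z) := fun z => by
      rw [hφ']
      exact congrArg φ ((zoomHomeo z₁ hρ).symm_apply_apply z).symm
    have hd := ht.1.differentiable (by simp)
    have h1 := hs.weakDV φ' ht i
    rw [funext hφe]
    simp only [dV_comp_zoom z₁ ρ hd]
    rw [integral_comp_zoom z₁ hρ fun z => g z * (ρ * dV i φ' z),
      integral_comp_zoom z₁ hρ fun z => φ' z * (ρ * H i z)]
    simp only [mul_left_comm _ ρ]
    rw [integral_const_mul, integral_const_mul, h1]
    ring
  ineq φ hφ hφ0 := by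
    have ht := hφ.comp_zoomInv hρ
    have h1 := hs.ineq _ ht fun w => hφ0 _
    set φ' := fun w => φ (zoomInv z₁ ρ w) with hφ'
    have hφe : ∀ z, φ z = φ' (zoom z₁ ρ z) := fun z => by
      rw [hφ']
      exact congrArg φ ((zoomHomeo z₁ hρ).symm_apply_apply z).symm
    have hd := ht.1.differentiable (by simp)
    rw [funext hφe]
    simp only [dV_comp_zoom z₁ ρ hd, transport_comp_zoom z₁ ρ hd]
    rw [integral_comp_zoom z₁ hρ fun z => g z * (ρ ^ 2 * transport φ' z),
      integral_comp_zoom z₁ hρ fun z => ρ ^ 2 * q z * φ' z]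
    have e1 : ∀ i, ∫ z, ρ * P i (zoom z₁ ρ z) * (ρ * dV i φ' (zoom z₁ ρ z)) =
        (ρ ^ (4 * d + 2))⁻¹ * ρ ^ 2 * ∫ z, P i z * dV i φ' z := by
      intro i
      rw [integral_comp_zoom z₁ hρ fun z => ρ * P i z * (ρ * dV i φ' z), mul_assoc,
        ← integral_const_mul (ρ ^ 2)]
      congr 2
      ext z
      ring
    simp only [e1, ← Finset.mul_sum, mul_left_comm _ (ρ ^ 2), mul_assoc (ρ ^ 2)]
    rw [integral_const_mul, integral_const_mul]
    have hc : 0 ≤ (ρ ^ (4 * d + 2))⁻¹ * ρ ^ 2 := by positivity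
    have h2 := mul_le_mul_of_nonneg_left h1 hc
    linarith

theorem gradNorm_const_mul_comp {ρ : ℝ} (hρ : 0 ≤ ρ) (H : Fin d → Ph d → ℝ) (Φ : Ph d → Ph d)
    (z : Ph d) : gradNorm (fun i z => ρ * H i (Φ z)) z = ρ * gradNorm H (Φ z) := by
  unfold gradNorm
  simp only [mul_pow]
  rw [← Finset.mul_sum, Real.sqrt_mul (sq_nonneg ρ), Real.sqrt_sq hρ]

theorem EnergySub.comp_zoom {z₁ : Ph d} {ρ : ℝ} (hρ : 0 < ρ) (hρ1 : ρ ≤ 1) {W : Set (Ph d)}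
    {lam Lam c : ℝ} (hLam : 0 ≤ Lam) {g u q : Ph d → ℝ} {H P : Fin d → Ph d → ℝ}
    (hs : EnergySub W lam Lam c g u H P q) :
    EnergySub (zoom z₁ ρ ⁻¹' W) lam Lam (ρ ^ 2 * c) (fun z => g (zoom z₁ ρ z))
      (fun z => u (zoom z₁ ρ z)) (fun i z => ρ * H i (zoom z₁ ρ z))
      (fun i z => ρ * P i (zoom z₁ ρ z)) (fun z => ρ ^ 2 * q (zoom z₁ ρ z)) where
  toWeakSub := hs.toWeakSub.comp_zoom hρ
  nonneg z := hs.nonneg _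
  le_u z := hs.le_u _
  memLp_u := memLp_comp_zoom z₁ hρ hs.memLp_u
  elliptic := by
    filter_upwards [ae_comp_zoom z₁ hρ hs.elliptic] with z hz
    rw [gradNorm_const_mul_comp hρ.le]
    have e : ∑ i, ρ * H i (zoom z₁ ρ z) * (ρ * P i (zoom z₁ ρ z)) =
        ρ ^ 2 * ∑ i, H i (zoom z₁ ρ z) * P i (zoom z₁ ρ z) := by
      rw [Finset.mul_sum]
      exact Finset.sum_congr rfl fun i _ => by ring
    rw [e]
    have := mul_le_mul_of_nonneg_left hz (sq_nonneg ρ)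
    linarith
  bound_P := by
    filter_upwards [ae_comp_zoom z₁ hρ hs.bound_P] with z hz
    rw [gradNorm_const_mul_comp hρ.le, gradNorm_const_mul_comp hρ.le]
    have := mul_le_mul_of_nonneg_left hz hρ.le
    linarith
  bound_q := by
    filter_upwards [ae_comp_zoom z₁ hρ hs.bound_q] with z hz
    rw [gradNorm_const_mul_comp hρ.le, abs_mul, abs_of_nonneg (sq_nonneg ρ)]
    have h1 := mul_le_mul_of_nonneg_left hz (sq_nonneg ρ)
    have h2 : 0 ≤ Lam * (ρ * gradNorm H (zoom z₁ ρ z)) :=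
      mul_nonneg hLam (mul_nonneg hρ.le (gradNorm_nonneg _ _))
    nlinarith

theorem HasTruncations.comp_zoom {z₁ : Ph d} {ρ : ℝ} (hρ : 0 < ρ) (hρ1 : ρ ≤ 1) {W : Set (Ph d)}
    {lam Lam sig : ℝ} (hLam : 0 ≤ Lam) {f : Ph d → ℝ} (hf : HasTruncations W lam Lam sig f) :
    HasTruncations (zoom z₁ ρ ⁻¹' W) lam Lam (ρ ^ 2 * sig) fun z => f (zoom z₁ ρ z) := by
  intro k h hk hh
  obtain ⟨g, H, P, q, hs, h1, h2⟩ := hf k h hk hh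
  have := hs.comp_zoom (z₁ := z₁) hρ hρ1 hLam
  rw [← mul_div_assoc] at this
  exact ⟨_, _, _, _, this, fun z => h1 (zoom z₁ ρ z), fun z => h2 (zoom z₁ ρ z)⟩

/-! ### Smooth truncations -/

/-- A smooth convex function between `(s - 1)₊` and `s₊`: the primitive of the smooth step. -/
def smoothPos (s : ℝ) : ℝ := ∫ t in 0..s, Real.smoothTransition t

theorem deriv_smoothPos : deriv smoothPos = Real.smoothTransition :=
  funext fun s => Real.smoothTransition.continuous.deriv_integral _ 0 s

theorem differentiable_smoothPos : Differentiable ℝ smoothPos := fun s =>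
  (intervalIntegral.integral_hasDerivAt_right
    (Real.smoothTransition.continuous.intervalIntegrable _ _)
    Real.smoothTransition.continuous.aestronglyMeasurable.stronglyMeasurableAtFilter
    Real.smoothTransition.continuous.continuousAt).differentiableAt

theorem contDiff_smoothPos : ContDiff ℝ ∞ smoothPos := by
  rw [contDiff_infty_iff_deriv, deriv_smoothPos]
  exact ⟨differentiable_smoothPos, Real.smoothTransition.contDiff⟩

theorem smoothPos_of_nonpos {s : ℝ} (hs : s ≤ 0) : smoothPos s = 0 := by
  unfold smoothPos
  rw [intervalIntegral.integral_congr (g := fun _ => (0 : ℝ))]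
  · simp
  · intro t ht
    rw [uIcc_of_ge hs] at ht
    exact Real.smoothTransition.zero_of_nonpos ht.2

theorem smoothPos_nonneg (s : ℝ) : 0 ≤ smoothPos s := by
  rcases le_total s 0 with h | h
  · rw [smoothPos_of_nonpos h]
  · exact intervalIntegral.integral_nonneg h fun t _ => Real.smoothTransition.nonneg t

theorem smoothPos_le (s : ℝ) : smoothPos s ≤ max s 0 := by
  rcases le_total s 0 with h | h
  · rw [smoothPos_of_nonpos h]
    exact le_max_right _ _
  · rw [max_eq_left h]
    have := intervalIntegral.integral_mono_on h
      (Real.smoothTransition.continuous.intervalIntegrable (μ := volume) 0 s)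
      (continuous_const.intervalIntegrable 0 s) fun t _ => Real.smoothTransition.le_one t
    rw [intervalIntegral.integral_const, smul_eq_mul, mul_one, sub_zero] at this
    exact this

theorem sub_one_le_smoothPos (s : ℝ) : max (s - 1) 0 ≤ smoothPos s := by
  refine max_le ?_ (smoothPos_nonneg s)
  rcases le_total s 1 with h | h
  · linarith [smoothPos_nonneg s]
  · have h1 := intervalIntegral.integral_add_adjacent_intervals
      (Real.smoothTransition.continuous.intervalIntegrable (μ := volume) 0 1)
      (Real.smoothTransition.continuous.intervalIntegrable (μ := volume) 1 s)
    have h2 : ∫ t in (1 : ℝ)..s, Real.smoothTransition t = s - 1 := by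
      rw [intervalIntegral.integral_congr (g := fun _ => (1 : ℝ))]
      · simp
      · intro t ht
        rw [uIcc_of_le h] at ht
        exact Real.smoothTransition.one_of_one_le ht.1
    have h3 := smoothPos_nonneg 1
    unfold smoothPos at h3 ⊢
    linarith

/-- The truncation `smoothPos` rescaled to the level `k` and the width `h`. -/
def truncAt (k h s : ℝ) : ℝ := h * smoothPos ((s - k) / h)

section truncAt

variable {k h : ℝ}

theorem contDiff_truncAt : ContDiff ℝ ∞ (truncAt k h) :=
  contDiff_const.mul (contDiff_smoothPos.comp ((contDiff_id.sub contDiff_const).div_const h))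

theorem deriv_truncAt (hh : 0 < h) (s : ℝ) :
    deriv (truncAt k h) s = Real.smoothTransition ((s - k) / h) := by
  have h1 : HasDerivAt (fun s => (s - k) / h) (1 / h) s := ((hasDerivAt_id s).sub_const k).div_const h
  have h2 : HasDerivAt smoothPos (Real.smoothTransition ((s - k) / h)) ((s - k) / h) := by
    rw [← deriv_smoothPos]
    exact (differentiable_smoothPos _).hasDerivAt
  have h3 := (h2.comp s h1).const_mul h
  rw [show truncAt k h = fun y => h * (smoothPos ∘ fun s => (s - k) / h) y from rfl, h3.deriv]
  field_simp

theorem deriv_deriv_truncAt (hh : 0 < h) (s : ℝ) :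
    deriv (deriv (truncAt k h)) s = deriv Real.smoothTransition ((s - k) / h) / h := by
  have h1 : HasDerivAt (fun s => (s - k) / h) (1 / h) s := ((hasDerivAt_id s).sub_const k).div_const h
  have h2 := (differentiable_smoothTransition ((s - k) / h)).hasDerivAt
  rw [funext fun s => deriv_truncAt (k := k) hh s, ← mul_one_div]
  exact (h2.comp s h1).deriv

theorem truncAt_nonneg (hh : 0 < h) (s : ℝ) : 0 ≤ truncAt k h s :=
  mul_nonneg hh.le (smoothPos_nonneg _)

theorem truncAt_le (hh : 0 < h) (s : ℝ) : truncAt k h s ≤ max (s - k) 0 := by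
  have := mul_le_mul_of_nonneg_left (smoothPos_le ((s - k) / h)) hh.le
  rwa [mul_max_of_nonneg _ _ hh.le, mul_zero, mul_div_cancel₀ _ hh.ne'] at this

theorem le_truncAt (hh : 0 < h) (s : ℝ) : max (s - (k + h)) 0 ≤ truncAt k h s := by
  have := mul_le_mul_of_nonneg_left (sub_one_le_smoothPos ((s - k) / h)) hh.le
  rw [mul_max_of_nonneg _ _ hh.le, mul_zero, mul_sub, mul_div_cancel₀ _ hh.ne', mul_one] at this
  rwa [show s - (k + h) = s - k - h by ring]

theorem truncAt_of_le (hh : 0 < h) {s : ℝ} (hs : s ≤ k) : truncAt k h s = 0 :=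
  le_antisymm ((truncAt_le hh s).trans (max_le (sub_nonpos.2 hs) le_rfl)) (truncAt_nonneg hh s)

theorem deriv_truncAt_of_le (hh : 0 < h) {s : ℝ} (hs : s ≤ k) : deriv (truncAt k h) s = 0 := by
  rw [deriv_truncAt hh]
  exact Real.smoothTransition.zero_of_nonpos (div_nonpos_of_nonpos_of_nonneg (sub_nonpos.2 hs) hh.le)

end truncAt

/-! ### The coefficients -/

theorem ellipticity_of_eigenvalues {lam Lam : ℝ} (hlam : 0 ≤ lam)
    {A : Matrix (Fin d) (Fin d) ℝ} (hA : A.IsSymm)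
    (hev : ∀ μ : ℝ, Module.End.HasEigenvalue (Matrix.toLin' A) μ → μ ∈ Icc lam Lam) (x : Sp d) :
    lam * ‖x‖ ^ 2 ≤ inner ℝ x (Matrix.toEuclideanLin A x) ∧
      ‖Matrix.toEuclideanLin A x‖ ^ 2 ≤ Lam ^ 2 * ‖x‖ ^ 2 := by
  have hs : (Matrix.toEuclideanLin A).IsSymmetric := by
    rw [Matrix.isSymmetric_toEuclideanLin_iff]
    rw [Matrix.IsHermitian, Matrix.conjTranspose_eq_transpose_of_trivial]
    exact hA
  have hn : Module.finrank ℝ (Sp d) = d := finrank_euclideanSpace_fin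
  set b := hs.eigenvectorBasis hn with hb
  set μ := hs.eigenvalues hn with hμ
  have hμm : ∀ i, μ i ∈ Icc lam Lam := by
    intro i
    refine hev _ (Module.End.hasEigenvalue_of_hasEigenvector
      (x := WithLp.ofLp (b i)) ⟨?_, ?_⟩)
    · rw [Module.End.mem_eigenspace_iff]
      have h1 : Matrix.toEuclideanLin A (b i) = μ i • b i := hs.apply_eigenvectorBasis hn i
      have h2 := congrArg WithLp.ofLp h1
      exact h2
    · intro h
      have : b i = 0 := by
        ext j
        exact congrFun h j
      exact b.orthonormal.ne_zero i this
  have hT : ∀ i, inner ℝ (b i) (Matrix.toEuclideanLin A x) = μ i * inner ℝ (b i) x := by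
    intro i
    have h1 : Matrix.toEuclideanLin A (b i) = μ i • b i := hs.apply_eigenvectorBasis hn i
    rw [← hs (b i) x, h1, real_inner_smul_left]
  have hx := b.sum_sq_norm_inner_right x
  have hTx := b.sum_sq_norm_inner_right (Matrix.toEuclideanLin A x)
  have hxT := b.sum_inner_mul_inner x (Matrix.toEuclideanLin A x)
  constructor
  · rw [← hx, ← hxT, Finset.mul_sum]
    refine Finset.sum_le_sum fun i _ => ?_
    rw [hT, ← real_inner_comm x (b i), Real.norm_eq_abs, sq_abs]
    have := mul_le_mul_of_nonneg_right (hμm i).1 (sq_nonneg (inner ℝ (b i) x))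
    linarith
  · rw [← hx, ← hTx, Finset.mul_sum]
    refine Finset.sum_le_sum fun i _ => ?_
    rw [hT, Real.norm_eq_abs, sq_abs, Real.norm_eq_abs, sq_abs, mul_pow]
    have h0 : 0 ≤ μ i := hlam.trans (hμm i).1
    have := (hμm i).2
    gcongr

/-! ### Truncations of weak sub-solutions -/

theorem integrable_mul_of_locallyIntegrableOn {U : Set (Ph d)} {f φ : Ph d → ℝ}
    (hf : LocallyIntegrableOn f U) (hφ : Continuous φ) (hc : HasCompactSupport φ)
    (hU : tsupport φ ⊆ U) : Integrable fun z => f z * φ z := by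
  have hK : IsCompact (tsupport φ) := hc
  have h1 := (hf.integrableOn_compact_subset hU hK).smul_continuousOn hφ.continuousOn hK
  refine (integrableOn_iff_integrable_of_support_subset fun z hz => ?_).1 h1
  by_contra h
  exact hz (by simp [image_eq_zero_of_notMem_tsupport h])

theorem LocallyIntegrableOn.coord {U : Set (Ph d)} {G : Ph d → Sp d}
    (hG : LocallyIntegrableOn G U) (i : Fin d) : LocallyIntegrableOn (fun z => G z i) U := by
  intro z hz
  obtain ⟨s, hs, hi⟩ := hG z hz
  exact ⟨s, hs, (EuclideanSpace.proj (𝕜 := ℝ) i).integrable_comp hi⟩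

theorem setIntegral_eq_integral_of_support {U : Set (Ph d)} (hU : MeasurableSet U) {F : Ph d → ℝ}
    (h : ∀ z ∉ U, F z = 0) : ∫ z in U, F z = ∫ z, F z := by
  rw [← integral_indicator hU]
  congr 1
  ext z
  by_cases hz : z ∈ U
  · rw [indicator_of_mem hz]
  · rw [indicator_of_notMem hz, h z hz]

theorem continuous_gradV {φ : Ph d → ℝ} (hφ : ContDiff ℝ ∞ φ) : Continuous (gradV φ) := by
  have h : gradV φ = fun z => WithLp.toLp 2 fun i => dV i φ z := by
    ext z i
    exact gradV_apply (hφ.differentiable (by simp) z) i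
  rw [h]
  exact (PiLp.continuous_toLp 2 _).comp (continuous_pi fun i => (contDiff_dV i hφ).continuous)

/-- The weak gradient in coordinates. -/
theorem IsWeakGradV.integral_eq {U : Set (Ph d)} (hU : MeasurableSet U) {f : Ph d → ℝ}
    {G : Ph d → Sp d} (h : IsWeakGradV U f G) {φ : Ph d → ℝ} (hφ : IsTestFun U φ) (i : Fin d) :
    ∫ z, f z * dV i φ z = -∫ z, φ z * G z i := by
  have hK : IsCompact (tsupport φ) := hφ.2.1
  have hφz : ∀ z ∉ tsupport φ, φ z = 0 := fun z hz => image_eq_zero_of_notMem_tsupport hz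
  have hgz : ∀ z ∉ tsupport φ, gradV φ z = 0 := fun z hz => by
    ext i
    rw [gradV_apply (hφ.1.differentiable (by simp) z), dV_eq_zero i hz]
    rfl
  have i1 : Integrable fun z => f z • gradV φ z := by
    have h1 := (h.1.integrableOn_compact_subset hφ.2.2 hK).smul_continuousOn
      (continuous_gradV hφ.1).continuousOn hK
    refine (integrableOn_iff_integrable_of_support_subset fun z hz => ?_).1 h1
    by_contra h
    exact hz (by simp [hgz z h])
  have i2 : Integrable fun z => φ z • G z := by
    have h1 := (h.2.1.integrableOn_compact_subset hφ.2.2 hK).continuousOn_smul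
      hφ.1.continuous.continuousOn hK
    refine (integrableOn_iff_integrable_of_support_subset fun z hz => ?_).1 h1
    by_contra h
    exact hz (by simp [hφz z h])
  have h3 := congrArg (EuclideanSpace.proj (𝕜 := ℝ) i) (h.2.2 φ hφ)
  rw [map_neg, ← ContinuousLinearMap.integral_comp_comm _ i1.integrableOn,
    ← ContinuousLinearMap.integral_comp_comm _ i2.integrableOn] at h3
  have e1 : ∀ z, EuclideanSpace.proj (𝕜 := ℝ) i (f z • gradV φ z) = f z * dV i φ z := fun z => by
    rw [← gradV_apply (hφ.1.differentiable (by simp) z)]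
    rfl
  have e2 : ∀ z, EuclideanSpace.proj (𝕜 := ℝ) i (φ z • G z) = φ z * G z i := fun z => rfl
  simp only [e1, e2] at h3
  rwa [setIntegral_eq_integral_of_support hU fun z hz => by
      rw [dV_eq_zero i fun hz' => hz (hφ.2.2 hz'), mul_zero],
    setIntegral_eq_integral_of_support hU fun z hz => by
      rw [hφz z fun hz' => hz (hφ.2.2 hz'), zero_mul]] at h3

theorem WeakDV.unique {W : Set (Ph d)} (hW : IsOpen W) {g : Ph d → ℝ} {H H' : Fin d → Ph d → ℝ}
    (h : WeakDV W g H) (h' : WeakDV W g H') (hH : ∀ i, LocallyIntegrableOn (H i) W)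
    (hH' : ∀ i, LocallyIntegrableOn (H' i) W) (i : Fin d) : ∀ᵐ z, z ∈ W → H i z = H' i z := by
  have := hW.ae_eq_zero_of_integral_contDiff_smul_eq_zero ((hH i).sub (hH' i)) (by
    intro φ h1 h2 h3
    have e1 := h φ ⟨h1, h2, h3⟩ i
    have e2 := h' φ ⟨h1, h2, h3⟩ i
    have j1 := integrable_mul_of_locallyIntegrableOn (hH i) h1.continuous h2 h3
    have j2 := integrable_mul_of_locallyIntegrableOn (hH' i) h1.continuous h2 h3
    simp only [Pi.sub_apply, smul_eq_mul, mul_sub]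
    simp only [mul_comm (H i _), mul_comm (H' i _)] at j1 j2
    rw [integral_sub j1 j2]
    linarith)
  filter_upwards [this] with z hz hzW
  exact sub_eq_zero.1 (hz hzW)

theorem inner_eq_sum (x y : Sp d) : inner ℝ x y = ∑ i, x i * y i := by
  rw [PiLp.inner_apply]
  exact Finset.sum_congr rfl fun i _ => mul_comm _ _

theorem gradNorm_eq_norm {H : Fin d → Ph d → ℝ} {x : Sp d} {z : Ph d} (h : ∀ i, H i z = x i) :
    gradNorm H z = ‖x‖ := by
  rw [gradNorm, EuclideanSpace.norm_eq]
  simp [h]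

/-- On an open subset of its domain, a weak sub-solution has truncations in the sense of
`HasTruncations`: the chain rule identifies the gradient of the truncated function. -/
theorem IsWeakSubSolution.hasTruncations {lam Lam : ℝ} (hlam : 0 < lam) (hLam : 0 ≤ Lam)
    {U : Set (Ph d)} (hU : IsOpen U) {A : Ph d → Matrix (Fin d) (Fin d) ℝ} {B : Ph d → Sp d}
    {S f : Ph d → ℝ} (hadm : IsAdmissible lam Lam U A B S) (hf : IsWeakSubSolution U A B S f)
    {W : Set (Ph d)} (hW : IsOpen W) (hWU : W ⊆ U) {sig : ℝ}
    (hS : ∀ᵐ z ∂volume.restrict W, |S z| ≤ sig) :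
    HasTruncations W lam Lam sig (W.indicator f) := by
  intro k h hk hh
  have hWm := hW.measurableSet
  have hres : volume.restrict W ≤ volume.restrict U := Measure.restrict_mono hWU le_rfl
  have hac : volume.restrict W ≪ volume.restrict U := hres.absolutelyContinuous
  -- all functions are extended by zero outside `W`
  set f₀ := W.indicator f with hf₀
  have hfL : MemLp f₀ 2 := (memLp_indicator_iff_restrict hWm).2
    (hf.inEnergySpace.memLp.mono_measure hres)
  have hf0 : ∀ z ∉ W, f₀ z = 0 := fun z hz => indicator_of_notMem hz f
  have hf1 : ∀ z ∈ W, f₀ z = f z := fun z hz => indicator_of_mem hz f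
  obtain ⟨G, hG, hGL⟩ := hf.inEnergySpace.grad
  set Gc : Fin d → Ph d → ℝ := fun i => W.indicator fun z => G z i with hGc
  have hGcL : ∀ i, MemLp (Gc i) 2 := fun i => (memLp_indicator_iff_restrict hWm).2
    (((EuclideanSpace.proj (𝕜 := ℝ) i).comp_memLp' hGL).mono_measure hres)
  have htest : ∀ {φ : Ph d → ℝ}, IsTestFun W φ → IsTestFun U φ := fun hφ =>
    ⟨hφ.1, hφ.2.1, hφ.2.2.trans hWU⟩
  have hoff : ∀ {φ : Ph d → ℝ}, IsTestFun W φ → ∀ z ∉ W, z ∉ tsupport φ := fun hφ z hz hz' =>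
    hz (hφ.2.2 hz')
  have hweak : WeakDV W f₀ Gc := by
    intro φ hφ i
    have h1 := hG.integral_eq hU.measurableSet (htest hφ) i
    have e1 : (fun z => f₀ z * dV i φ z) = fun z => f z * dV i φ z := by
      ext z
      by_cases hz : z ∈ W
      · rw [hf1 z hz]
      · rw [dV_eq_zero i (hoff hφ z hz), mul_zero, mul_zero]
    have e2 : (fun z => φ z * Gc i z) = fun z => φ z * G z i := by
      ext z
      by_cases hz : z ∈ W
      · simp only [hGc, indicator_of_mem hz]
      · rw [image_eq_zero_of_notMem_tsupport (hoff hφ z hz), zero_mul, zero_mul]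
    rw [e1, e2, h1]
  -- the truncation starts at the level `k + h` rather than `k`, so that `(f - k)₊ ≥ h` where it is
  -- positive
  set κ := k + h with hκ
  have hκ0 : 0 ≤ κ := by positivity
  set β := truncAt κ h with hβ
  obtain ⟨L, hL0, hL⟩ := exists_deriv_smoothTransition_le
  have hβ1 : ∀ s, 0 ≤ deriv β s := fun s => by
    rw [hβ, deriv_truncAt hh]
    exact Real.smoothTransition.nonneg _
  have hβ1' : ∀ s, deriv β s ≤ 1 := fun s => by
    rw [hβ, deriv_truncAt hh]
    exact Real.smoothTransition.le_one _
  have hβ2 : ∀ s, 0 ≤ deriv (deriv β) s := fun s => by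
    rw [hβ, deriv_deriv_truncAt hh]
    exact div_nonneg (deriv_smoothTransition_nonneg _) hh.le
  have hβ2' : ∀ s, deriv (deriv β) s ≤ L / h := fun s => by
    rw [hβ, deriv_deriv_truncAt hh]
    exact div_le_div_of_nonneg_right (hL _) hh.le
  have hβ0 : β 0 = 0 := truncAt_of_le hh hκ0
  have hdβ0 : deriv β 0 = 0 := deriv_truncAt_of_le hh hκ0
  have hLh : 0 ≤ L / h := by positivity
  have hKb : ∀ s, deriv β s ≤ 1 + L / h ∧ deriv (deriv β) s ≤ 1 + L / h := fun s =>
    ⟨by linarith [hβ1' s], by linarith [hβ2' s]⟩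
  have hcd : ContDiff ℝ ∞ β := contDiff_truncAt
  have hcdd : ContDiff ℝ ∞ (deriv β) := (contDiff_infty_iff_deriv.1 hcd).2
  obtain ⟨Hβ, hHβ, hineq⟩ := hf.renormalized β (by exact_mod_cast contDiff_infty.1 hcd 2) hβ1 hβ2
    ⟨1 + L / h, hKb⟩
  set H : Fin d → Ph d → ℝ := fun i z => deriv β (f₀ z) * Gc i z with hH
  have hchain : WeakDV W (fun z => β (f₀ z)) H := hweak.comp hW hfL hGcL hcd hβ0
    (fun s => by rw [abs_of_nonneg (hβ1 s)]; exact (hKb s).1)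
    (fun s => by rw [abs_of_nonneg (hβ2 s)]; exact (hKb s).2)
  have hHL : ∀ i, MemLp (H i) 2 := fun i => by
    refine (hGcL i).mono ((hcdd.continuous.comp_aestronglyMeasurable hfL.1).mul (hGcL i).1)
      (Eventually.of_forall fun z => ?_)
    rw [norm_mul, Real.norm_of_nonneg (hβ1 _)]
    exact mul_le_of_le_one_left (norm_nonneg _) (hβ1' _)
  have hHloc : ∀ i, LocallyIntegrableOn (H i) W := fun i =>
    (locallyIntegrable_of_memLp (hHL i)).locallyIntegrableOn W
  have hHβloc : ∀ i, LocallyIntegrableOn (fun z => Hβ z i) W := fun i =>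
    (LocallyIntegrableOn.coord hHβ.2.1 i).mono_set hWU
  have hweakβ : WeakDV W (fun z => β (f₀ z)) fun i z => Hβ z i := by
    intro φ hφ i
    rw [← hHβ.integral_eq hU.measurableSet (htest hφ) i]
    congr 1
    ext z
    by_cases hz : z ∈ W
    · simp only [hf1 z hz]
    · rw [dV_eq_zero i (hoff hφ z hz), mul_zero, mul_zero]
  -- weak gradients are unique, so the gradient in the inequality is that of the chain rule
  have hHeq : ∀ᵐ z, z ∈ W → ∀ i, Hβ z i = H i z := by
    have := fun i => hweakβ.unique hW hchain hHβloc hHloc i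
    filter_upwards [ae_all_iff.2 this] with z hz hzW i
    exact hz i hzW
  have hH0 : ∀ z ∉ W, ∀ i, H i z = 0 := fun z hz i => by
    simp only [hH, hGc, indicator_of_notMem hz, mul_zero]
  set P : Fin d → Ph d → ℝ := fun i z => ∑ j, A z i j * H j z with hP
  set q : Ph d → ℝ := fun z => ∑ j, B z j * H j z + S z * deriv β (f₀ z) with hq
  have hP0 : ∀ z ∉ W, ∀ i, P i z = 0 := fun z hz i => by
    simp only [hP, hH0 z hz, mul_zero, Finset.sum_const_zero]
  have hq0 : ∀ z ∉ W, q z = 0 := fun z hz => by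
    simp only [hq, hH0 z hz, mul_zero, Finset.sum_const_zero, hf0 z hz, hdβ0, add_zero]
  -- the vector with the components of the gradient
  set Hv : Ph d → Sp d := fun z => WithLp.toLp 2 fun i => H i z with hHv
  have hHvn : ∀ z, gradNorm H z = ‖Hv z‖ := fun z => gradNorm_eq_norm fun i => rfl
  have hAHv : ∀ z i, Matrix.toEuclideanLin (A z) (Hv z) i = P i z := fun z i => rfl
  have hPn : ∀ z, gradNorm P z = ‖Matrix.toEuclideanLin (A z) (Hv z)‖ := fun z =>
    gradNorm_eq_norm fun i => rfl
  have hell : ∀ᵐ z, z ∈ W → lam * gradNorm H z ^ 2 ≤ ∑ i, H i z * P i z ∧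
      gradNorm P z ^ 2 ≤ Lam ^ 2 * gradNorm H z ^ 2 := by
    rw [← ae_restrict_iff' hWm]
    filter_upwards [hac.ae_le hadm.symm_A, hac.ae_le hadm.eigenvalues_A] with z h1 h2
    have h3 := ellipticity_of_eigenvalues hlam.le h1 h2 (Hv z)
    rw [← hHvn, ← hPn, inner_eq_sum] at h3
    exact h3
  have hbP : ∀ᵐ z, gradNorm P z ≤ Lam * gradNorm H z := by
    filter_upwards [hell] with z hz
    by_cases hzW : z ∈ W
    · have h3 := (hz hzW).2
      rw [← mul_pow] at h3
      exact (pow_le_pow_iff_left₀ (gradNorm_nonneg P z)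
        (mul_nonneg hLam (gradNorm_nonneg H z)) two_ne_zero).1 h3
    · have : gradNorm P z = 0 := by
        unfold gradNorm
        simp [hP0 z hzW]
      rw [this]
      exact mul_nonneg hLam (gradNorm_nonneg H z)
  have hgL : MemLp (gradNorm H) 2 := memLp_gradNorm hHL
  have hmA : ∀ i j, AEStronglyMeasurable (fun z => A z i j) (volume.restrict W) := fun i j =>
    ((hadm.aemeasurable_A i j).mono_measure hres).aestronglyMeasurable
  have hPL : ∀ i, MemLp (P i) 2 := fun i => by
    have e : P i = W.indicator (P i) := by
      ext z
      by_cases hz : z ∈ W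
      · rw [indicator_of_mem hz]
      · rw [indicator_of_notMem hz, hP0 z hz]
    have hm : AEStronglyMeasurable (P i) := by
      rw [e, aestronglyMeasurable_indicator_iff hWm]
      exact Finset.aestronglyMeasurable_fun_sum _ fun j _ => (hmA i j).mul (hHL j).1.restrict
    refine hgL.of_le_mul (c := Lam) hm ?_
    filter_upwards [hbP] with z hz
    rw [Real.norm_of_nonneg (gradNorm_nonneg H z)]
    exact (abs_le_gradNorm P i z).trans hz
  set u : Ph d → ℝ := fun z => max (f₀ z - k) 0 with hu
  have huL : MemLp u 2 := by
    refine hfL.mono ?_ (Eventually.of_forall fun z => ?_)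
    · exact (continuous_id.sub continuous_const |>.max continuous_const).comp_aestronglyMeasurable
        hfL.1
    · rw [Real.norm_of_nonneg (le_max_right _ _), Real.norm_eq_abs]
      exact max_le (by linarith [le_abs_self (f₀ z)]) (abs_nonneg _)
  -- the source acts only where `(f - k)₊ ≥ h`
  have hSsrc : ∀ᵐ z, |S z * deriv β (f₀ z)| ≤ sig / h * u z := by
    rw [ae_restrict_iff' hWm] at hS
    filter_upwards [hS] with z hz
    by_cases hzW : z ∈ W
    · have hSz := hz hzW
      have hsig : 0 ≤ sig := (abs_nonneg _).trans hSz
      rw [abs_mul, abs_of_nonneg (hβ1 _)]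
      rcases le_or_gt (f₀ z) κ with hle | hlt
      · rw [show deriv β (f₀ z) = 0 from deriv_truncAt_of_le hh hle, mul_zero]
        exact mul_nonneg (div_nonneg hsig hh.le) (le_max_right _ _)
      · have h1 : h ≤ u z := le_trans (by rw [hκ] at hlt; linarith) (le_max_left _ _)
        calc |S z| * deriv β (f₀ z) ≤ sig * 1 := mul_le_mul hSz (hβ1' _) (hβ1 _) hsig
          _ = sig / h * h := by field_simp
          _ ≤ _ := by gcongr
    · rw [hf0 z hzW, hdβ0, mul_zero, abs_zero]
      have : u z = 0 := by simp only [hu, hf0 z hzW, zero_sub]; exact max_eq_right (by linarith)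
      rw [this, mul_zero]
  have hBH : ∀ᵐ z, |∑ j, B z j * H j z| ≤ Lam * gradNorm H z := by
    have hB : ∀ᵐ z ∂volume.restrict W, ‖B z‖ ≤ Lam := hac.ae_le hadm.bound_B
    rw [ae_restrict_iff' hWm] at hB
    filter_upwards [hB] with z hz
    by_cases hzW : z ∈ W
    · have e : ∑ j, B z j * H j z = inner ℝ (B z) (Hv z) := (inner_eq_sum (B z) (Hv z)).symm
      rw [e, hHvn]
      exact (abs_real_inner_le_norm _ _).trans
        (mul_le_mul_of_nonneg_right (hz hzW) (norm_nonneg _))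
    · simp only [hH0 z hzW, mul_zero, Finset.sum_const_zero, abs_zero]
      exact mul_nonneg hLam (gradNorm_nonneg H z)
  have hbq : ∀ᵐ z, |q z| ≤ Lam * gradNorm H z + sig / h * u z := by
    filter_upwards [hBH, hSsrc] with z h1 h2
    exact (abs_add_le _ _).trans (add_le_add h1 h2)
  have hqL : MemLp q 2 := by
    have e : q = W.indicator q := by
      ext z
      by_cases hz : z ∈ W
      · rw [indicator_of_mem hz]
      · rw [indicator_of_notMem hz, hq0 z hz]
    have hm : AEStronglyMeasurable q := by
      rw [e, aestronglyMeasurable_indicator_iff hWm]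
      refine (Finset.aestronglyMeasurable_fun_sum _ fun j _ => ?_).add ?_
      · exact (((EuclideanSpace.proj (𝕜 := ℝ) j).continuous.comp_aestronglyMeasurable
          (hadm.aemeasurable_B.mono_measure hres).aestronglyMeasurable)).mul (hHL j).1.restrict
      · exact (hadm.memLp_S.1.mono_measure hres).mul
          (hcdd.continuous.comp_aestronglyMeasurable hfL.1).restrict
    have hbd : MemLp (fun z => Lam * gradNorm H z + sig / h * u z) 2 :=
      (hgL.const_mul Lam).add (huL.const_mul (sig / h))
    refine hbd.mono hm ?_
    filter_upwards [hbq] with z hz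
    exact hz.trans (le_abs_self _)
  have hβL : MemLp (fun z => β (f₀ z)) 2 := by
    refine huL.mono (hcd.continuous.comp_aestronglyMeasurable hfL.1)
      (Eventually.of_forall fun z => ?_)
    rw [Real.norm_of_nonneg (truncAt_nonneg hh _), Real.norm_of_nonneg (le_max_right _ _)]
    exact (truncAt_le hh _).trans (max_le_max (by rw [hκ]; linarith) le_rfl)
  refine ⟨fun z => β (f₀ z), H, P, q, ⟨⟨hβL, hHL, hPL, hqL, hchain, ?_⟩, ?_, ?_, huL, ?_, hbP, hbq⟩,
    ?_, ?_⟩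
  · intro φ hφ hφ0
    have h1 := hineq φ (htest hφ) hφ0
    have hUm := hU.measurableSet
    have zφ : ∀ z ∉ W, φ z = 0 := fun z hz => image_eq_zero_of_notMem_tsupport (hoff hφ z hz)
    have zd : ∀ z ∉ W, ∀ i, dV i φ z = 0 := fun z hz i => dV_eq_zero i (hoff hφ z hz)
    have hgv : ∀ z i, gradV φ z i = dV i φ z := fun z i =>
      gradV_apply (hφ.1.differentiable (by simp) z) i
    have zg : ∀ z ∉ W, gradV φ z = 0 := fun z hz => by
      ext i
      rw [hgv, zd z hz]
      rfl
    have e1 : ∫ z in U, β (f z) * transport φ z = ∫ z, β (f₀ z) * transport φ z := by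
      rw [setIntegral_eq_integral_of_support hUm fun z hz => by
        rw [transport_eq_zero (hoff hφ z fun h => hz (hWU h)), mul_zero]]
      congr 1
      ext z
      by_cases hz : z ∈ W
      · rw [hf1 z hz]
      · rw [transport_eq_zero (hoff hφ z hz), mul_zero, mul_zero]
    have e2 : ∫ z in U, inner ℝ (Matrix.toEuclideanLin (A z) (Hβ z)) (gradV φ z) =
        ∑ i, ∫ z, P i z * dV i φ z := by
      rw [setIntegral_eq_integral_of_support hUm fun z hz => by
        rw [zg z fun h => hz (hWU h), inner_zero_right]]
      rw [← integral_finsetSum _ fun i _ => ?_]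
      · refine integral_congr_ae ?_
        filter_upwards [hHeq] with z hz
        by_cases hzW : z ∈ W
        · have : Hβ z = Hv z := by
            ext i
            exact hz hzW i
          rw [this, inner_eq_sum]
          refine Finset.sum_congr rfl fun i _ => ?_
          rw [hAHv, hgv]
        · simp [zg z hzW, zd z hzW]
      · have : MemLp (dV i φ) 2 := (contDiff_dV i hφ.1).continuous.memLp_of_hasCompactSupport
          (hasCompactSupport_dV i hφ.2.1)
        exact (hPL i).integrable_mul this
    have e3 : ∫ z in U, (inner ℝ (B z) (Hβ z) + S z * deriv β (f z)) * φ z =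
        ∫ z, q z * φ z := by
      rw [setIntegral_eq_integral_of_support hUm fun z hz => by
        rw [zφ z fun h => hz (hWU h), mul_zero]]
      refine integral_congr_ae ?_
      filter_upwards [hHeq] with z hz
      by_cases hzW : z ∈ W
      · have : Hβ z = Hv z := by
          ext i
          exact hz hzW i
        simp only [hq]
        rw [this, inner_eq_sum, hf1 z hzW]
      · simp [zφ z hzW]
    rw [e1, e2, e3] at h1
    exact h1
  · exact fun z => truncAt_nonneg hh _
  · exact fun z => (truncAt_le hh _).trans (max_le_max (by rw [hκ]; linarith) le_rfl)
  · filter_upwards [hell] with z hz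
    by_cases hzW : z ∈ W
    · exact (hz hzW).1
    · have : gradNorm H z = 0 := by
        unfold gradNorm
        simp [hH0 z hzW]
      rw [this]
      simp [hH0 z hzW]
  · intro z
    simp only
    rcases le_or_gt (f₀ z) κ with hle | hlt
    · rw [show β (f₀ z) = 0 from truncAt_of_le hh hle]
      simp
    · have h1 : h ≤ max (f₀ z - k) 0 := le_trans (by rw [hκ] at hlt; linarith) (le_max_left _ _)
      have := mul_le_mul_of_nonneg_left h1 (truncAt_nonneg (k := κ) hh (f₀ z))
      linarith
  · intro z
    have := le_truncAt (k := κ) hh (f₀ z)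
    rwa [hκ, show k + h + h = k + 2 * h by ring] at this

/-! ### Cylinders and the local bound -/

/-- The kinetic cylinder without its final time, an open set. -/
def openCylinder (z₁ : Ph d) (ρ : ℝ) : Set (Ph d) :=
  {z | -ρ ^ 2 < z.1 - z₁.1 ∧ z.1 - z₁.1 < 0 ∧
    ‖z.2.1 - z₁.2.1 - (z.1 - z₁.1) • z₁.2.2‖ < ρ ^ 3 ∧ ‖z.2.2 - z₁.2.2‖ < ρ}

theorem isOpen_openCylinder (z₁ : Ph d) (ρ : ℝ) : IsOpen (openCylinder z₁ ρ) := by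
  have h1 : IsOpen {z : Ph d | -ρ ^ 2 < z.1 - z₁.1} := isOpen_lt (by fun_prop) (by fun_prop)
  have h2 : IsOpen {z : Ph d | z.1 - z₁.1 < 0} := isOpen_lt (by fun_prop) (by fun_prop)
  have h3 : IsOpen {z : Ph d | ‖z.2.1 - z₁.2.1 - (z.1 - z₁.1) • z₁.2.2‖ < ρ ^ 3} :=
    isOpen_lt (by fun_prop) (by fun_prop)
  have h4 : IsOpen {z : Ph d | ‖z.2.2 - z₁.2.2‖ < ρ} := isOpen_lt (by fun_prop) (by fun_prop)
  exact h1.inter (h2.inter (h3.inter h4))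

theorem openCylinder_subset (z₁ : Ph d) (ρ : ℝ) : openCylinder z₁ ρ ⊆ cylinder z₁ ρ :=
  fun _ hz => ⟨hz.1, hz.2.1.le, hz.2.2⟩

theorem measurableSet_cylinder (z₁ : Ph d) (ρ : ℝ) : MeasurableSet (cylinder z₁ ρ) := by
  have h1 : MeasurableSet {z : Ph d | -ρ ^ 2 < z.1 - z₁.1} :=
    (isOpen_lt (by fun_prop) (by fun_prop)).measurableSet
  have h2 : MeasurableSet {z : Ph d | z.1 - z₁.1 ≤ 0} :=
    (isClosed_le (by fun_prop) (by fun_prop)).measurableSet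
  have h3 : MeasurableSet {z : Ph d | ‖z.2.1 - z₁.2.1 - (z.1 - z₁.1) • z₁.2.2‖ < ρ ^ 3} :=
    (isOpen_lt (by fun_prop) (by fun_prop)).measurableSet
  have h4 : MeasurableSet {z : Ph d | ‖z.2.2 - z₁.2.2‖ < ρ} :=
    (isOpen_lt (by fun_prop) (by fun_prop)).measurableSet
  exact h1.inter (h2.inter (h3.inter h4))

theorem zoom_sub_fst (z₁ : Ph d) (ρ : ℝ) (z : Ph d) : (zoom z₁ ρ z).1 - z₁.1 = ρ ^ 2 * z.1 := by
  simp [zoom, gal]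

theorem zoom_sub_pos (z₁ : Ph d) (ρ : ℝ) (z : Ph d) :
    (zoom z₁ ρ z).2.1 - z₁.2.1 - ((zoom z₁ ρ z).1 - z₁.1) • z₁.2.2 = ρ ^ 3 • z.2.1 := by
  rw [zoom_sub_fst]
  simp only [zoom, gal]
  abel

theorem zoom_sub_vel (z₁ : Ph d) (ρ : ℝ) (z : Ph d) :
    (zoom z₁ ρ z).2.2 - z₁.2.2 = ρ • z.2.2 := by
  simp [zoom, gal]

theorem mul_neg_iff_right_neg {a t : ℝ} (ha : 0 < a) : a * t < 0 ↔ t < 0 :=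
  ⟨fun h => by_contra fun h' => absurd (mul_nonneg ha.le (not_lt.1 h')) (not_le.2 h),
    mul_neg_of_pos_of_neg ha⟩

theorem preimage_zoom_openCylinder (z₁ : Ph d) {ρ : ℝ} (hρ : 0 < ρ) :
    zoom z₁ ρ ⁻¹' openCylinder z₁ ρ = box 1 := by
  ext z
  have h2 : 0 < ρ ^ 2 := by positivity
  have h3 : 0 < ρ ^ 3 := by positivity
  simp only [openCylinder, mem_preimage, mem_ofPred_eq, zoom_sub_pos, zoom_sub_vel, norm_smul,
    box]
  rw [zoom_sub_fst, Real.norm_of_nonneg hρ.le, Real.norm_of_nonneg h3.le,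
    mul_lt_iff_lt_one_right h3, mul_lt_iff_lt_one_right hρ, mul_neg_iff_right_neg h2]
  constructor
  · rintro ⟨a, b⟩
    exact ⟨by nlinarith, b⟩
  · rintro ⟨a, b⟩
    exact ⟨by nlinarith, b⟩

theorem preimage_zoom_half_subset (z₁ : Ph d) {ρ : ℝ} (hρ : 0 < ρ) :
    zoom z₁ ρ ⁻¹' openCylinder z₁ (ρ / 2) ⊆ box (1 / 2) := by
  intro z hz
  have h2 : 0 < ρ ^ 2 := by positivity
  have h3 : 0 < ρ ^ 3 := by positivity
  simp only [openCylinder, mem_preimage, mem_ofPred_eq, zoom_sub_pos, zoom_sub_vel, norm_smul] at hz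
  rw [zoom_sub_fst, Real.norm_of_nonneg hρ.le, Real.norm_of_nonneg h3.le,
    mul_neg_iff_right_neg h2] at hz
  refine ⟨?_, hz.2.1, ?_, ?_⟩
  · by_contra h
    have := mul_le_mul_of_nonneg_left (not_lt.1 h) h2.le
    nlinarith [hz.1]
  · by_contra h
    have := mul_le_mul_of_nonneg_left (not_lt.1 h) h3.le
    nlinarith [hz.2.2.1]
  · by_contra h
    have := mul_le_mul_of_nonneg_left (not_lt.1 h) hρ.le
    linarith [hz.2.2.2]

theorem exists_volume_cylinder_le (d : ℕ) : ∃ c : ℝ, 1 ≤ c ∧ ∀ (z₁ : Ph d) (ρ : ℝ), 0 < ρ →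
    volume (cylinder z₁ ρ) ≤ ENNReal.ofReal (c * ρ ^ (4 * d + 2)) := by
  have hfin : volume (closedBox (d := d) 1 0) < ⊤ := (isCompact_closedBox 1 0).measure_lt_top
  have h0 : 0 ≤ (volume (closedBox (d := d) 1 0)).toReal := ENNReal.toReal_nonneg
  refine ⟨(volume (closedBox (d := d) 1 0)).toReal + 1, by linarith, fun z₁ ρ hρ => ?_⟩
  have h2 : 0 < ρ ^ 2 := by positivity
  have h3 : 0 < ρ ^ 3 := by positivity
  have hsub : zoom z₁ ρ ⁻¹' cylinder z₁ ρ ⊆ closedBox 1 0 := by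
    intro z hz
    simp only [cylinder, mem_preimage, mem_ofPred_eq, zoom_sub_pos, zoom_sub_vel, norm_smul] at hz
    rw [zoom_sub_fst, Real.norm_of_nonneg hρ.le, Real.norm_of_nonneg h3.le,
      mul_lt_iff_lt_one_right h3, mul_lt_iff_lt_one_right hρ] at hz
    refine mem_closedBox.2 ⟨⟨?_, ?_⟩, hz.2.2.1.le, hz.2.2.2.le⟩
    · nlinarith [hz.1]
    · by_contra h
      have := mul_pos h2 (not_le.1 h)
      linarith [hz.2.1]
  have h1 : volume (zoom z₁ ρ ⁻¹' cylinder z₁ ρ) =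
      ENNReal.ofReal ((ρ ^ (4 * d + 2))⁻¹) * volume (cylinder z₁ ρ) := by
    rw [← Measure.map_apply (continuous_zoom z₁ ρ).measurable (measurableSet_cylinder z₁ ρ),
      map_zoom_volume z₁ hρ, Measure.smul_apply, smul_eq_mul]
  have h4 : volume (cylinder z₁ ρ) = ENNReal.ofReal (ρ ^ (4 * d + 2)) *
      volume (zoom z₁ ρ ⁻¹' cylinder z₁ ρ) := by
    rw [h1, ← mul_assoc, ← ENNReal.ofReal_mul (by positivity), mul_inv_cancel₀ (by positivity),
      ENNReal.ofReal_one, one_mul]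
  rw [h4, mul_comm, ENNReal.ofReal_mul (by positivity)]
  refine mul_le_mul_left ((measure_mono hsub).trans ?_) _
  rw [ENNReal.le_ofReal_iff_toReal_le hfin.ne (by positivity)]
  linarith

theorem eLpNorm_two_comp_zoom (z₁ : Ph d) {ρ : ℝ} (hρ : 0 < ρ) (u : Ph d → ℝ) :
    eLpNorm (fun z => u (zoom z₁ ρ z)) 2 =
      ENNReal.ofReal ((ρ ^ (2 * d + 1))⁻¹) * eLpNorm u 2 := by
  have h := (measurableEmbedding_zoom z₁ hρ).eLpNorm_map_measure (g := u) (p := 2) (μ := volume)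
  rw [map_zoom_volume z₁ hρ, eLpNorm_smul_measure_of_ne_top (by norm_num)] at h
  refine h.symm.trans ?_
  rw [smul_eq_mul]
  congr 1
  rw [ENNReal.ofReal_rpow_of_nonneg (by positivity) (by positivity)]
  congr 1
  have : (ρ ^ (4 * d + 2))⁻¹ = ((ρ ^ (2 * d + 1))⁻¹) ^ 2 := by
    rw [inv_pow, ← pow_mul]
    congr 2
    ring
  have e : (1 / (2 : ℝ≥0∞)).toReal = 1 / 2 := by simp
  rw [this, e, ← Real.sqrt_eq_rpow, Real.sqrt_sq (by positivity)]

/-- The bound of `f` by a constant `K` on a small cylinder, given a suitable bound in the mean on the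
cylinder of twice the radius. -/
theorem IsWeakSubSolution.exists_local_bound (d : ℕ) {lam Lam : ℝ} (hlam : 0 < lam)
    (hLam : 0 ≤ Lam) :
    ∃ C : ℝ, 0 < C ∧ ∀ (U : Set (Ph d)) (A : Ph d → Matrix (Fin d) (Fin d) ℝ) (B : Ph d → Sp d)
      (S f : Ph d → ℝ), IsOpen U → IsAdmissible lam Lam U A B S → IsWeakSubSolution U A B S f →
      ∀ (z₁ : Ph d) (ρ : ℝ), 0 < ρ → ρ ≤ 1 → openCylinder z₁ ρ ⊆ U → ∀ K : ℝ, 0 < K →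
        (∀ᵐ z ∂volume.restrict (openCylinder z₁ ρ), |S z| ≤ K) →
        ENNReal.ofReal (C * (ρ ^ (2 * d + 1))⁻¹) *
          eLpNorm f 2 (volume.restrict (openCylinder z₁ ρ)) ≤ ENNReal.ofReal K →
        ∀ᵐ z ∂volume.restrict (openCylinder z₁ (ρ / 2)), f z ≤ K := by
  obtain ⟨C, hC0, hC⟩ := HasTruncations.exists_ae_le d hlam hLam
  refine ⟨C, hC0, ?_⟩
  intro U A B S f hU hadm hf z₁ ρ hρ hρ1 hsub K hK hS hle
  set W := openCylinder z₁ ρ with hWdef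
  have hW : IsOpen W := isOpen_openCylinder z₁ ρ
  have htr := (hf.hasTruncations hlam hLam hU hadm hW hsub hS).comp_zoom (z₁ := z₁) hρ hρ1 hLam
  rw [preimage_zoom_openCylinder z₁ hρ] at htr
  have hfL : MemLp (W.indicator f) 2 := (memLp_indicator_iff_restrict hW.measurableSet).2
    (hf.inEnergySpace.memLp.mono_measure (Measure.restrict_mono hsub le_rfl))
  have hbd := hC (ρ ^ 2 * K) _ (by positivity) (memLp_comp_zoom z₁ hρ hfL).1 htr K hK
    (mul_le_of_le_one_left hK.le (pow_le_one₀ hρ.le hρ1)) (by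
      refine le_trans ?_ hle
      rw [ENNReal.ofReal_mul hC0.le, mul_assoc]
      refine mul_le_mul_right ((eLpNorm_mono_measure _ Measure.restrict_le_self).trans ?_) _
      rw [eLpNorm_two_comp_zoom z₁ hρ, eLpNorm_indicator_eq_eLpNorm_restrict hW.measurableSet])
  rw [ae_restrict_iff' (measurableSet_box _)] at hbd
  rw [ae_restrict_iff' (isOpen_openCylinder z₁ _).measurableSet]
  have hmap : ∀ᵐ z ∂(Measure.map (zoom z₁ ρ) volume), z ∈ openCylinder z₁ (ρ / 2) → f z ≤ K := by
    rw [(measurableEmbedding_zoom z₁ hρ).ae_map_iff]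
    filter_upwards [hbd] with z hz hzm
    have hz1 := preimage_zoom_half_subset z₁ hρ hzm
    have hz2 : zoom z₁ ρ z ∈ W := by
      have : z ∈ zoom z₁ ρ ⁻¹' openCylinder z₁ ρ := by
        rw [preimage_zoom_openCylinder z₁ hρ]
        exact box_mono (by norm_num) hz1
      exact this
    have := hz hz1
    rwa [indicator_of_mem hz2] at this
  rw [map_zoom_volume z₁ hρ] at hmap
  have hne : ENNReal.ofReal (ρ ^ (4 * d + 2))⁻¹ ≠ 0 :=
    (ENNReal.ofReal_pos.2 (by positivity)).ne'
  exact (Measure.absolutelyContinuous_smul hne).ae_le hmap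

/-! ### Covering by small cylinders -/

theorem cylinder_subset_cylinder {z₀ z₁ : Ph d} {s s' : ℝ} (hs : 0 < s) (hss : s < s')
    (hz : z₁ ∈ cylinder z₀ s) : cylinder z₁ (s' - s) ⊆ cylinder z₀ s' := by
  rintro z ⟨a1, a2, a3, a4⟩
  obtain ⟨b1, b2, b3, b4⟩ := hz
  obtain ⟨η, hη, rfl⟩ : ∃ η, 0 < η ∧ s' = s + η := ⟨s' - s, by linarith, by ring⟩
  rw [add_sub_cancel_left] at a1 a3 a4
  have hsη : 0 < s * η := mul_pos hs hη
  refine ⟨by nlinarith, by linarith, ?_, ?_⟩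
  · have e : z.2.1 - z₀.2.1 - (z.1 - z₀.1) • z₀.2.2 =
        (z.2.1 - z₁.2.1 - (z.1 - z₁.1) • z₁.2.2) +
        (z₁.2.1 - z₀.2.1 - (z₁.1 - z₀.1) • z₀.2.2) + (z.1 - z₁.1) • (z₁.2.2 - z₀.2.2) := by
      module
    have h1 : ‖(z.1 - z₁.1) • (z₁.2.2 - z₀.2.2)‖ ≤ η ^ 2 * s := by
      rw [norm_smul, Real.norm_eq_abs]
      exact mul_le_mul (abs_le.2 ⟨a1.le, a2.trans (by positivity)⟩) b4.le (norm_nonneg _)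
        (by positivity)
    rw [e]
    have h2 := norm_add₃_le (a := z.2.1 - z₁.2.1 - (z.1 - z₁.1) • z₁.2.2)
      (b := z₁.2.1 - z₀.2.1 - (z₁.1 - z₀.1) • z₀.2.2) (c := (z.1 - z₁.1) • (z₁.2.2 - z₀.2.2))
    have h3 : 0 < η ^ 2 * s := by positivity
    have h4 : 0 < η * s ^ 2 := by positivity
    have h5 : (s + η) ^ 3 = s ^ 3 + η ^ 3 + 3 * (η ^ 2 * s) + 3 * (η * s ^ 2) := by ring
    linarith
  · have e : z.2.2 - z₀.2.2 = (z.2.2 - z₁.2.2) + (z₁.2.2 - z₀.2.2) := by abel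
    rw [e]
    linarith [norm_add_le (z.2.2 - z₁.2.2) (z₁.2.2 - z₀.2.2)]

theorem cylinder_mono (z₀ : Ph d) {s s' : ℝ} (hs : 0 < s) (hss : s ≤ s') :
    cylinder z₀ s ⊆ cylinder z₀ s' := fun _ hz =>
  ⟨lt_of_le_of_lt (neg_le_neg (pow_le_pow_left₀ hs.le hss 2)) hz.1, hz.2.1,
    hz.2.2.1.trans_le (pow_le_pow_left₀ hs.le hss 3), hz.2.2.2.trans_le hss⟩

/-- A bound that holds near every point, in the sense of the small cylinders that end there, holds
almost everywhere. A point strictly before the final time lies in the interior of the small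
cylinder that ends slightly later along its free trajectory; the final time is negligible. -/
theorem ae_cylinder_of_forall_openCylinder {z₀ : Ph d} {s ε : ℝ} (hε : 0 < ε) {p : Ph d → Prop}
    (h : ∀ z₁ ∈ cylinder z₀ s, ∀ᵐ z ∂volume.restrict (openCylinder z₁ ε), p z) :
    ∀ᵐ z ∂volume.restrict (cylinder z₀ s), p z := by
  rw [ae_restrict_iff' (measurableSet_cylinder z₀ s)]
  have hnull : volume {z : Ph d | z.1 = z₀.1} = 0 := by
    have : {z : Ph d | z.1 = z₀.1} = {z₀.1} ×ˢ univ := by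
      ext z
      simp
    rw [this, Measure.volume_eq_prod, Measure.prod_prod]
    simp
  have hmain : volume {z | z ∈ openCylinder z₀ s ∧ ¬ p z} = 0 := by
    refine measure_null_of_locally_null _ fun z hz => ?_
    -- the trajectory `τ ↦ (t + τ, x + τ v, v)` through `z`, followed for a short time
    have hopen := isOpen_openCylinder z₀ s
    have hcont : Continuous fun τ : ℝ => ((z.1 + τ, z.2.1 + τ • z.2.2, z.2.2) : Ph d) := by
      fun_prop
    have h0 : ((z.1 + 0, z.2.1 + (0 : ℝ) • z.2.2, z.2.2) : Ph d) ∈ openCylinder z₀ s := by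
      simpa using hz.1
    have hev := (hcont.tendsto 0).eventually (hopen.mem_nhds h0)
    have hev2 : ∀ᶠ τ in 𝓝 (0 : ℝ), τ < ε ^ 2 := eventually_lt_nhds (by positivity)
    have hev3 := ((hev.and hev2).filter_mono nhdsWithin_le_nhds).and
      (self_mem_nhdsWithin (a := (0 : ℝ)) (s := Ioi 0))
    obtain ⟨τ, ⟨h1, h2⟩, h3⟩ := hev3.exists
    have h3' : 0 < τ := h3
    have hmem : z ∈ openCylinder ((z.1 + τ, z.2.1 + τ • z.2.2, z.2.2) : Ph d) ε := by
      have e : z.2.1 - (z.2.1 + τ • z.2.2) - (z.1 - (z.1 + τ)) • z.2.2 = 0 := by module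
      refine ⟨?_, ?_, ?_, ?_⟩
      · simp only
        linarith
      · simp only
        linarith
      · simp only [e, norm_zero]
        positivity
      · simpa using hε
    have hz1 := h _ (openCylinder_subset _ _ h1)
    rw [ae_restrict_iff' (isOpen_openCylinder _ _).measurableSet] at hz1
    refine ⟨openCylinder ((z.1 + τ, z.2.1 + τ • z.2.2, z.2.2) : Ph d) ε ∩ {z | ¬ p z}, ?_, ?_⟩
    · rw [inter_comm]
      exact inter_mem (mem_of_superset self_mem_nhdsWithin fun w hw => hw.2)
        (mem_nhdsWithin_of_mem_nhds ((isOpen_openCylinder _ _).mem_nhds hmem))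
    · refine measure_mono_null (fun w hw => ?_) (ae_iff.1 hz1)
      exact fun h' => hw.2 (h' hw.1)
  refine measure_mono_null (fun w hw => ?_) (measure_union_null hnull hmain)
  simp only [mem_compl_iff, mem_ofPred_eq, Classical.not_imp] at hw
  obtain ⟨hw1, hw2⟩ := hw
  rcases hw1.2.1.lt_or_eq with h' | h'
  · exact Or.inr ⟨⟨hw1.1, h', hw1.2.2⟩, hw2⟩
  · exact Or.inl (sub_eq_zero.1 h')

/-! ### From the mean square to small exponents -/

theorem eLpNorm_two_le_of_ae_le {α : Type*} [MeasurableSpace α] {μ : Measure α} {f : α → ℝ}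
    {p M N : ℝ} (hp : 0 < p) (hp2 : p ≤ 2) (hM : 0 < M) (hN : 0 ≤ N)
    (hf0 : ∀ᵐ z ∂μ, 0 ≤ f z) (hfM : ∀ᵐ z ∂μ, f z ≤ M)
    (hfN : eLpNorm f (ENNReal.ofReal p) μ ≤ ENNReal.ofReal N) :
    eLpNorm f 2 μ ≤ ENNReal.ofReal (M ^ (1 - p / 2) * N ^ (p / 2)) := by
  have hp0 : ENNReal.ofReal p ≠ 0 := (ENNReal.ofReal_pos.2 hp).ne'
  rw [eLpNorm_eq_lintegral_rpow_enorm_toReal hp0 ENNReal.ofReal_ne_top,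
    ENNReal.toReal_ofReal hp.le] at hfN
  rw [eLpNorm_eq_lintegral_rpow_enorm_toReal two_ne_zero ENNReal.ofNat_ne_top, ENNReal.toReal_ofNat]
  have h1 : (∫⁻ z, ‖f z‖ₑ ^ p ∂μ) ≤ ENNReal.ofReal (N ^ p) := by
    have := ENNReal.rpow_le_rpow hfN hp.le
    rwa [← ENNReal.rpow_mul, one_div_mul_cancel hp.ne', ENNReal.rpow_one,
      ENNReal.ofReal_rpow_of_nonneg hN hp.le] at this
  have h2 : (∫⁻ z, ‖f z‖ₑ ^ (2 : ℝ) ∂μ) ≤ ENNReal.ofReal (M ^ (2 - p) * N ^ p) := by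
    calc (∫⁻ z, ‖f z‖ₑ ^ (2 : ℝ) ∂μ)
        ≤ ∫⁻ z, ENNReal.ofReal (M ^ (2 - p)) * ‖f z‖ₑ ^ p ∂μ := by
          refine lintegral_mono_ae ?_
          filter_upwards [hf0, hfM] with z hz0 hzM
          rw [Real.enorm_of_nonneg hz0, ENNReal.ofReal_rpow_of_nonneg hz0 hp.le,
            ENNReal.ofReal_rpow_of_nonneg hz0 (by norm_num),
            ← ENNReal.ofReal_mul (by positivity)]
          refine ENNReal.ofReal_le_ofReal ?_
          have e : f z ^ (2 : ℝ) = f z ^ (2 - p) * f z ^ p := by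
            rw [← Real.rpow_add_of_nonneg hz0 (by linarith) hp.le, sub_add_cancel]
          rw [e]
          exact mul_le_mul_of_nonneg_right (Real.rpow_le_rpow hz0 hzM (by linarith))
            (by positivity)
      _ = ENNReal.ofReal (M ^ (2 - p)) * ∫⁻ z, ‖f z‖ₑ ^ p ∂μ :=
          lintegral_const_mul' _ _ ENNReal.ofReal_ne_top
      _ ≤ _ := by
          rw [ENNReal.ofReal_mul (by positivity)]
          exact mul_le_mul_right h1 _
  refine (ENNReal.rpow_le_rpow h2 (by norm_num)).trans_eq ?_
  rw [ENNReal.ofReal_rpow_of_nonneg (by positivity) (by norm_num), Real.mul_rpow (by positivity)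
    (by positivity), ← Real.rpow_mul hM.le, ← Real.rpow_mul hN]
  congr 3 <;> ring

/-- The conclusion of the local bound, as a property of the function `f` on the set `Q`: on small
cylinders in `Q`, a level `K ≥ σ` that dominates the mean square of `f` at the scale of the cylinder
dominates `f` on the half cylinder. -/
def HasLocalBound (C σ : ℝ) (Q : Set (Ph d)) (f : Ph d → ℝ) : Prop :=
  ∀ (z₁ : Ph d) (ρ : ℝ), 0 < ρ → ρ ≤ 1 → cylinder z₁ ρ ⊆ Q → ∀ K : ℝ, 0 < K → σ ≤ K →
    ENNReal.ofReal (C * (ρ ^ (2 * d + 1))⁻¹) *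
      eLpNorm f 2 (volume.restrict (cylinder z₁ ρ)) ≤ ENNReal.ofReal K →
    ∀ᵐ z ∂volume.restrict (openCylinder z₁ (ρ / 2)), f z ≤ K

theorem HasLocalBound.ae_le {C σ : ℝ} {Q : Set (Ph d)} {f : Ph d → ℝ}
    (h : HasLocalBound C σ Q f) {z₁ : Ph d} {s s' K : ℝ} (hs : 0 < s) (hss : s < s')
    (hs1 : s' - s ≤ 1) (hQ : cylinder z₁ s' ⊆ Q) (hK : 0 < K) (hσ : σ ≤ K)
    (hle : ENNReal.ofReal (C * ((s' - s) ^ (2 * d + 1))⁻¹) *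
      eLpNorm f 2 (volume.restrict (cylinder z₁ s')) ≤ ENNReal.ofReal K) :
    ∀ᵐ z ∂volume.restrict (cylinder z₁ s), f z ≤ K := by
  refine ae_cylinder_of_forall_openCylinder (ε := (s' - s) / 2) (by linarith) fun w hw => ?_
  have hsub := cylinder_subset_cylinder hs hss hw
  refine h w (s' - s) (by linarith) hs1 (hsub.trans hQ) K hK hσ (le_trans ?_ hle)
  exact mul_le_mul_right (eLpNorm_mono_measure _ (Measure.restrict_mono hsub le_rfl)) _

/-- One step of the iteration in exponents: half of the previous constant is absorbed. -/
theorem rpow_mul_rpow_le_half_add {θ b C V N : ℝ} (hθ : 0 < θ) (hθ1 : θ ≤ 1) (hC : 0 < C)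
    (hV : 0 ≤ V) (hN : 0 ≤ N) :
    2 ^ b * C * (V ^ (1 - θ) * N ^ θ) ≤ V / 2 + (2 ^ (b + 1 - θ) * C) ^ (1 / θ) * N := by
  set G := (2 ^ (b + 1 - θ) * C) ^ (1 / θ) with hG
  have hG0 : 0 ≤ G := by positivity
  have h := Real.geom_mean_le_arith_mean2_weighted (w₁ := 1 - θ) (w₂ := θ) (p₁ := V / 2)
    (p₂ := G * N) (by linarith) hθ.le (by positivity) (by positivity) (by ring)
  have e1 : G ^ θ = 2 ^ (b + 1 - θ) * C := by
    rw [hG, ← Real.rpow_mul (by positivity), one_div_mul_cancel hθ.ne', Real.rpow_one]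
  have e2 : (2 : ℝ) ^ (b + 1 - θ) = 2 ^ b * 2 ^ (1 - θ) := by
    rw [← Real.rpow_add two_pos]
    congr 1
    ring
  have e3 : (V / 2) ^ (1 - θ) * (G * N) ^ θ = 2 ^ b * C * (V ^ (1 - θ) * N ^ θ) := by
    rw [Real.div_rpow hV two_pos.le, Real.mul_rpow hG0 hN, e1, e2]
    have : (2 : ℝ) ^ (1 - θ) ≠ 0 := by positivity
    field_simp
  rw [e3] at h
  have h1 : (1 - θ) * (V / 2) ≤ 1 * (V / 2) :=
    mul_le_mul_of_nonneg_right (by linarith) (by positivity)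
  have h2 : θ * (G * N) ≤ 1 * (G * N) := mul_le_mul_of_nonneg_right hθ1 (by positivity)
  linarith

/-- The local bound with an exponent `p ≤ 1` in place of `2`: on concentric cylinders the mean square
is interpolated between the supremum and the `L^p` norm, and the supremum is absorbed by iteration
over the radii. -/
theorem exists_ae_le_of_hasLocalBound (d : ℕ) {C₀ p : ℝ} (hC₀ : 0 < C₀) (hp : 0 < p) (hp1 : p ≤ 1) :
    ∃ C : ℝ, 1 ≤ C ∧ ∀ (σ : ℝ) (Q : Set (Ph d)) (f : Ph d → ℝ), 0 < σ → HasLocalBound C₀ σ Q f →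
      ∀ (z₁ : Ph d) (δ : ℝ), 0 < δ → δ ≤ 1 → cylinder z₁ δ ⊆ Q →
      MemLp f 2 (volume.restrict (cylinder z₁ δ)) →
      (∀ᵐ z ∂volume.restrict (cylinder z₁ δ), 0 ≤ f z) → ∀ N : ℝ, 0 ≤ N →
      eLpNorm f (ENNReal.ofReal p) (volume.restrict (cylinder z₁ δ)) ≤ ENNReal.ofReal N →
      ∀ᵐ z ∂volume.restrict (cylinder z₁ (δ / 2)), f z ≤ C * (δ ^ (-((4 * d + 2) / p)) * N + σ) := by
  set b : ℝ := (4 * d + 2) / p with hb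
  have hb0 : 0 < b := by positivity
  set θ : ℝ := p / 2 with hθ
  have hθ0 : 0 < θ := by positivity
  have hθ1 : θ ≤ 1 := by rw [hθ]; linarith
  have hbθ : b * θ = 2 * d + 1 := by
    rw [hb, hθ]
    field_simp
    ring
  set G₀ : ℝ := (2 ^ (b + 1 - θ) * C₀) ^ (1 / θ) with hG₀
  have hG₀0 : 0 < G₀ := by positivity
  refine ⟨4 ^ b * (2 * G₀) + 1, by linarith [show 0 < (4 : ℝ) ^ b * (2 * G₀) by positivity], ?_⟩
  intro σ Q f hσ h z₁ δ hδ hδ1 hQ hL2 hf0 N hN hfN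
  set D : ℝ := δ / 4 with hD
  have hD0 : 0 < D := by positivity
  set R' : ℝ := 3 * δ / 4 with hR'
  have hmono : ∀ s, 0 < s → s ≤ δ → cylinder z₁ s ⊆ cylinder z₁ δ :=
    fun s hs hss => cylinder_mono z₁ hs hss
  -- a qualitative bound, on which the iteration starts
  obtain ⟨M₀, hM₀, hM₀f⟩ : ∃ M₀ : ℝ, 0 < M₀ ∧
      ∀ᵐ z ∂volume.restrict (cylinder z₁ R'), f z ≤ M₀ := by
    have hfin : ENNReal.ofReal (C₀ * ((δ - R') ^ (2 * d + 1))⁻¹) *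
        eLpNorm f 2 (volume.restrict (cylinder z₁ δ)) ≠ ⊤ :=
      ENNReal.mul_ne_top ENNReal.ofReal_ne_top hL2.2.ne
    set T := (ENNReal.ofReal (C₀ * ((δ - R') ^ (2 * d + 1))⁻¹) *
        eLpNorm f 2 (volume.restrict (cylinder z₁ δ))).toReal with hT
    have hT0 : 0 ≤ T := ENNReal.toReal_nonneg
    refine ⟨T + σ, by linarith, h.ae_le (s' := δ) (by positivity) (by linarith) (by linarith) hQ
      (by linarith) (by linarith) ?_⟩
    rw [← ENNReal.ofReal_toReal hfin]
    exact ENNReal.ofReal_le_ofReal (by linarith)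
  set E : ℝ := 2 * (G₀ * N) + D ^ b * σ with hE
  have hE0 : 0 < E := by
    have : 0 < D ^ b * σ := by positivity
    have : 0 ≤ G₀ * N := by positivity
    linarith
  have key : ∀ n : ℕ, ∀ s, δ / 2 ≤ s → s < R' → ∀ᵐ z ∂volume.restrict (cylinder z₁ s),
      f z ≤ (R' - s) ^ (-b) * ((1 / 2) ^ n * (D ^ b * M₀) + E) := by
    intro n
    induction n with
    | zero =>
      intro s hs hsR
      have hsub : cylinder z₁ s ⊆ cylinder z₁ R' := cylinder_mono z₁ (by linarith) hsR.le
      filter_upwards [ae_restrict_of_ae_restrict_of_subset hsub hM₀f] with z hz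
      have hx : 0 < R' - s := by linarith
      have h1 : (R' - s) ^ b ≤ D ^ b := Real.rpow_le_rpow hx.le (by linarith) hb0.le
      have h2 : 1 ≤ (R' - s) ^ (-b) * D ^ b := by
        rw [Real.rpow_neg hx.le, inv_mul_eq_div, one_le_div (by positivity)]
        exact h1
      have h3 : 0 ≤ (R' - s) ^ (-b) * E := by positivity
      have h4 := mul_le_mul_of_nonneg_right h2 hM₀.le
      have h5 : (R' - s) ^ (-b) * ((1 / 2) ^ 0 * (D ^ b * M₀) + E) =
        (R' - s) ^ (-b) * D ^ b * M₀ + (R' - s) ^ (-b) * E := by ring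
      rw [h5]
      linarith
    | succ n ih =>
      intro s hs hsR
      obtain ⟨η, hη⟩ : ∃ η, η = (R' - s) / 2 := ⟨_, rfl⟩
      have hη0 : 0 < η := by rw [hη]; linarith
      have hs' : (s + η) < R' := by linarith
      have ih' := ih (s + η) (by linarith) hs'
      have e1 : R' - (s + η) = η := by rw [hη]; ring
      have e2 : R' - s = 2 * η := by rw [hη]; ring
      rw [e1] at ih'
      rw [e2]
      obtain ⟨V, hV⟩ : ∃ V, V = (1 / 2) ^ n * (D ^ b * M₀) + E := ⟨_, rfl⟩
      have hV0 : 0 < V := by rw [hV]; positivity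
      rw [← hV] at ih'
      have eV : (1 / 2 : ℝ) ^ (n + 1) * (D ^ b * M₀) + E = V / 2 + E / 2 := by
        rw [hV, pow_succ]
        ring
      rw [eV]
      have hK : 0 < (2 * η) ^ (-b) * (V / 2 + E / 2) := by positivity
      have hsub : cylinder z₁ (s + η) ⊆ cylinder z₁ δ := hmono _ (by linarith) (by linarith)
      refine h.ae_le (s' := s + η) (by linarith) (by linarith) (by linarith) (hsub.trans hQ) hK
        ?_ ?_
      · have hx : 0 < 2 * η := by linarith
        have h1 : (2 * η) ^ b ≤ D ^ b := Real.rpow_le_rpow hx.le (by linarith) hb0.le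
        have h2 : 1 ≤ (2 * η) ^ (-b) * D ^ b := by
          rw [Real.rpow_neg hx.le, inv_mul_eq_div, one_le_div (by positivity)]
          exact h1
        have h3 : D ^ b * σ ≤ V / 2 + E / 2 := by
          have : E ≤ V := by
            rw [hV]
            linarith [show 0 < (1 / 2 : ℝ) ^ n * (D ^ b * M₀) by positivity]
          have : 0 ≤ G₀ * N := by positivity
          linarith
        calc σ ≤ (2 * η) ^ (-b) * D ^ b * σ := le_mul_of_one_le_left hσ.le h2
          _ = (2 * η) ^ (-b) * (D ^ b * σ) := by ring
          _ ≤ _ := mul_le_mul_of_nonneg_left h3 (by positivity)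
      · have hμ : volume.restrict (cylinder z₁ (s + η)) ≤ volume.restrict (cylinder z₁ δ) :=
          Measure.restrict_mono hsub le_rfl
        have hint := eLpNorm_two_le_of_ae_le (M := η ^ (-b) * V) hp (by linarith)
          (by positivity) hN (ae_restrict_of_ae_restrict_of_subset hsub hf0) ih'
          ((eLpNorm_mono_measure _ hμ).trans hfN)
        rw [add_sub_cancel_left]
        refine (mul_le_mul_right hint _).trans ?_
        rw [← ENNReal.ofReal_mul (by positivity)]
        refine ENNReal.ofReal_le_ofReal ?_
        rw [← hθ, Real.mul_rpow (by positivity) hV0.le]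
        -- the power of the radius is the one that turns `η ^ (-b * (1 - θ))` into `η ^ (-b)`
        have e3 : (η ^ (2 * d + 1))⁻¹ * (η ^ (-b)) ^ (1 - θ) = η ^ (-b) := by
          rw [← Real.rpow_natCast, ← Real.rpow_neg hη0.le, ← Real.rpow_mul hη0.le,
            ← Real.rpow_add hη0]
          congr 1
          push_cast
          linear_combination hbθ
        have e4 : (2 * η) ^ (-b) = (2 ^ b)⁻¹ * η ^ (-b) := by
          rw [Real.mul_rpow two_pos.le hη0.le, Real.rpow_neg two_pos.le]
        have h5 := rpow_mul_rpow_le_half_add (b := b) hθ0 hθ1 hC₀ hV0.le hN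
        have h6 : 2 ^ b * C₀ * (V ^ (1 - θ) * N ^ θ) ≤ V / 2 + E / 2 := by
          refine h5.trans ?_
          have : 0 ≤ D ^ b * σ := by positivity
          linarith
        have h7 : C₀ * (V ^ (1 - θ) * N ^ θ) ≤ (2 ^ b)⁻¹ * (V / 2 + E / 2) := by
          rw [inv_mul_eq_div, le_div_iff₀ (by positivity)]
          linarith
        calc C₀ * (η ^ (2 * d + 1))⁻¹ * ((η ^ (-b)) ^ (1 - θ) * V ^ (1 - θ) * N ^ θ)
            = ((η ^ (2 * d + 1))⁻¹ * (η ^ (-b)) ^ (1 - θ)) * (C₀ * (V ^ (1 - θ) * N ^ θ)) := by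
              ring
          _ ≤ η ^ (-b) * ((2 ^ b)⁻¹ * (V / 2 + E / 2)) := by
              rw [e3]
              exact mul_le_mul_of_nonneg_left h7 (by positivity)
          _ = _ := by
              rw [e4]
              ring
  have hall := ae_all_iff.2 fun n => key n (δ / 2) le_rfl (by linarith)
  filter_upwards [hall] with z hz
  have e1 : R' - δ / 2 = D := by rw [hR', hD]; ring
  rw [e1] at hz
  have hlim : Tendsto (fun n : ℕ => D ^ (-b) * ((1 / 2 : ℝ) ^ n * (D ^ b * M₀) + E)) atTop
      (𝓝 (D ^ (-b) * (0 * (D ^ b * M₀) + E))) :=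
    (((tendsto_pow_atTop_nhds_zero_of_lt_one (by norm_num) (by norm_num)).mul_const _).add_const
      _).const_mul _
  refine (ge_of_tendsto' hlim hz).trans ?_
  have e2 : D ^ (-b) = 4 ^ b * δ ^ (-b) := by
    rw [hD, Real.div_rpow hδ.le (by norm_num), Real.rpow_neg (by norm_num : (0 : ℝ) ≤ 4), div_inv_eq_mul,
      mul_comm]
  have e3 : D ^ (-b) * D ^ b = 1 := by
    rw [← Real.rpow_add hD0, neg_add_cancel, Real.rpow_zero]
  have h1 : 0 ≤ 4 ^ b * (2 * G₀) * σ := by positivity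
  have h2 : 0 ≤ δ ^ (-b) * N := by positivity
  calc D ^ (-b) * (0 * (D ^ b * M₀) + E)
      = D ^ (-b) * (2 * (G₀ * N)) + D ^ (-b) * D ^ b * σ := by rw [hE]; ring
    _ = 4 ^ b * (2 * G₀) * (δ ^ (-b) * N) + σ := by rw [e3, e2]; ring
    _ ≤ _ := by
      linear_combination h1 + h2

/-- The local bound in terms of a norm with exponent `ζ ≥ p`, by Hölder's inequality on the small
cylinders. -/
theorem exists_ae_le_of_hasLocalBound_of_le (d : ℕ) {C₀ p : ℝ} (hC₀ : 0 < C₀) (hp : 0 < p)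
    (hp1 : p ≤ 1) :
    ∃ C : ℝ, 1 ≤ C ∧ ∀ (σ : ℝ) (f : Ph d → ℝ) (z₀ : Ph d) (r R ζ F : ℝ), 0 < σ → 0 < r → r < R →
      R ≤ 1 → p ≤ ζ → HasLocalBound C₀ σ (cylinder z₀ R) f →
      MemLp f 2 (volume.restrict (cylinder z₀ R)) →
      (∀ᵐ z ∂volume.restrict (cylinder z₀ R), 0 ≤ f z) → 0 ≤ F →
      eLpNorm f (ENNReal.ofReal ζ) (volume.restrict (cylinder z₀ R)) ≤ ENNReal.ofReal F →
      ∀ᵐ z ∂volume.restrict (cylinder z₀ r),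
        f z ≤ C * ((R - r) ^ (-((4 * d + 2) / ζ)) * F + σ) := by
  obtain ⟨C₁, hC₁, h₁⟩ := exists_ae_le_of_hasLocalBound d hC₀ hp hp1
  obtain ⟨c, hc1, hc⟩ := exists_volume_cylinder_le d
  have hc0 : 0 < c := by linarith
  have hcp : 1 ≤ c ^ (1 / p) := Real.one_le_rpow hc1 (by positivity)
  refine ⟨C₁ * c ^ (1 / p), by nlinarith, ?_⟩
  intro σ f z₀ r R ζ F hσ hr hrR hR hpζ hloc hL2 hf0 hF hfF
  have hζ : 0 < ζ := hp.trans_le hpζ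
  obtain ⟨δ, hδ⟩ : ∃ δ, δ = R - r := ⟨_, rfl⟩
  have hδ0 : 0 < δ := by linarith
  rw [← hδ]
  refine ae_cylinder_of_forall_openCylinder (ε := δ / 2) (by linarith) fun z₁ hz₁ => ?_
  have hsub : cylinder z₁ δ ⊆ cylinder z₀ R := by
    rw [hδ]
    exact cylinder_subset_cylinder hr hrR hz₁
  have hμ : volume.restrict (cylinder z₁ δ) ≤ volume.restrict (cylinder z₀ R) :=
    Measure.restrict_mono hsub le_rfl
  have hL2' := hL2.mono_measure hμ
  obtain ⟨a, ha⟩ : ∃ a, a = 1 / p - 1 / ζ := ⟨_, rfl⟩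
  have ha0 : 0 ≤ a := by
    rw [ha, sub_nonneg]
    exact one_div_le_one_div_of_le hp hpζ
  have hN : eLpNorm f (ENNReal.ofReal p) (volume.restrict (cylinder z₁ δ)) ≤
      ENNReal.ofReal (F * (c * δ ^ (4 * d + 2)) ^ a) := by
    refine (eLpNorm_le_eLpNorm_mul_rpow_measure_univ (ENNReal.ofReal_le_ofReal hpζ)
      hL2'.1).trans ?_
    rw [ENNReal.toReal_ofReal hp.le, ENNReal.toReal_ofReal hζ.le, Measure.restrict_apply_univ, ← ha,
      ENNReal.ofReal_mul hF, ← ENNReal.ofReal_rpow_of_nonneg (by positivity) ha0]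
    exact mul_le_mul' ((eLpNorm_mono_measure _ hμ).trans hfF)
      (ENNReal.rpow_le_rpow (hc z₁ δ hδ0) ha0)
  have hb := h₁ σ _ f hσ hloc z₁ δ hδ0 (by linarith) hsub hL2'
    (ae_restrict_of_ae_restrict_of_subset hsub hf0) _ (by positivity) hN
  have hsub2 := openCylinder_subset z₁ (δ / 2)
  filter_upwards [ae_restrict_of_ae_restrict_of_subset hsub2 hb] with z hz
  refine hz.trans ?_
  rw [mul_assoc]
  refine mul_le_mul_of_nonneg_left ?_ (by linarith)
  rw [mul_add]
  refine add_le_add ?_ (le_mul_of_one_le_left hσ.le hcp)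
  have e1 : (c * δ ^ (4 * d + 2)) ^ a = c ^ a * δ ^ ((4 * d + 2) * a) := by
    rw [Real.mul_rpow hc0.le (by positivity), ← Real.rpow_natCast, ← Real.rpow_mul hδ0.le]
    push_cast
    rfl
  have e2 : δ ^ (-((4 * d + 2) / p)) * δ ^ ((4 * d + 2) * a) = δ ^ (-((4 * d + 2) / ζ)) := by
    rw [← Real.rpow_add hδ0, ha]
    congr 1
    ring
  have h3 : c ^ a ≤ c ^ (1 / p) := Real.rpow_le_rpow_of_exponent_le hc1 (by
    rw [ha]
    linarith [one_div_pos.2 hζ])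
  calc δ ^ (-((4 * d + 2) / p)) * (F * (c * δ ^ (4 * d + 2)) ^ a)
      = c ^ a * ((δ ^ (-((4 * d + 2) / p)) * δ ^ ((4 * d + 2) * a)) * F) := by rw [e1]; ring
    _ ≤ _ := by
      rw [e2]
      exact mul_le_mul_of_nonneg_right h3 (by positivity)

/-- The factor in the final estimate dominates both `1` and the natural power of the gap `R - r`. -/
theorem one_le_rpow_and_rpow_le {v r R ζ : ℝ} (d : ℕ) (hv : 0 ≤ v) (hr : 0 < r) (hrR : r < R)
    (hR : R ≤ 1) (hζ : 0 < ζ) :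
    1 ≤ ((1 + v) / (r ^ 2 * (R - r) ^ 3)) ^ ((1 + 4 * (d : ℝ)) / ζ) ∧
      (R - r) ^ (-((4 * (d : ℝ) + 2) / ζ)) ≤
        ((1 + v) / (r ^ 2 * (R - r) ^ 3)) ^ ((1 + 4 * (d : ℝ)) / ζ) := by
  obtain ⟨δ, hδ⟩ : ∃ δ, δ = R - r := ⟨_, rfl⟩
  have hδ0 : 0 < δ := by linarith
  have hδ1 : δ ≤ 1 := by linarith
  rw [← hδ]
  have hδ3 : 0 < δ ^ 3 := by positivity
  have hr2 : r ^ 2 ≤ 1 := pow_le_one₀ hr.le (by linarith)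
  have h1 : (δ ^ 3)⁻¹ ≤ (1 + v) / (r ^ 2 * δ ^ 3) := by
    rw [inv_eq_one_div]
    exact div_le_div₀ (by linarith) (by linarith) (by positivity)
      (mul_le_of_le_one_left hδ3.le hr2)
  have h2 : 1 ≤ (δ ^ 3)⁻¹ := (one_le_inv₀ hδ3).2 (pow_le_one₀ hδ0.le hδ1)
  have he : 0 ≤ (1 + 4 * (d : ℝ)) / ζ := by positivity
  refine ⟨Real.one_le_rpow (h2.trans h1) he, le_trans ?_ (Real.rpow_le_rpow (by positivity) h1 he)⟩
  rw [← Real.rpow_natCast, ← Real.rpow_neg hδ0.le, ← Real.rpow_mul hδ0.le]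
  refine Real.rpow_le_rpow_of_exponent_ge hδ0 hδ1 ?_
  push_cast
  rw [neg_mul, neg_le_neg_iff, ← mul_div_assoc]
  gcongr
  have : (0 : ℝ) ≤ d := Nat.cast_nonneg d
  linarith

theorem hasLocalBound_of_openCylinder {C σ : ℝ} {U Q : Set (Ph d)} {S f : Ph d → ℝ}
    (hC : ∀ (z₁ : Ph d) (ρ : ℝ), 0 < ρ → ρ ≤ 1 → openCylinder z₁ ρ ⊆ U → ∀ K : ℝ, 0 < K →
        (∀ᵐ z ∂volume.restrict (openCylinder z₁ ρ), |S z| ≤ K) →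
        ENNReal.ofReal (C * (ρ ^ (2 * d + 1))⁻¹) *
          eLpNorm f 2 (volume.restrict (openCylinder z₁ ρ)) ≤ ENNReal.ofReal K →
        ∀ᵐ z ∂volume.restrict (openCylinder z₁ (ρ / 2)), f z ≤ K) (hQ : Q ⊆ U)
    (hS : ∀ᵐ z ∂volume.restrict Q, |S z| ≤ σ) : HasLocalBound C σ Q f := by
  intro z₁ ρ hρ hρ1 hsub K hK hσ hle
  have hsub' := openCylinder_subset z₁ ρ
  refine hC z₁ ρ hρ hρ1 ((hsub'.trans hsub).trans hQ) K hK ?_ (le_trans ?_ hle)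
  · filter_upwards [ae_restrict_of_ae_restrict_of_subset (hsub'.trans hsub) hS] with z hz
    exact hz.trans hσ
  · exact mul_le_mul_right (eLpNorm_mono_measure _ (Measure.restrict_mono hsub' le_rfl)) _

end KineticFP

end

theorem proposition2p4 (d : ℕ) (hd : 1 ≤ d) (lam Lam : ℝ) (hlam : 0 < lam) (hLam : lam < Lam)
    (ζ₀ : ℝ) (hζ₀ : 0 < ζ₀) :
    ∃ C : ℝ, 0 < C ∧
      ∀ (U : Set (KineticFP.Ph d)) (A : KineticFP.Ph d → Matrix (Fin d) (Fin d) ℝ)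
        (B : KineticFP.Ph d → KineticFP.Sp d) (S f : KineticFP.Ph d → ℝ),
        IsOpen U → KineticFP.IsAdmissible lam Lam U A B S →
        KineticFP.IsWeakSubSolution U A B S f → (∀ᵐ z ∂volume.restrict U, 0 ≤ f z) →
        ∀ (z₀ : KineticFP.Ph d) (r R : ℝ), 0 < r → r < R → R ≤ 1 →
          KineticFP.cylinder z₀ R ⊆ U →
          ∀ ζ : ℝ, ζ₀ ≤ ζ →
            eLpNorm f ∞ (volume.restrict (KineticFP.cylinder z₀ r)) ≤
              ENNReal.ofReal (C *
                ((1 + ‖z₀.2.2‖) / (r ^ 2 * (R - r) ^ 3)) ^ ((1 + 4 * (d : ℝ)) / ζ)) *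
              (eLpNorm f (ENNReal.ofReal ζ) (volume.restrict (KineticFP.cylinder z₀ R)) +
                eLpNorm S ∞ (volume.restrict (KineticFP.cylinder z₀ R))) := by
  obtain ⟨C₀, hC₀, h₀⟩ := KineticFP.IsWeakSubSolution.exists_local_bound d hlam
    (hlam.trans hLam).le
  obtain ⟨C₁, hC₁, h₁⟩ := KineticFP.exists_ae_le_of_hasLocalBound_of_le d hC₀
    (lt_min hζ₀ one_pos) (min_le_right ζ₀ 1)
  refine ⟨C₁ * 2, by linarith, ?_⟩
  intro U A B S f hU hadm hf hf0 z₀ r R hr hrR hR hsub ζ hζ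
  have hζ0 : 0 < ζ := hζ₀.trans_le hζ
  obtain ⟨hY1, hYδ⟩ := KineticFP.one_le_rpow_and_rpow_le d (norm_nonneg z₀.2.2) hr hrR hR hζ0
  obtain ⟨Y, hY⟩ : ∃ Y, Y = ((1 + ‖z₀.2.2‖) / (r ^ 2 * (R - r) ^ 3)) ^ ((1 + 4 * (d : ℝ)) / ζ) :=
    ⟨_, rfl⟩
  rw [← hY] at hY1 hYδ ⊢
  have hμ := Measure.restrict_mono hsub (le_refl (volume : Measure (KineticFP.Ph d)))
  set μ := volume.restrict (KineticFP.cylinder z₀ R) with hμdef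
  have hrsub : KineticFP.cylinder z₀ r ⊆ KineticFP.cylinder z₀ R :=
    KineticFP.cylinder_mono z₀ hr hrR.le
  have hL2 : MemLp f 2 μ := hf.inEnergySpace.memLp.mono_measure hμ
  have hSfin : eLpNorm S ∞ μ ≠ ⊤ := (hadm.memLp_S.mono_measure hμ).2.ne
  have hf0R : ∀ᵐ z ∂μ, 0 ≤ f z := ae_restrict_of_ae_restrict_of_subset hsub hf0
  have hCY : 0 < C₁ * 2 * Y := by positivity
  by_cases hFtop : eLpNorm f (ENNReal.ofReal ζ) μ = ⊤
  · rw [hFtop, top_add, ENNReal.mul_top (ENNReal.ofReal_pos.2 hCY).ne']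
    exact le_top
  obtain ⟨F, hF⟩ : ∃ F, F = (eLpNorm f (ENNReal.ofReal ζ) μ).toReal := ⟨_, rfl⟩
  obtain ⟨s, hs⟩ : ∃ s, s = (eLpNorm S ∞ μ).toReal := ⟨_, rfl⟩
  have hF0 : 0 ≤ F := hF ▸ ENNReal.toReal_nonneg
  have hs0 : 0 ≤ s := hs ▸ ENNReal.toReal_nonneg
  have hFe : eLpNorm f (ENNReal.ofReal ζ) μ = ENNReal.ofReal F := by
    rw [hF, ENNReal.ofReal_toReal hFtop]
  have hse : eLpNorm S ∞ μ = ENNReal.ofReal s := by rw [hs, ENNReal.ofReal_toReal hSfin]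
  have hSs : ∀ᵐ z ∂μ, |S z| ≤ s := by
    have h := ae_le_eLpNormEssSup (f := S) (μ := μ)
    rw [← eLpNorm_exponent_top, hse] at h
    filter_upwards [h] with z hz
    rwa [Real.enorm_eq_ofReal_abs, ENNReal.ofReal_le_ofReal_iff hs0] at hz
  rw [hFe, hse, ← ENNReal.ofReal_add hF0 hs0, ← ENNReal.ofReal_mul hCY.le, eLpNorm_exponent_top]
  refine eLpNormEssSup_le_of_ae_bound ?_
  suffices hle : ∀ᵐ z ∂volume.restrict (KineticFP.cylinder z₀ r), f z ≤ C₁ * 2 * Y * (F + s) by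
    filter_upwards [hle, ae_restrict_of_ae_restrict_of_subset hrsub hf0R] with z hz hz0
    rwa [Real.norm_of_nonneg hz0]
  rcases (add_nonneg hF0 hs0).eq_or_lt with h0 | hpos
  · -- without source and with vanishing norm, `f` vanishes
    have hFz : F = 0 := by linarith
    rw [hFz, ENNReal.ofReal_zero, eLpNorm_eq_zero_iff hL2.1 (ENNReal.ofReal_pos.2 hζ0).ne'] at hFe
    filter_upwards [ae_restrict_of_ae_restrict_of_subset hrsub hFe] with z hz
    rw [hz, ← h0, mul_zero]
    exact le_rfl
  · have hloc : KineticFP.HasLocalBound C₀ (F + s) (KineticFP.cylinder z₀ R) f :=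
      KineticFP.hasLocalBound_of_openCylinder (h₀ U A B S f hU hadm hf) hsub
        (hSs.mono fun z hz => hz.trans (by linarith))
    have hb := h₁ (F + s) f z₀ r R ζ F hpos hr hrR hR ((min_le_left _ _).trans hζ) hloc hL2 hf0R
      hF0 hFe.le
    filter_upwards [hb] with z hz
    refine hz.trans ?_
    rw [mul_assoc, mul_assoc]
    refine mul_le_mul_of_nonneg_left ?_ (by linarith)
    have h1 := mul_le_mul_of_nonneg_right hYδ hF0
    have h2 := mul_le_mul_of_nonneg_right hY1 hpos.le
    have h3 : 0 ≤ Y * s := mul_nonneg (by linarith) hs0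
    linarith
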